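/- **Setting.** Signals are measurable functions $u:\mathbb R\to\mathbb R^m$ vanishing for $t<0$. Put $R_{uv}(\tau)=\lim_{T\to\infty}\frac1T\int_0^T u(t+\tau)v(t)'\,dt$. The (cross) spectral density $S_{uv}(j\omega)$ is the Fourier transform of $R_{uv}$, in the sense that $R_{uv}(\tau)=\frac1{2\pi}\int S_{uv}(j\omega)e^{j\omega\tau}\,d\omega$ for all $\tau$; it may contain impulses, that is, $S_{uv}(j\omega)\,d\omega$ may be any finite complex matrix-valued measure (so that constant and sinusoidal signals are included). $\mathcal P$ is the set of bounded signals $u$ for which $R_{uu}(\tau)$ exists for all $\tau$, the spectral density $S_{uu}$ exists, and $\|u\|_{\mathcal P}^2=\lim_{T\to\infty}\frac1T\int_0^T\|u(t)\|^2dt$ exists and is finite. Signals $u,v$ are orthogonal if $S_{uv}=0$. $\mathcal{RL}_\infty$ is the set of proper real-rational transfer matrices $M(s)$ without poles on the imaginary axis, $\|M\|_\infty=\sup_\omega\bar\sigma(M(j\omega))$, $M^*(s)=M(-s)'$. Such an $M$ acts on signals by $y=Mu$, $y(t)=Du(t)+\int h(t-s)u(s)\,ds$ for $t\ge0$ (and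 $y(t)=0$ for $t<0$), where $D\delta+h$, $h\in L^1(\mathbb R)$ (not necessarily causal), is the impulse response, $M(j\omega)=D+\int h(t)e^{-j\omega t}dt$. Consider the plant $\dot x=Ax+B_1w+B_2u$, $z=C_1(C_2x-r)+D_{12}u$, $y=C_2x+D_{21}w$, a controller $\mathbf C=(A_c,B_c,C_c,D_c)$ driven by $y-r$ and a controller $\mathbf K=(A_k,B_k,C_k,D_k)$ driven by $y$, both stabilizing, i.e. the matrices $$\begin{bmatrix}A+B_2D_\bullet C_2&B_2C_\bullet\\B_\bullet C_2&A_\bullet\end{bmatrix},\qquad \bullet\in\{c,k\},$$ are Hurwitz, and matrices $L,L_c$ such that $A+LC_2$ and $A_c+L_cC_c$ are Hurwitz. The closed loop, starting from rest, is formed by the plant and the two-controller structure $$\dot x_c=(A_c+L_cC_c)x_c-L_cu+(B_c+L_cD_c)(y-r),\quad u_c=C_cx_c+D_c(y-r),$$ $$\dot{\hat x}=A\hat x+B_2u+Lf,\quad f=C_2\hat x-y,\quad \dot x_q=A_qx_q+B_qf,\quad u_q=C_qx_q+D_qf,\quad u=u_c+u_q,$$ with $D_q=D_c-D_k$, $C_q=[-C_c\;\;-D_qC_2\;\;C_k]$,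 $$A_q=\begin{bmatrix}A_c+L_cC_c&(B_c+L_cD_q)C_2&-L_cC_k\\0&A+B_2D_kC_2&B_2C_k\\0&B_kC_2&A_k\end{bmatrix},\qquad B_q=\begin{bmatrix}-B_c-L_cD_q\\L-B_2D_k\\-B_k\end{bmatrix}.$$ Let $T_{z_1w}$ be the transfer matrix from $w$ to $z_1=C_1C_2x+D_{12}u$ of the plant with $r=0$ in closed loop with $u=\mathbf Ky$ (its feedthrough is $D_{12}D_kD_{21}$), and $T_{z_2r}$ the transfer matrix from $r$ to $z$ of the plant with $w=0$ in closed loop with $u=\mathbf C(y-r)$. **Theorem.** Let $r\in\mathcal P$. (i) Let $w=W(r)+w_1$, where $W\in\mathcal{RL}_\infty$, $W(r)$ is the output of the LTI map $W$ for the input $r$, and $w_1\in\mathcal P$ is orthogonal to both $r$ and $W(r)$. Let $z$ be the closed-loop output for $(w,r)$, and $z_1=T_{z_1w}w_1$, $z_2=T_{z_2r}r$, $\tilde z_2=T_{z_1w}W(r)+z_2$. Then $W(r),w,z,z_1,z_2,\tilde z_2\in\mathcal P$ and, for every real $\gamma$, $$\|z\|_{\mathcal P}^2=\|z_1\|_{\mathcal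 P}^2+\|\tilde z_2\|_{\mathcal P}^2,$$ $$\|z\|_{\mathcal P}^2-\gamma^2\|w\|_{\mathcal P}^2=\|z_1\|_{\mathcal P}^2-\gamma^2\|w_1\|_{\mathcal P}^2+\|\tilde z_2\|_{\mathcal P}^2-\gamma^2\|W(r)\|_{\mathcal P}^2,$$ $$\|z_1\|_{\mathcal P}^2=\frac1{2\pi}\int\mathrm{Tr}[T_{z_1w}S_{w_1w_1}T_{z_1w}^*]\,d\omega,\qquad \|z_2\|_{\mathcal P}^2=\frac1{2\pi}\int\mathrm{Tr}[T_{z_2r}S_{rr}T_{z_2r}^*]\,d\omega .$$ (ii) Suppose moreover that $\gamma>0$ and $\|T_{z_1w}\|_\infty<\gamma$, and put $$J=\frac1{2\pi}\int\mathrm{Tr}\big[S_{rr}T_{z_2r}^*(I-\gamma^{-2}T_{z_1w}T_{z_1w}^*)^{-1}T_{z_2r}\big]\,d\omega .$$ Then $$\sup_{W\in\mathcal{RL}_\infty}\{\|\tilde z_2\|_{\mathcal P}^2-\gamma^2\|W(r)\|_{\mathcal P}^2\}=J,$$ and the supremum is attained at $\widetilde W=(\gamma^2I-T_{z_1w}^*T_{z_1w})^{-1}T_{z_1w}^*T_{z_2r}\in\mathcal{RL}_\infty$.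 Furthermore $$\sup_{w}\{\|z\|_{\mathcal P}^2-\gamma^2\|w\|_{\mathcal P}^2\}=\sup_{w_1\in\mathcal P}\{\|z_1\|_{\mathcal P}^2-\gamma^2\|w_1\|_{\mathcal P}^2\}+\sup_{W\in\mathcal{RL}_\infty}\{\|\tilde z_2\|_{\mathcal P}^2-\gamma^2\|W(r)\|_{\mathcal P}^2\}\le J,$$ both when $w$ ranges over all signals in $\mathcal P$ for which $z\in\mathcal P$ (so that $\|z\|_{\mathcal P}$ is defined) and when $w$ ranges over the signals $W(r)+w_1$ of part (i). -/

import Mathlib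

open MeasureTheory Filter Topology Matrix

noncomputable section

namespace MOCC

/-! ### Rational transfer matrices -/

/-- Real-rational transfer matrices in the Laplace variable `s`. -/
abbrev TransferMatrix (p m : Type*) := Matrix p m (RatFunc ℝ)

/-- The frequency response `M(jω)`. -/
def freq {p m : Type*} (M : TransferMatrix p m) (ω : ℝ) : Matrix p m ℂ :=
  M.map (RatFunc.eval (algebraMap ℝ ℂ) ((ω : ℂ) * Complex.I))

/-- `M ∈ RL∞`: every entry is proper and has no pole on the imaginary axis. -/
def IsRLInf {p m : Type*} (M : TransferMatrix p m) : Prop :=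
  ∀ i j, (M i j).intDegree ≤ 0 ∧
    ∀ ω : ℝ, (M i j).denom.eval₂ (algebraMap ℝ ℂ) ((ω : ℂ) * Complex.I) ≠ 0

/-- The transfer matrix `C (sI - A)⁻¹ B + D` of a state-space realization. -/
def stateSpaceTF {ι p m : Type*} [Fintype ι] [DecidableEq ι]
    (A : Matrix ι ι ℝ) (B : Matrix ι m ℝ) (C : Matrix p ι ℝ) (D : Matrix p m ℝ) :
    TransferMatrix p m :=
  C.map (RatFunc.C (K := ℝ)) *
      ((RatFunc.X : RatFunc ℝ) • (1 : Matrix ι ι (RatFunc ℝ)) - A.map (RatFunc.C (K := ℝ)))⁻¹ *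
      B.map (RatFunc.C (K := ℝ)) + D.map (RatFunc.C (K := ℝ))

/-- The substitution `s ↦ -s` on rational functions. -/
def negVar : RatFunc ℝ →+* RatFunc ℝ :=
  RatFunc.mapRingHom (Polynomial.algEquivAevalNegX (R := ℝ))
    (nonZeroDivisors_le_comap_nonZeroDivisors_of_injective _
      (Polynomial.algEquivAevalNegX (R := ℝ)).injective)

/-- The para-Hermitian conjugate `M*(s) = M(-s)ᵀ`. -/
def paraConj {p m : Type*} (M : TransferMatrix p m) : TransferMatrix m p :=
  (M.map negVar)ᵀ

open scoped Matrix.Norms.L2Operator in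
/-- `‖M‖∞ = sup_ω σ̄(M(jω))`, with values in `[0, ∞]`; the largest singular value of a complex matrix
is its operator norm with respect to Euclidean norms. -/
def hinfNorm {p m : Type*} [Fintype p] [Fintype m] [DecidableEq m] (M : TransferMatrix p m) :
    ENNReal :=
  ⨆ ω : ℝ, ENNReal.ofReal ‖freq M ω‖

/-! ### Bounded power signals -/

/-- A (real, vector-valued) signal. -/
abbrev Signal (ι : Type*) := ℝ → ι → ℝ

/-- `R = R_uv(τ) = lim_{T → ∞} (1/T) ∫₀ᵀ u(t+τ) v(t)' dt`. -/
def IsCorrelation {ι κ : Type*} (u : Signal ι) (v : Signal κ) (τ : ℝ) (R : Matrix ι κ ℝ) : Prop :=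
  ∀ i j, Tendsto (fun T : ℝ => T⁻¹ * ∫ t in (0 : ℝ)..T, u (t + τ) i * v t j) atTop (𝓝 (R i j))

/-- `S dμ` is the (cross) power spectral density of `u` and `v`: the correlation matrix exists for
all `τ` and is the inverse Fourier transform `R_uv(τ) = (1/2π) ∫ S_uv(jω) e^{jωτ} dμ(ω)`.
For `μ` the Lebesgue measure, `S` is a spectral density function; the general measure `μ` allows for
impulses in the spectrum, as they occur for constant and sinusoidal signals. -/
def IsSpectralDensity {ι κ : Type*} (u : Signal ι) (v : Signal κ) (μ : Measure ℝ)
    (S : ℝ → Matrix ι κ ℂ) : Prop :=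
  (∀ i j, Integrable (fun ω => S ω i j) μ) ∧
    ∃ R : ℝ → Matrix ι κ ℝ, (∀ τ, IsCorrelation u v τ (R τ)) ∧
      ∀ τ i j, ((R τ i j : ℝ) : ℂ) =
        (2 * (Real.pi : ℂ))⁻¹ * ∫ ω, S ω i j * Complex.exp ((ω : ℂ) * (τ : ℂ) * Complex.I) ∂μ

/-- The class `𝒫` of bounded power signals. -/
structure BoundedPower {ι : Type*} [Fintype ι] (u : Signal ι) : Prop where
  aemeasurable : AEMeasurable u volume
  zero_of_neg : ∀ t < 0, u t = 0
  bounded : ∃ M : ℝ, ∀ t, 0 ≤ t → u t ⬝ᵥ u t ≤ M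
  spectral : ∃ (μ : Measure ℝ) (_ : SigmaFinite μ) (S : ℝ → Matrix ι ι ℂ),
    IsSpectralDensity u u μ S
  power : ∃ p : ℝ, Tendsto (fun T : ℝ => T⁻¹ * ∫ t in (0 : ℝ)..T, u t ⬝ᵥ u t) atTop (𝓝 p)

/-- The power seminorm `‖u‖_𝒫 = (lim_{T → ∞} (1/T) ∫₀ᵀ ‖u(t)‖² dt)^{1/2}` (Euclidean norm). -/
def powerNorm {ι : Type*} [Fintype ι] (u : Signal ι) : ℝ :=
  Real.sqrt (limUnder atTop (fun T : ℝ => T⁻¹ * ∫ t in (0 : ℝ)..T, u t ⬝ᵥ u t))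

/-- `u` and `v` are orthogonal: their cross spectral density exists and `S_uv = 0`. -/
def Orthogonal {ι κ : Type*} (u : Signal ι) (v : Signal κ) : Prop :=
  IsSpectralDensity u v volume (fun _ => 0)

/-- `p = (1/2π) ∫ Trace[G(ω)] dμ(ω)`, the integral being absolutely convergent. -/
def IsTraceIntegral {ι : Type*} [Fintype ι] (μ : Measure ℝ) (G : ℝ → Matrix ι ι ℂ) (p : ℝ) : Prop :=
  Integrable (fun ω => (G ω).trace) μ ∧
    (p : ℂ) = (2 * (Real.pi : ℂ))⁻¹ * ∫ ω, (G ω).trace ∂μ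

/-! ### Linear time-invariant maps -/

/-- `D δ + h`, with `h` integrable over the whole time axis (so not necessarily causal), is the
impulse response of the LTI map with frequency response `M(jω)`. -/
def IsImpulseResponse {p m : Type*} (M : TransferMatrix p m) (D : Matrix p m ℝ)
    (h : ℝ → Matrix p m ℝ) : Prop :=
  (∀ i j, Integrable (fun t => h t i j)) ∧
    ∀ ω i j, freq M ω i j = ((D i j : ℝ) : ℂ) +
      ∫ t, ((h t i j : ℝ) : ℂ) * Complex.exp (-((ω : ℂ) * (t : ℂ) * Complex.I))

/-- `y` is the output, on `t ≥ 0`, of the LTI map with transfer matrix `M ∈ RL∞` for the input `u`: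
`y(t) = D u(t) + ∫ h(t-s) u(s) ds`. Like every signal, `y` is zero for `t < 0`. -/
def IsLTIOutput {p m : Type*} [Fintype m] (M : TransferMatrix p m) (u : Signal m) (y : Signal p) :
    Prop :=
  ∃ (D : Matrix p m ℝ) (h : ℝ → Matrix p m ℝ), IsImpulseResponse M D h ∧
    (∀ t < 0, y t = 0) ∧
    ∀ t, 0 ≤ t → ∀ i, y t i = ∑ j, (D i j * u t j + ∫ s, h (t - s) i j * u s j)

/-! ### Plant, controllers and the closed loop -/

/-- `A` is stable: all its eigenvalues lie in the open left half plane. -/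
def IsHurwitz {ι : Type*} [Fintype ι] [DecidableEq ι] (A : Matrix ι ι ℝ) : Prop :=
  ∀ c ∈ spectrum ℂ (A.map (algebraMap ℝ ℂ)), c.re < 0

/-- The plant `x' = A x + B₁ w + B₂ u`, `z = C₁ (C₂ x - r) + D₁₂ u`, `y = C₂ x + D₂₁ w`. -/
structure Plant (n m₁ m₂ p₁ p₂ : Type*) where
  A : Matrix n n ℝ
  B₁ : Matrix n m₁ ℝ
  B₂ : Matrix n m₂ ℝ
  C₁ : Matrix p₁ p₂ ℝ
  C₂ : Matrix p₂ n ℝ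
  D₁₂ : Matrix p₁ m₂ ℝ
  D₂₁ : Matrix p₂ m₁ ℝ

/-- A dynamic output-feedback controller `ξ' = A ξ + B y`, `u = C ξ + D y`. -/
structure Controller (k m₂ p₂ : Type*) where
  A : Matrix k k ℝ
  B : Matrix k p₂ ℝ
  C : Matrix m₂ k ℝ
  D : Matrix m₂ p₂ ℝ

section

variable {n m₁ m₂ p₁ p₂ k c : Type*} [Fintype n] [Fintype m₁] [Fintype m₂] [Fintype p₁]
  [Fintype p₂] [Fintype k] [Fintype c] [DecidableEq n] [DecidableEq k] [DecidableEq c]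

/-- The state matrix of the loop formed by the plant and a controller. -/
def loopMatrix (P : Plant n m₁ m₂ p₁ p₂) (K : Controller k m₂ p₂) : Matrix (n ⊕ k) (n ⊕ k) ℝ :=
  fromBlocks (P.A + P.B₂ * K.D * P.C₂) (P.B₂ * K.C) (K.B * P.C₂) K.A

/-- The controller stabilizes the plant. -/
def Stabilizes (P : Plant n m₁ m₂ p₁ p₂) (K : Controller k m₂ p₂) : Prop :=
  IsHurwitz (loopMatrix P K)

/-- `T_{z₁w}`: the closed-loop transfer matrix from `w` to `z₁ = C₁ C₂ x + D₁₂ u` (case `r = 0`) with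
the controller `u = K y`. -/
def Tz1w (P : Plant n m₁ m₂ p₁ p₂) (K : Controller k m₂ p₂) : TransferMatrix p₁ m₁ :=
  stateSpaceTF (loopMatrix P K)
    (fromRows (P.B₁ + P.B₂ * K.D * P.D₂₁) (K.B * P.D₂₁))
    (fromCols ((P.C₁ + P.D₁₂ * K.D) * P.C₂) (P.D₁₂ * K.C))
    (P.D₁₂ * K.D * P.D₂₁)

/-- `T_{z₂r}`: the closed-loop transfer matrix from `r` to `z₂ = C₁ (C₂ x - r) + D₁₂ u` (case `w = 0`)
with the controller `u = C (y - r)`. -/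
def Tz2r (P : Plant n m₁ m₂ p₁ p₂) (C : Controller c m₂ p₂) : TransferMatrix p₁ p₂ :=
  stateSpaceTF (loopMatrix P C)
    (fromRows (-(P.B₂ * C.D)) (-C.B))
    (fromCols ((P.C₁ + P.D₁₂ * C.D) * P.C₂) (P.D₁₂ * C.C))
    (-(P.C₁ + P.D₁₂ * C.D))

/-- The Youla-type operator `Q` coordinating `C` and `K`, driven by the residual `f`. -/
def youlaQ (P : Plant n m₁ m₂ p₁ p₂) (C : Controller c m₂ p₂) (K : Controller k m₂ p₂)
    (L : Matrix n p₂ ℝ) (Lc : Matrix c m₂ ℝ) : Controller (c ⊕ (n ⊕ k)) m₂ p₂ where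
  A := fromBlocks (C.A + Lc * C.C)
        (fromCols ((C.B + Lc * (C.D - K.D)) * P.C₂) (-(Lc * K.C)))
        0 (loopMatrix P K)
  B := fromRows (-C.B - Lc * (C.D - K.D)) (fromRows (L - P.B₂ * K.D) (-K.B))
  C := fromCols (-C.C) (fromCols (-((C.D - K.D) * P.C₂)) K.C)
  D := C.D - K.D

/-- `x` solves `x' = g` (in the sense of Carathéodory) on `t ≥ 0` with zero initial value. -/
def IsStateOf {ι : Type*} [Fintype ι] (x g : Signal ι) : Prop :=
  ∀ t : ℝ, 0 ≤ t → IntervalIntegrable g volume 0 t ∧ x t = ∫ s in (0 : ℝ)..t, g s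

/-- `z` is the performance output of the closed loop, from rest, of the plant with the two-controller
structure: the controller `C` acting on `y - r`, the observer with residual `f = C₂ x̂ - y`, and `Q`. -/
def IsClosedLoopOutput (P : Plant n m₁ m₂ p₁ p₂) (C : Controller c m₂ p₂)
    (K : Controller k m₂ p₂) (L : Matrix n p₂ ℝ) (Lc : Matrix c m₂ ℝ)
    (w : Signal m₁) (r : Signal p₂) (z : Signal p₁) : Prop :=
  ∃ (x xhat : Signal n) (xc : Signal c) (xq : Signal (c ⊕ (n ⊕ k)))
    (u uc uq : Signal m₂) (y f : Signal p₂),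
    -- plant
    IsStateOf x (fun t => P.A *ᵥ x t + P.B₁ *ᵥ w t + P.B₂ *ᵥ u t) ∧
    (∀ t, 0 ≤ t → z t = P.C₁ *ᵥ (P.C₂ *ᵥ x t - r t) + P.D₁₂ *ᵥ u t) ∧
    (∀ t < 0, z t = 0) ∧
    (∀ t, 0 ≤ t → y t = P.C₂ *ᵥ x t + P.D₂₁ *ᵥ w t) ∧
    -- controller `C`
    IsStateOf xc (fun t => (C.A + Lc * C.C) *ᵥ xc t - Lc *ᵥ u t
      + (C.B + Lc * C.D) *ᵥ (y t - r t)) ∧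
    (∀ t, 0 ≤ t → uc t = C.C *ᵥ xc t + C.D *ᵥ (y t - r t)) ∧
    -- observer and residual
    IsStateOf xhat (fun t => P.A *ᵥ xhat t + P.B₂ *ᵥ u t + L *ᵥ f t) ∧
    (∀ t, 0 ≤ t → f t = P.C₂ *ᵥ xhat t - y t) ∧
    -- operator `Q`
    IsStateOf xq (fun t => (youlaQ P C K L Lc).A *ᵥ xq t + (youlaQ P C K L Lc).B *ᵥ f t) ∧
    (∀ t, 0 ≤ t → uq t = (youlaQ P C K L Lc).C *ᵥ xq t + (youlaQ P C K L Lc).D *ᵥ f t) ∧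
    -- total control
    (∀ t, 0 ≤ t → u t = uc t + uq t)

/-- `W(s)` and the signals `Wr = W(r)`, `z₂ = T_{z₂r} r`, `z̃₂ = T_{z₁w} W(r) + z₂` generated by it. -/
structure IsDependentPart (P : Plant n m₁ m₂ p₁ p₂) (C : Controller c m₂ p₂)
    (K : Controller k m₂ p₂) (r : Signal p₂) (W : TransferMatrix m₁ p₂)
    (Wr : Signal m₁) (z₂ z₂' : Signal p₁) : Prop where
  rlinf : IsRLInf W
  output_W : IsLTIOutput W r Wr
  output_z₂ : IsLTIOutput (Tz2r P C) r z₂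
  output_z₂' : ∃ v, IsLTIOutput (Tz1w P K) Wr v ∧ z₂' = v + z₂

/-- The worst dependent weighting `W̃ = (γ² I - T_{z₁w}* T_{z₁w})⁻¹ T_{z₁w}* T_{z₂r}`. -/
def worstWeighting [DecidableEq m₁] (P : Plant n m₁ m₂ p₁ p₂) (C : Controller c m₂ p₂)
    (K : Controller k m₂ p₂) (γ : ℝ) : TransferMatrix m₁ p₂ :=
  (RatFunc.C (γ ^ 2) • (1 : TransferMatrix m₁ m₁) - paraConj (Tz1w P K) * Tz1w P K)⁻¹ *
    paraConj (Tz1w P K) * Tz2r P C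

end

end MOCC

end

/-! Everything rests on separation: started from rest, the loop gives z = T_{z₁w} w + T_{z₂r} r,
however w arises. If (q₁, q₂, q₃) is the state of Q, then (q₂ - x̂ + x, q₃) obeys the loop of the
plant with K, driven by w alone, and (x̂ - q₂, x_c - q₁) obeys the loop with C, driven by r alone
(`IsClosedLoopOutput.eq_add`).

Part (i) is then spectral calculus. Filtering one factor of a correlation multiplies the cross
density by the frequency response (`SpecPair.convol`, by Fubini and dominated convergence).
`IsResponse` keeps only this consequence, so it passes to sums and further filters and does not
depend on the chosen impulse response. Orthogonality survives filtering, hence z₁ and z̃₂ are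
uncorrelated and their powers add (`IsSpectralDensity.add_of_uncorrelated`).

Part (ii) completes a square. Write T = T_{z₁w}, T₂ = T_{z₂r}. The weighting W̃ solves the
stationarity equation T*(T W̃ + T₂) = γ² W̃, and its cost is J (`trace_worst_case`). A general w in
𝒫 need not have any cross spectrum with r, so it is compared with w' = W̃(r) in the time domain
(`power_sub_le`). With e = w - w' and y = T w' + T₂ r, the cost changes by the average of |Te|² -
γ²|e|² plus twice that of ⟨y, Te⟩ - γ²⟨w', e⟩. Moving T to the other factor costs only boundary
terms (`hasTimeAvg_ltiResp_adjoint`), and T*y - γ²w' has zero density, so the cross term averages to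
0. The quadratic part is asymptotically nonpositive because the gain of T is at most γ: truncate the
input and apply Plancherel (`eventually_avg_gain_le`). So J bounds every cost and w' attains it; the
same bound with zero reference response shows that the supremum over w₁ is 0.

The analytic input is that proper rational functions regular on the imaginary axis are transforms of
D δ + h with h integrable (`exists_impulse_response`), and that for Hurwitz A the kernel e^{tA} is
integrable with transform (jω - A)⁻¹ (`IsHurwitz.freqInt_stateKernel`). -/

noncomputable section

namespace MOCC

/-! ### Bounded functions and time averages -/

/-- Bounded measurable functions on the real line. -/
structure BddFun (f : ℝ → ℝ) : Prop where
  aesm : AEStronglyMeasurable f volume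
  bdd : ∃ M : ℝ, ∀ t, |f t| ≤ M

namespace BddFun

variable {f g : ℝ → ℝ}

lemma exists_pos (hf : BddFun f) : ∃ M : ℝ, 0 < M ∧ ∀ t, |f t| ≤ M := by
  obtain ⟨M, hM⟩ := hf.bdd
  exact ⟨max M 1, by positivity, fun t => (hM t).trans (le_max_left _ _)⟩

lemma zero : BddFun (fun _ => 0) := ⟨aestronglyMeasurable_const, 0, by simp⟩

lemma mul (hf : BddFun f) (hg : BddFun g) : BddFun (fun t => f t * g t) := by
  obtain ⟨M, hM⟩ := hf.bdd
  obtain ⟨N, hN⟩ := hg.bdd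
  refine ⟨hf.aesm.mul hg.aesm, M * N, fun t => ?_⟩
  rw [abs_mul]
  exact mul_le_mul (hM t) (hN t) (abs_nonneg _) ((abs_nonneg _).trans (hM t))

lemma add (hf : BddFun f) (hg : BddFun g) : BddFun (fun t => f t + g t) := by
  obtain ⟨M, hM⟩ := hf.bdd
  obtain ⟨N, hN⟩ := hg.bdd
  exact ⟨hf.aesm.add hg.aesm, M + N, fun t => (abs_add_le _ _).trans (add_le_add (hM t) (hN t))⟩

lemma const_mul (hf : BddFun f) (c : ℝ) : BddFun (fun t => c * f t) :=
  mul ⟨aestronglyMeasurable_const, |c|, fun _ => le_rfl⟩ hf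

lemma neg (hf : BddFun f) : BddFun (fun t => -f t) := by
  simpa using hf.const_mul (-1)

lemma sub (hf : BddFun f) (hg : BddFun g) : BddFun (fun t => f t - g t) := by
  simpa [sub_eq_add_neg] using hf.add hg.neg

lemma sum {α : Type*} (s : Finset α) {f : α → ℝ → ℝ} (hf : ∀ a ∈ s, BddFun (f a)) :
    BddFun (fun t => ∑ a ∈ s, f a t) := by
  classical
  induction s using Finset.induction_on with
  | empty => simpa using zero
  | insert a s ha ih =>
    simp only [Finset.sum_insert ha]
    exact (hf a (by simp)).add (ih fun b hb => hf b (by simp [hb]))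

lemma shift (hf : BddFun f) (τ : ℝ) : BddFun (fun t => f (t + τ)) := by
  obtain ⟨M, hM⟩ := hf.bdd
  exact ⟨hf.aesm.comp_quasiMeasurePreserving
    (measurePreserving_add_right volume τ).quasiMeasurePreserving, M, fun t => hM _⟩

lemma indicator (hf : BddFun f) {s : Set ℝ} (hs : MeasurableSet s) : BddFun (s.indicator f) := by
  obtain ⟨M, hM⟩ := hf.bdd
  refine ⟨hf.aesm.indicator hs, M, fun t => ?_⟩
  by_cases h : t ∈ s
  · simpa [h] using hM t
  · simpa [h] using (abs_nonneg _).trans (hM t)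

lemma intervalIntegrable (hf : BddFun f) (a b : ℝ) : IntervalIntegrable f volume a b := by
  obtain ⟨M, hM⟩ := hf.bdd
  rw [intervalIntegrable_iff]
  refine Measure.integrableOn_of_bounded (M := M) (by simp [Set.uIoc])
    hf.aesm (Eventually.of_forall fun t => hM t)

lemma abs_integral_le {M : ℝ} (hM : ∀ t, |f t| ≤ M) (a b : ℝ) :
    |∫ t in a..b, f t| ≤ M * |b - a| := by
  rw [← Real.norm_eq_abs]
  exact intervalIntegral.norm_integral_le_of_norm_le_const fun t _ => hM t

end BddFun

/-- `a` is the limit of the time averages of `f`. -/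
def HasTimeAvg (f : ℝ → ℝ) (a : ℝ) : Prop :=
  Tendsto (fun T : ℝ => T⁻¹ * ∫ t in (0 : ℝ)..T, f t) atTop (𝓝 a)

namespace HasTimeAvg

variable {f g : ℝ → ℝ} {a b : ℝ}

lemma zero : HasTimeAvg (fun _ => 0) 0 := by
  simp [HasTimeAvg]

lemma add (hf : BddFun f) (hg : BddFun g) (h : HasTimeAvg f a) (h' : HasTimeAvg g b) :
    HasTimeAvg (fun t => f t + g t) (a + b) := by
  refine (Tendsto.add h h').congr fun T => ?_
  rw [intervalIntegral.integral_add (hf.intervalIntegrable _ _) (hg.intervalIntegrable _ _)]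
  ring

lemma const_mul (c : ℝ) (h : HasTimeAvg f a) : HasTimeAvg (fun t => c * f t) (c * a) := by
  refine (Tendsto.const_mul c h).congr fun T => ?_
  rw [intervalIntegral.integral_const_mul]
  ring

lemma sub (hf : BddFun f) (hg : BddFun g) (h : HasTimeAvg f a) (h' : HasTimeAvg g b) :
    HasTimeAvg (fun t => f t - g t) (a - b) := by
  simpa [sub_eq_add_neg] using h.add hf hg.neg (by simpa using h'.const_mul (-1))

lemma sum {α : Type*} (s : Finset α) {f : α → ℝ → ℝ} {a : α → ℝ} (hf : ∀ i ∈ s, BddFun (f i))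
    (h : ∀ i ∈ s, HasTimeAvg (f i) (a i)) :
    HasTimeAvg (fun t => ∑ i ∈ s, f i t) (∑ i ∈ s, a i) := by
  classical
  induction s using Finset.induction_on with
  | empty => simpa using zero
  | insert i s hi ih =>
    simp only [Finset.sum_insert hi]
    exact (h i (by simp)).add (hf i (by simp)) (BddFun.sum s fun b hb => hf b (by simp [hb]))
      (ih (fun b hb => hf b (by simp [hb])) fun b hb => h b (by simp [hb]))

/-- The factor 1/T kills any difference of integrals that stays bounded. This absorbs both changes
on a bounded interval and time shifts. -/
lemma of_abs_integral_sub_le {C : ℝ} (h : HasTimeAvg f a)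
    (hC : ∀ᶠ T : ℝ in atTop, |(∫ t in (0 : ℝ)..T, g t) - ∫ t in (0 : ℝ)..T, f t| ≤ C) :
    HasTimeAvg g a := by
  have h0 : Tendsto (fun T : ℝ => T⁻¹ * ((∫ t in (0 : ℝ)..T, g t) - ∫ t in (0 : ℝ)..T, f t))
      atTop (𝓝 0) := by
    apply squeeze_zero_norm' (a := fun T : ℝ => T⁻¹ * C)
    · filter_upwards [hC, eventually_gt_atTop 0] with T hT hT0
      rw [Real.norm_eq_abs, abs_mul, abs_of_pos (inv_pos.2 hT0)]
      gcongr
    · simpa using tendsto_inv_atTop_zero.mul_const C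
  simpa [HasTimeAvg, mul_sub] using Tendsto.add h0 h

/-- Time averages see only the far future. Hence the output cut off at t < 0 may be exchanged for
the two-sided convolution. -/
lemma congr_of_le (hf : BddFun f) (hg : BddFun g) (t₀ : ℝ) (hfg : ∀ t, t₀ ≤ t → f t = g t)
    (h : HasTimeAvg f a) : HasTimeAvg g a := by
  obtain ⟨M, hM⟩ := (hg.sub hf).bdd
  refine h.of_abs_integral_sub_le (C := M * |max t₀ 0 - 0|) ?_
  filter_upwards [eventually_ge_atTop (max t₀ 0)] with T hT
  rw [← intervalIntegral.integral_sub (hg.intervalIntegrable _ _) (hf.intervalIntegrable _ _),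
    ← intervalIntegral.integral_add_adjacent_intervals (b := max t₀ 0)
    ((hg.sub hf).intervalIntegrable _ _) ((hg.sub hf).intervalIntegrable _ _)]
  have : ∫ t in (max t₀ 0)..T, (g t - f t) = 0 := by
    apply intervalIntegral.integral_zero_ae
    refine Eventually.of_forall fun t ht => ?_
    rw [Set.uIoc_of_le hT] at ht
    rw [hfg t ((le_max_left _ _).trans ht.1.le), sub_self]
  rw [this, add_zero]
  exact BddFun.abs_integral_le hM _ _

lemma nonneg (hf : ∀ t, 0 ≤ f t) (h : HasTimeAvg f a) : 0 ≤ a := by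
  refine ge_of_tendsto h ?_
  filter_upwards [eventually_ge_atTop 0] with T hT
  exact mul_nonneg (inv_nonneg.2 hT) (intervalIntegral.integral_nonneg hT fun t _ => hf t)

/-- A shift changes the integral only by two end pieces of length |τ|. The bound is uniform in T,
which later allows averaging over shifts. -/
lemma _root_.MOCC.BddFun.abs_integral_shift_sub_le (hf : BddFun f) {M : ℝ} (hM : ∀ t, |f t| ≤ M)
    (τ T : ℝ) : |(∫ t in (0 : ℝ)..T, f (t + τ)) - ∫ t in (0 : ℝ)..T, f t| ≤ 2 * M * |τ| := by
  have e : (∫ t in (0 : ℝ)..T, f (t + τ)) - ∫ t in (0 : ℝ)..T, f t =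
      (∫ t in T..(T + τ), f t) - ∫ t in (0 : ℝ)..(0 + τ), f t := by
    have h1 := intervalIntegral.integral_add_adjacent_intervals
      (hf.intervalIntegrable 0 (0 + τ)) (hf.intervalIntegrable (0 + τ) (T + τ))
    have h2 := intervalIntegral.integral_add_adjacent_intervals
      (hf.intervalIntegrable 0 T) (hf.intervalIntegrable T (T + τ))
    rw [intervalIntegral.integral_comp_add_right f τ]
    linarith
  rw [e, mul_assoc, two_mul]
  refine (abs_sub _ _).trans (add_le_add ?_ ?_)
  · simpa using BddFun.abs_integral_le hM T (T + τ)
  · simpa using BddFun.abs_integral_le hM 0 (0 + τ)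

lemma shift (hf : BddFun f) (h : HasTimeAvg f a) (τ : ℝ) :
    HasTimeAvg (fun t => f (t + τ)) a := by
  obtain ⟨M, hM⟩ := hf.bdd
  exact h.of_abs_integral_sub_le (C := 2 * M * |τ|)
    (Eventually.of_forall fun T => hf.abs_integral_shift_sub_le hM τ T)

/-- Perturbations of vanishing power do not change correlations. -/
lemma zero_mul_of_sq (hf : BddFun f) (hg : BddFun g) (h : HasTimeAvg (fun t => f t ^ 2) 0) :
    HasTimeAvg (fun t => f t * g t) 0 := by
  obtain ⟨M, hM0, hM⟩ := hg.exists_pos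
  rw [HasTimeAvg, Metric.tendsto_atTop]
  intro ε hε
  -- `|f g| ≤ f² M² / ε + ε / 4`
  have hc : Tendsto (fun T : ℝ => (M ^ 2 / ε) * (T⁻¹ * ∫ t in (0 : ℝ)..T, f t ^ 2)) atTop (𝓝 0) := by
    simpa using Tendsto.const_mul (M ^ 2 / ε) h
  have hev := (hc.eventually (gt_mem_nhds (show (0:ℝ) < ε / 2 by positivity))).and
    (eventually_gt_atTop 0)
  obtain ⟨N, hN⟩ := eventually_atTop.1 hev
  refine ⟨N, fun T hT => ?_⟩
  obtain ⟨h1, hT0⟩ := hN T hT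
  have hf2 : BddFun (fun t => f t ^ 2) := by simpa [pow_two] using hf.mul hf
  have hle : |∫ t in (0 : ℝ)..T, f t * g t| ≤ ∫ t in (0 : ℝ)..T, (M ^ 2 / ε * f t ^ 2 + ε / 4) := by
    rw [← Real.norm_eq_abs]
    refine intervalIntegral.norm_integral_le_of_norm_le (g := fun t => M ^ 2 / ε * f t ^ 2 + ε / 4)
      hT0.le (Eventually.of_forall fun t _ => ?_)
      (((hf2.const_mul _).intervalIntegrable _ _).add intervalIntegrable_const)
    rw [Real.norm_eq_abs, abs_mul]
    have h2 : |f t| * |g t| ≤ |f t| * M := by gcongr; exact hM t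
    refine h2.trans ?_
    -- Expanding the square yields Young's inequality. Eventually the average of the first term is
    -- below ε/2, so the total stays below ε/2 + ε/4.
    have : 0 ≤ (|f t| * M / ε - 1 / 2) ^ 2 * ε := by positivity
    have e : (|f t| * M / ε - 1 / 2) ^ 2 * ε = M ^ 2 / ε * |f t| ^ 2 + ε / 4 - |f t| * M := by
      field_simp
      ring
    rw [sq_abs] at e
    linarith
  rw [intervalIntegral.integral_add ((hf2.const_mul _).intervalIntegrable _ _)
    intervalIntegrable_const, intervalIntegral.integral_const_mul,
    intervalIntegral.integral_const] at hle
  rw [dist_zero_right, Real.norm_eq_abs, abs_mul, abs_of_pos (inv_pos.2 hT0)]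
  calc T⁻¹ * |∫ t in (0 : ℝ)..T, f t * g t|
      ≤ T⁻¹ * (M ^ 2 / ε * (∫ t in (0 : ℝ)..T, f t ^ 2) + (T - 0) • (ε / 4)) := by gcongr
    _ = M ^ 2 / ε * (T⁻¹ * ∫ t in (0 : ℝ)..T, f t ^ 2) + ε / 4 := by
      simp only [smul_eq_mul, sub_zero]
      field_simp
    _ < ε := by linarith

end HasTimeAvg

/-! ### Convolutions -/

/-- The response `∫ h(t-s) u(s) ds`. -/
def convol (h u : ℝ → ℝ) (t : ℝ) : ℝ := ∫ s, h (t - s) * u s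

lemma convol_eq (h u : ℝ → ℝ) (t : ℝ) : convol h u t = ∫ a, h a * u (t - a) := by
  rw [convol, ← integral_sub_left_eq_self _ volume t]
  simp

lemma integrable_mul_bddFun' {h u : ℝ → ℝ} (hh : Integrable h) (hu : BddFun u) (t : ℝ) :
    Integrable (fun s => h (t - s) * u s) := by
  obtain ⟨M, hM⟩ := hu.bdd
  exact (hh.comp_sub_left t).mul_bdd (c := M) hu.aesm (Eventually.of_forall fun a => hM _)

lemma aestronglyMeasurable_convol_integrand {h u : ℝ → ℝ} (hh : Integrable h)
    (hu : AEStronglyMeasurable u volume) :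
    AEStronglyMeasurable (fun p : ℝ × ℝ => h p.2 * u (p.1 - p.2)) (volume.prod volume) :=
  (hh.aestronglyMeasurable.comp_quasiMeasurePreserving Measure.quasiMeasurePreserving_snd).mul
    (hu.comp_quasiMeasurePreserving (quasiMeasurePreserving_sub volume volume))

lemma abs_convol_le {h u : ℝ → ℝ} (hh : Integrable h) {M : ℝ} (hM : ∀ t, |u t| ≤ M) (t : ℝ) :
    |convol h u t| ≤ (∫ a, |h a|) * M := by
  rw [convol_eq, ← integral_mul_const, ← Real.norm_eq_abs]
  refine norm_integral_le_of_norm_le (hh.abs.mul_const M) (Eventually.of_forall fun a => ?_)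
  rw [Real.norm_eq_abs, abs_mul]
  exact mul_le_mul_of_nonneg_left (hM _) (abs_nonneg _)

lemma BddFun.convol {h u : ℝ → ℝ} (hh : Integrable h) (hu : BddFun u) : BddFun (convol h u) := by
  obtain ⟨M, hM⟩ := hu.bdd
  refine ⟨?_, _, abs_convol_le hh hM⟩
  have := (aestronglyMeasurable_convol_integrand hh hu.aesm).integral_prod_right'
  exact this.congr (Eventually.of_forall fun t => (convol_eq h u t).symm)

/-- Time averages commute with filtering of one factor. -/
lemma integral_convol_mul {h u v : ℝ → ℝ} (hh : Integrable h) (hu : BddFun u) (hv : BddFun v)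
    (τ T : ℝ) :
    ∫ t in (0 : ℝ)..T, convol h u (t + τ) * v t =
      ∫ a, h a * ∫ t in (0 : ℝ)..T, u (t + (τ - a)) * v t := by
  obtain ⟨M, hM⟩ := hu.bdd
  obtain ⟨N, hN⟩ := hv.bdd
  have hM0 : 0 ≤ M := (abs_nonneg _).trans (hM 0)
  have hint : Integrable (fun p : ℝ × ℝ => h p.2 * u (p.1 + τ - p.2) * v p.1)
      ((volume.restrict (Set.uIoc 0 T)).prod volume) := by
    have hm : AEStronglyMeasurable (fun p : ℝ × ℝ => h p.2 * u (p.1 + τ - p.2) * v p.1)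
        ((volume.restrict (Set.uIoc 0 T)).prod volume) := by
      have h1 := (aestronglyMeasurable_convol_integrand hh (hu.shift τ).aesm).mul
        (hv.aesm.comp_quasiMeasurePreserving
          (Measure.quasiMeasurePreserving_fst (μ := volume) (ν := (volume : Measure ℝ))))
      refine (h1.congr (Eventually.of_forall fun p => ?_)).mono_ac
        (Measure.absolutelyContinuous_of_le (Measure.prod_mono Measure.restrict_le_self le_rfl))
      simp [sub_add_eq_add_sub]
    -- The t-range has finite measure and h is integrable, so this product dominates the integrand
    -- and Fubini applies.
    have hdom : Integrable (fun p : ℝ × ℝ => (M * N) * h p.2)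
        ((volume.restrict (Set.uIoc 0 T)).prod volume) := by
      have : IsFiniteMeasure (volume.restrict (Set.uIoc 0 T)) := ⟨by simp [Set.uIoc]⟩
      exact (integrable_const (M * N)).mul_prod hh
    refine hdom.mono hm (Eventually.of_forall fun p => ?_)
    simp only [Real.norm_eq_abs, abs_mul]
    calc |h p.2| * |u (p.1 + τ - p.2)| * |v p.1| ≤ |h p.2| * M * N :=
          mul_le_mul (mul_le_mul_of_nonneg_left (hM _) (abs_nonneg _)) (hN _) (abs_nonneg _)
            (by positivity)
      _ = M * N * |h p.2| := by ring
      _ ≤ |M| * |N| * |h p.2| := by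
          rw [← abs_mul]
          exact mul_le_mul_of_nonneg_right (le_abs_self _) (abs_nonneg _)
  simp only [intervalIntegral.intervalIntegral_eq_integral_uIoc, smul_eq_mul]
  have := integral_integral_swap (f := fun t a => h a * u (t + τ - a) * v t) hint
  simp only [integral_mul_const] at this
  calc _ = (if 0 ≤ T then 1 else -1) * ∫ t in Set.uIoc 0 T, (∫ a, h a * u (t + τ - a)) * v t := by
        simp only [convol_eq]
    _ = _ := by
        rw [this, ← integral_const_mul]
        congr 1 with a
        have : ∀ t, h a * u (t + τ - a) * v t = h a * (u (t + (τ - a)) * v t) := fun t => by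
          rw [mul_assoc, add_sub_assoc]
        simp only [this, integral_const_mul]
        ring

lemma aestronglyMeasurable_integral_shift_mul {u v : ℝ → ℝ} (hu : BddFun u) (hv : BddFun v)
    (τ T : ℝ) :
    AEStronglyMeasurable (fun a => ∫ t in (0 : ℝ)..T, u (t + (τ - a)) * v t) volume := by
  simp only [intervalIntegral.intervalIntegral_eq_integral_uIoc, smul_eq_mul]
  refine AEStronglyMeasurable.const_mul ?_ _
  -- Since u is only a.e. measurable, composition needs quasi-measure-preserving maps; the argument
  -- is therefore written as a reflection and translation of the difference map.
  have h1 : AEStronglyMeasurable (fun p : ℝ × ℝ => u (-(p.1 - p.2) + τ))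
      (volume.prod (volume.restrict (Set.uIoc 0 T))) := by
    refine (AEStronglyMeasurable.comp_quasiMeasurePreserving (g := fun x => u (-x + τ)) ?_
      (quasiMeasurePreserving_sub volume (volume.restrict (Set.uIoc 0 T))))
    exact (hu.shift τ).aesm.comp_quasiMeasurePreserving
      (Measure.measurePreserving_neg volume).quasiMeasurePreserving
  have h2 : AEStronglyMeasurable (fun p : ℝ × ℝ => v p.2)
      (volume.prod (volume.restrict (Set.uIoc 0 T))) :=
    hv.aesm.restrict.comp_quasiMeasurePreserving Measure.quasiMeasurePreserving_snd
  refine ((h1.mul h2).integral_prod_right').congr (Eventually.of_forall fun a => ?_)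
  simp only [Pi.mul_apply]
  congr 1 with t
  ring_nf

/-- Fubini moves the time average under the convolution integral; dominated convergence with the
majorant |h| M N then lets T tend to infinity. -/
lemma hasTimeAvg_convol {h u v : ℝ → ℝ} (hh : Integrable h) (hu : BddFun u) (hv : BddFun v)
    {ρ : ℝ → ℝ} (hρ : ∀ τ, HasTimeAvg (fun t => u (t + τ) * v t) (ρ τ)) (τ : ℝ) :
    HasTimeAvg (fun t => convol h u (t + τ) * v t) (∫ a, h a * ρ (τ - a)) := by
  obtain ⟨M, hM⟩ := hu.bdd
  obtain ⟨N, hN⟩ := hv.bdd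
  have hMN : ∀ a t, |u (t + (τ - a)) * v t| ≤ M * N := fun a t => by
    rw [abs_mul]
    exact mul_le_mul (hM _) (hN t) (abs_nonneg _) ((abs_nonneg _).trans (hM 0))
  have key : Tendsto (fun T : ℝ => ∫ a, T⁻¹ * (h a * ∫ t in (0 : ℝ)..T, u (t + (τ - a)) * v t))
      atTop (𝓝 (∫ a, h a * ρ (τ - a))) := by
    refine tendsto_integral_filter_of_dominated_convergence (fun a => |h a| * (M * N)) ?_ ?_
      (hh.abs.mul_const _) (Eventually.of_forall fun a => ?_)
    · filter_upwards with T
      exact (hh.aestronglyMeasurable.mul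
        (aestronglyMeasurable_integral_shift_mul hu hv τ T)).const_mul _
    · filter_upwards [eventually_gt_atTop 0] with T hT
      refine Eventually.of_forall fun a => ?_
      rw [Real.norm_eq_abs, abs_mul, abs_mul, abs_of_pos (inv_pos.2 hT)]
      have := BddFun.abs_integral_le (hMN a) 0 T
      rw [sub_zero, abs_of_pos hT] at this
      calc T⁻¹ * (|h a| * |∫ t in (0 : ℝ)..T, u (t + (τ - a)) * v t|)
          ≤ T⁻¹ * (|h a| * (M * N * T)) := by gcongr
        _ = |h a| * (M * N) := by field_simp
    · refine (Tendsto.const_mul (h a) (hρ (τ - a))).congr fun T => ?_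
      ring
  refine key.congr fun T => ?_
  rw [integral_convol_mul hh hu hv, integral_const_mul]

/-! ### Scalar spectral densities -/

/-- `s dμ` is the cross spectral density of the scalar signals `u` and `v`. -/
def SpecPair (u v : ℝ → ℝ) (μ : Measure ℝ) (s : ℝ → ℂ) : Prop :=
  Integrable s μ ∧ ∃ ρ : ℝ → ℝ, (∀ τ, HasTimeAvg (fun t => u (t + τ) * v t) (ρ τ)) ∧
    ∀ τ, ((ρ τ : ℝ) : ℂ) =
      (2 * (Real.pi : ℂ))⁻¹ * ∫ ω, s ω * Complex.exp ((ω : ℂ) * (τ : ℂ) * Complex.I) ∂μ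

lemma isSpectralDensity_iff {ι κ : Type*} {u : Signal ι} {v : Signal κ} {μ : Measure ℝ}
    {S : ℝ → Matrix ι κ ℂ} : IsSpectralDensity u v μ S ↔
      ∀ i j, SpecPair (fun t => u t i) (fun t => v t j) μ (fun ω => S ω i j) := by
  constructor
  · rintro ⟨hi, R, hR, hS⟩ i j
    exact ⟨hi i j, fun τ => R τ i j, fun τ => hR τ i j, fun τ => hS τ i j⟩
  · intro h
    choose hi ρ hρ hs using h
    exact ⟨hi, fun τ => Matrix.of fun i j => ρ i j τ, fun τ i j => hρ i j τ,
      fun τ i j => hs i j τ⟩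

/-- The Fourier integral of an impulse response. -/
def freqInt (h : ℝ → ℝ) (ω : ℝ) : ℂ :=
  ∫ t, ((h t : ℝ) : ℂ) * Complex.exp (-((ω : ℂ) * (t : ℂ) * Complex.I))

lemma norm_exp_mul_I (a b : ℝ) : ‖Complex.exp ((a : ℂ) * (b : ℂ) * Complex.I)‖ = 1 := by
  rw [← Complex.ofReal_mul, Complex.norm_exp_ofReal_mul_I]

lemma norm_exp_neg_mul_I (a b : ℝ) : ‖Complex.exp (-((a : ℂ) * (b : ℂ) * Complex.I))‖ = 1 := by
  rw [← neg_mul, ← Complex.ofReal_mul, ← Complex.ofReal_neg, Complex.norm_exp_ofReal_mul_I]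

lemma continuous_freqInt {h : ℝ → ℝ} (hh : Integrable h) : Continuous (freqInt h) := by
  refine continuous_of_dominated (F := fun (ω : ℝ) (t : ℝ) => ((h t : ℝ) : ℂ) *
    Complex.exp (-((ω : ℂ) * (t : ℂ) * Complex.I))) (bound := fun t => |h t|) ?_ ?_ hh.abs ?_
  · intro ω
    exact hh.ofReal.aestronglyMeasurable.mul (Continuous.aestronglyMeasurable (by fun_prop))
  · intro ω
    refine Eventually.of_forall fun t => ?_
    rw [norm_mul, norm_exp_neg_mul_I, mul_one, Complex.norm_real, Real.norm_eq_abs]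
  · refine Eventually.of_forall fun t => ?_
    fun_prop

lemma norm_freqInt_le {h : ℝ → ℝ} (hh : Integrable h) (ω : ℝ) : ‖freqInt h ω‖ ≤ ∫ t, |h t| := by
  refine norm_integral_le_of_norm_le hh.abs (Eventually.of_forall fun t => ?_)
  rw [norm_mul, norm_exp_neg_mul_I, mul_one, Complex.norm_real, Real.norm_eq_abs]

lemma integrable_mul_exp {μ : Measure ℝ} {s : ℝ → ℂ} (hs : Integrable s μ) (τ : ℝ) :
    Integrable (fun ω : ℝ => s ω * Complex.exp ((ω : ℂ) * (τ : ℂ) * Complex.I)) μ :=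
  hs.mul_bdd (c := 1) (Continuous.aestronglyMeasurable (by fun_prop))
    (Eventually.of_forall fun ω => (norm_exp_mul_I ω τ).le)

namespace SpecPair

variable {u v u' v' : ℝ → ℝ} {μ : Measure ℝ} {s s' : ℝ → ℂ}

lemma hasTimeAvg (h : SpecPair u v μ s) : ∃ p : ℝ, HasTimeAvg (fun t => u t * v t) p ∧
    (p : ℂ) = (2 * (Real.pi : ℂ))⁻¹ * ∫ ω, s ω ∂μ := by
  obtain ⟨_, ρ, h1, h2⟩ := h
  exact ⟨ρ 0, by simpa using h1 0, by simpa using h2 0⟩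

lemma congr (h : SpecPair u v μ s) (hs : ∀ ω, s ω = s' ω) : SpecPair u v μ s' := by
  rwa [show s' = s from funext fun ω => (hs ω).symm]

lemma zero_left : SpecPair (fun _ => 0) v μ (fun _ => 0) :=
  ⟨integrable_zero _ _ _, fun _ => 0, fun τ => by simpa using HasTimeAvg.zero, by simp⟩

lemma add (hu : BddFun u) (hu' : BddFun u') (hv : BddFun v) (h : SpecPair u v μ s)
    (h' : SpecPair u' v μ s') : SpecPair (fun t => u t + u' t) v μ (fun ω => s ω + s' ω) := by
  obtain ⟨hi, ρ, h1, h2⟩ := h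
  obtain ⟨hi', ρ', h1', h2'⟩ := h'
  refine ⟨hi.add hi', fun τ => ρ τ + ρ' τ, fun τ => ?_, fun τ => ?_⟩
  · simpa only [add_mul] using (h1 τ).add ((hu.shift τ).mul hv) ((hu'.shift τ).mul hv) (h1' τ)
  · simp only [add_mul]
    rw [integral_add (integrable_mul_exp hi τ) (integrable_mul_exp hi' τ)]
    push_cast
    rw [h2, h2']
    ring

lemma const_mul (c : ℝ) (h : SpecPair u v μ s) :
    SpecPair (fun t => c * u t) v μ (fun ω => c * s ω) := by
  obtain ⟨hi, ρ, h1, h2⟩ := h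
  refine ⟨hi.const_mul _, fun τ => c * ρ τ, fun τ => ?_, fun τ => ?_⟩
  · simpa only [mul_assoc] using (h1 τ).const_mul c
  · simp only [mul_assoc]
    rw [integral_const_mul]
    push_cast
    rw [h2]
    simp only [mul_assoc]
    ring

lemma sum {α : Type*} (t : Finset α) {u : α → ℝ → ℝ} {s : α → ℝ → ℂ} (hu : ∀ a, BddFun (u a))
    (hv : BddFun v) (h : ∀ a, SpecPair (u a) v μ (s a)) :
    SpecPair (fun x => ∑ a ∈ t, u a x) v μ (fun ω => ∑ a ∈ t, s a ω) := by
  classical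
  induction t using Finset.induction_on with
  | empty => simpa using zero_left
  | insert i t hi ih =>
    simp only [Finset.sum_insert hi]
    exact (h i).add (hu i) (BddFun.sum t fun b _ => hu b) hv ih

/-- Shift invariance of averages gives R_vu(τ) = R_uv(-τ). As R_uv is real, conjugating its Fourier
representation restores the sign of τ. -/
lemma swap (hu : BddFun u) (hv : BddFun v) (h : SpecPair u v μ s) :
    SpecPair v u μ (fun ω => starRingEnd ℂ (s ω)) := by
  obtain ⟨hi, ρ, h1, h2⟩ := h
  refine ⟨?_, fun τ => ρ (-τ), fun τ => ?_, fun τ => ?_⟩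
  · exact (LinearIsometryEquiv.integrable_comp_iff Complex.conjLIE).2 hi
  · have := (h1 (-τ)).shift ((hu.shift (-τ)).mul hv) τ
    simpa [mul_comm] using this
  · rw [← Complex.conj_ofReal, h2, map_mul, ← integral_conj]
    simp only [map_mul, map_inv₀, Complex.conj_ofReal, Complex.conj_ofNat, ← Complex.exp_conj,
      Complex.ofReal_neg, mul_neg, neg_mul]
    simp only [map_neg, map_mul, Complex.conj_ofReal, Complex.conj_I, mul_neg, neg_neg]

lemma congr_left_of_le (hu : BddFun u) (hu' : BddFun u') (hv : BddFun v) (t₀ : ℝ)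
    (huu : ∀ t, t₀ ≤ t → u t = u' t) (h : SpecPair u v μ s) : SpecPair u' v μ s := by
  obtain ⟨hi, ρ, h1, h2⟩ := h
  refine ⟨hi, ρ, fun τ => ?_, h2⟩
  refine (h1 τ).congr_of_le ((hu.shift τ).mul hv) ((hu'.shift τ).mul hv) (t₀ - τ) fun t ht => ?_
  rw [huu _ (by linarith)]

/-- Filtering multiplies the cross spectral density by the frequency response. -/
lemma convol [SFinite μ] {h : ℝ → ℝ} (hh : Integrable h) (hu : BddFun u) (hv : BddFun v)
    (H : SpecPair u v μ s) : SpecPair (MOCC.convol h u) v μ (fun ω => freqInt h ω * s ω) := by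
  obtain ⟨hi, ρ, h1, h2⟩ := H
  refine ⟨?_, fun τ => ∫ a, h a * ρ (τ - a), fun τ => hasTimeAvg_convol hh hu hv h1 τ,
    fun τ => ?_⟩
  · exact hi.bdd_mul (c := ∫ t, |h t|) (continuous_freqInt hh).aestronglyMeasurable
      (Eventually.of_forall (norm_freqInt_le hh))
  -- The exponential has modulus one, so the integrand is dominated by |h(a)| |s(ω)| and the lag and
  -- frequency integrals may be exchanged.
  · have hint : Integrable (fun p : ℝ × ℝ => (((h p.1 : ℝ) : ℂ) * s p.2) *
        Complex.exp ((p.2 : ℂ) * ((τ - p.1 : ℝ) : ℂ) * Complex.I)) (volume.prod μ) :=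
      (hh.ofReal.mul_prod hi).mul_bdd (c := 1)
        (Continuous.aestronglyMeasurable (by fun_prop))
        (Eventually.of_forall fun p => (norm_exp_mul_I p.2 (τ - p.1)).le)
    have hsw := integral_integral_swap (f := fun a ω => (((h a : ℝ) : ℂ) * s ω) *
        Complex.exp ((ω : ℂ) * ((τ - a : ℝ) : ℂ) * Complex.I)) hint
    rw [← integral_complex_ofReal]
    calc ∫ a, ((h a * ρ (τ - a) : ℝ) : ℂ)
        = ∫ a, (2 * (Real.pi : ℂ))⁻¹ * ∫ ω, (((h a : ℝ) : ℂ) * s ω) *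
            Complex.exp ((ω : ℂ) * ((τ - a : ℝ) : ℂ) * Complex.I) ∂μ := by
          congr 1 with a
          rw [Complex.ofReal_mul, h2]
          simp only [mul_assoc]
          rw [integral_const_mul]
          ring
      _ = (2 * (Real.pi : ℂ))⁻¹ * ∫ ω, (∫ a, (((h a : ℝ) : ℂ) * s ω) *
            Complex.exp ((ω : ℂ) * ((τ - a : ℝ) : ℂ) * Complex.I)) ∂μ := by
          rw [integral_const_mul, hsw]
      _ = _ := by
          refine congrArg _ (integral_congr_ae (Eventually.of_forall fun ω => ?_))
          simp only [freqInt]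
          rw [mul_assoc, ← integral_mul_const]
          congr 1 with a
          rw [show (ω : ℂ) * ((τ - a : ℝ) : ℂ) * Complex.I =
            -((ω : ℂ) * (a : ℂ) * Complex.I) + (ω : ℂ) * (τ : ℂ) * Complex.I by
              push_cast; ring, Complex.exp_add]
          ring

end SpecPair

/-! ### Bounded signals and spectral densities of vector signals -/

/-- Bounded measurable signals vanishing for negative times. -/
structure BddSignal {ι : Type*} (u : Signal ι) : Prop where
  bddFun : ∀ i, BddFun (fun t => u t i)
  zero_of_neg : ∀ t < 0, u t = 0

section

variable {ι κ : Type*}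

lemma BddSignal.add {u v : Signal ι} (hu : BddSignal u) (hv : BddSignal v) :
    BddSignal (u + v) :=
  ⟨fun i => (hu.bddFun i).add (hv.bddFun i), fun t ht => by
    simp [hu.zero_of_neg t ht, hv.zero_of_neg t ht]⟩

lemma BddSignal.const_smul {u : Signal ι} (hu : BddSignal u) (c : ℝ) : BddSignal (c • u) :=
  ⟨fun i => (hu.bddFun i).const_mul c, fun t ht => by simp [hu.zero_of_neg t ht]⟩

lemma BddSignal.sub {u v : Signal ι} (hu : BddSignal u) (hv : BddSignal v) :
    BddSignal (u - v) :=
  ⟨fun i => (hu.bddFun i).sub (hv.bddFun i), fun t ht => by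
    simp [hu.zero_of_neg t ht, hv.zero_of_neg t ht]⟩

lemma BddSignal.zero : BddSignal (0 : Signal ι) := ⟨fun _ => BddFun.zero, fun _ _ => rfl⟩

lemma BoundedPower.bddSignal [Fintype ι] {u : Signal ι} (hu : BoundedPower u) : BddSignal u := by
  refine ⟨fun i => ⟨(aemeasurable_pi_iff.1 hu.aemeasurable i).aestronglyMeasurable, ?_⟩,
    hu.zero_of_neg⟩
  obtain ⟨M, hM⟩ := hu.bounded
  -- M bounds the square of an entry; if B = max M 1 then B² ≥ M, so B bounds the entry itself
  -- without a square root.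
  refine ⟨max M 1, fun t => ?_⟩
  rcases lt_or_ge t 0 with ht | ht
  · rw [hu.zero_of_neg t ht]
    simp
  · have h1 : u t i * u t i ≤ M := by
      refine le_trans ?_ (hM t ht)
      exact Finset.single_le_sum (f := fun i => u t i * u t i) (fun j _ => mul_self_nonneg _)
        (Finset.mem_univ i)
    refine abs_le_of_sq_le_sq ?_ (by positivity)
    have h2 : M ≤ max M 1 := le_max_left _ _
    have h3 : 1 ≤ max M 1 := le_max_right _ _
    nlinarith

lemma BddSignal.dotProduct [Fintype ι] {u v : Signal ι} (hu : BddSignal u) (hv : BddSignal v) :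
    BddFun (fun t => u t ⬝ᵥ v t) :=
  BddFun.sum Finset.univ fun i _ => (hu.bddFun i).mul (hv.bddFun i)

namespace IsSpectralDensity

variable {u u' : Signal ι} {v : Signal κ} {μ : Measure ℝ} {S S' : ℝ → Matrix ι κ ℂ}

lemma congr (h : IsSpectralDensity u v μ S) (hS : ∀ ω, S ω = S' ω) :
    IsSpectralDensity u v μ S' := by
  rwa [show S' = S from funext fun ω => (hS ω).symm]

lemma swap (hu : BddSignal u) (hv : BddSignal v) (h : IsSpectralDensity u v μ S) :
    IsSpectralDensity v u μ (fun ω => (S ω)ᴴ) := by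
  rw [isSpectralDensity_iff] at h ⊢
  exact fun i j => (h j i).swap (hu.bddFun j) (hv.bddFun i)

lemma add (hu : BddSignal u) (hu' : BddSignal u') (hv : BddSignal v)
    (h : IsSpectralDensity u v μ S) (h' : IsSpectralDensity u' v μ S') :
    IsSpectralDensity (u + u') v μ (fun ω => S ω + S' ω) := by
  rw [isSpectralDensity_iff] at h h' ⊢
  exact fun i j => (h i j).add (hu.bddFun i) (hu'.bddFun i) (hv.bddFun j) (h' i j)

lemma const_smul (c : ℝ) (h : IsSpectralDensity u v μ S) :
    IsSpectralDensity (c • u) v μ (fun ω => (c : ℂ) • S ω) := by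
  rw [isSpectralDensity_iff] at h ⊢
  exact fun i j => (h i j).const_mul c

lemma hasTimeAvg_dotProduct [Fintype ι] {v : Signal ι} {S : ℝ → Matrix ι ι ℂ}
    (hu : BddSignal u) (hv : BddSignal v)
    (h : IsSpectralDensity u v μ S) : ∃ p : ℝ, HasTimeAvg (fun t => u t ⬝ᵥ v t) p ∧
      IsTraceIntegral μ S p := by
  rw [isSpectralDensity_iff] at h
  choose p hp1 hp2 using fun i => (h i i).hasTimeAvg
  refine ⟨∑ i, p i, HasTimeAvg.sum Finset.univ (fun i _ => (hu.bddFun i).mul (hv.bddFun i))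
    fun i _ => hp1 i, integrable_finsetSum _ fun i _ => (h i i).1, ?_⟩
  simp only [Matrix.trace, Matrix.diag]
  rw [integral_finsetSum _ fun i _ => (h i i).1, Finset.mul_sum]
  push_cast
  exact Finset.sum_congr rfl fun i _ => hp2 i

/-- A vanishing density does not notice its base measure, so orthogonality can be combined with
spectra over any μ, including singular ones. -/
lemma zero_of_orthogonal (h : Orthogonal u v) (μ : Measure ℝ) :
    IsSpectralDensity u v μ (fun _ => 0) := by
  obtain ⟨-, R, h1, h2⟩ := h
  refine ⟨fun i j => by simp, R, h1, fun τ i j => ?_⟩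
  rw [h2]
  simp

/-- The Radon–Nikodym derivative is absorbed into the density. This puts signals with unrelated
spectral measures over a common one. -/
lemma change_measure {μ' : Measure ℝ} [SigmaFinite μ] [SigmaFinite μ'] (hμ : μ ≪ μ')
    (h : IsSpectralDensity u v μ S) :
    IsSpectralDensity u v μ' (fun ω => ((μ.rnDeriv μ' ω).toReal : ℂ) • S ω) := by
  obtain ⟨h0, R, h1, h2⟩ := h
  have hsm : ∀ (x : ℝ) (c : ℂ), (x : ℂ) * c = x • c := fun x c => by simp
  refine ⟨fun i j => ?_, R, h1, fun τ i j => ?_⟩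
  · simp only [Matrix.smul_apply, smul_eq_mul, hsm]
    exact (integrable_rnDeriv_smul_iff hμ).2 (h0 i j)
  · rw [h2, ← integral_rnDeriv_smul hμ]
    refine congrArg _ (integral_congr_ae (Eventually.of_forall fun ω => ?_))
    simp only [Matrix.smul_apply, smul_eq_mul, Complex.real_smul, mul_assoc]

end IsSpectralDensity

/-! ### Powers as time averages and membership in 𝒫. -/

lemma HasTimeAvg.powerNorm_sq [Fintype ι] {u : Signal ι} {p : ℝ}
    (h : HasTimeAvg (fun t => u t ⬝ᵥ u t) p) : powerNorm u ^ 2 = p := by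
  rw [powerNorm, Tendsto.limUnder_eq h, Real.sq_sqrt]
  exact h.nonneg fun t => Finset.sum_nonneg fun i _ => mul_self_nonneg _

lemma IsSpectralDensity.hasTimeAvg_powerNorm [Fintype ι] {u : Signal ι} {μ : Measure ℝ}
    {S : ℝ → Matrix ι ι ℂ} (h : IsSpectralDensity u u μ S) (hu : BddSignal u) :
    HasTimeAvg (fun t => u t ⬝ᵥ u t) (powerNorm u ^ 2) ∧
      IsTraceIntegral μ S (powerNorm u ^ 2) := by
  obtain ⟨p, hp, hp'⟩ := h.hasTimeAvg_dotProduct hu hu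
  rw [hp.powerNorm_sq]
  exact ⟨hp, hp'⟩

lemma BoundedPower.hasTimeAvg [Fintype ι] {u : Signal ι} (h : BoundedPower u) :
    HasTimeAvg (fun t => u t ⬝ᵥ u t) (powerNorm u ^ 2) := by
  obtain ⟨p, hp⟩ := h.power
  exact (HasTimeAvg.powerNorm_sq hp).symm ▸ hp

lemma BddSignal.boundedPower [Fintype ι] {u : Signal ι} (hu : BddSignal u) {μ : Measure ℝ}
    [SigmaFinite μ] {S : ℝ → Matrix ι ι ℂ} (h : IsSpectralDensity u u μ S) : BoundedPower u where
  aemeasurable := aemeasurable_pi_iff.2 fun i => (hu.bddFun i).aesm.aemeasurable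
  zero_of_neg := hu.zero_of_neg
  bounded := by
    obtain ⟨M, hM⟩ := (hu.dotProduct hu).bdd
    exact ⟨M, fun t _ => (le_abs_self _).trans (hM t)⟩
  spectral := ⟨μ, inferInstance, S, h⟩
  power := ⟨_, (h.hasTimeAvg_powerNorm hu).1⟩

lemma boundedPower_zero [Fintype ι] : BoundedPower (0 : Signal ι) := by
  refine BddSignal.zero.boundedPower (μ := volume) (S := fun _ => 0) ?_
  rw [isSpectralDensity_iff]
  exact fun i j => SpecPair.zero_left

lemma powerNorm_zero [Fintype ι] : powerNorm (0 : Signal ι) = 0 := by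
  have : HasTimeAvg (fun t => (0 : Signal ι) t ⬝ᵥ (0 : Signal ι) t) 0 := by
    simpa using HasTimeAvg.zero
  exact pow_eq_zero_iff (two_ne_zero) |>.1 this.powerNorm_sq

lemma orthogonal_zero {v : Signal κ} : Orthogonal (0 : Signal ι) v := by
  rw [Orthogonal, isSpectralDensity_iff]
  exact fun i j => SpecPair.zero_left

end

/-! ### Responses of linear time-invariant maps -/

lemma IsImpulseResponse.freq_eq {p m : Type*} {M : TransferMatrix p m} {D : Matrix p m ℝ}
    {h : ℝ → Matrix p m ℝ} (hM : IsImpulseResponse M D h) (ω : ℝ) (i : p) (j : m) :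
    freq M ω i j = (D i j : ℂ) + freqInt (fun t => h t i j) ω := hM.2 ω i j

section

variable {p m : Type*} [Fintype m]

/-- The response, on `t ≥ 0`, of the map with impulse response `D δ + h`. -/
def ltiResp (D : Matrix p m ℝ) (h : ℝ → Matrix p m ℝ) (u : Signal m) : Signal p :=
  fun t i => if 0 ≤ t then
    ∑ j, (D i j * u t j + convol (fun t => h t i j) (fun s => u s j) t) else 0

lemma isLTIOutput_iff {M : TransferMatrix p m} {u : Signal m} {y : Signal p} :
    IsLTIOutput M u y ↔ ∃ D h, IsImpulseResponse M D h ∧ y = ltiResp D h u := by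
  constructor
  · rintro ⟨D, h, hM, hn, hy⟩
    refine ⟨D, h, hM, ?_⟩
    ext t i
    rcases lt_or_ge t 0 with ht | ht
    · simp [ltiResp, hn t ht, ht.not_ge]
    · simp [ltiResp, ht, hy t ht, convol]
  · rintro ⟨D, h, hM, rfl⟩
    refine ⟨D, h, hM, fun t ht => ?_, fun t ht i => ?_⟩
    · ext i
      simp [ltiResp, ht.not_ge]
    · simp [ltiResp, ht, convol]

lemma BddSignal.ltiResp {D : Matrix p m ℝ} {h : ℝ → Matrix p m ℝ} {u : Signal m}
    (hh : ∀ i j, Integrable (fun t => h t i j)) (hu : BddSignal u) :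
    BddSignal (ltiResp D h u) := by
  refine ⟨fun i => ?_, fun t ht => by ext i; simp [MOCC.ltiResp, ht.not_ge]⟩
  have := (BddFun.sum Finset.univ fun j _ => ((hu.bddFun j).const_mul (D i j)).add
    ((hu.bddFun j).convol (hh i j))).indicator (measurableSet_Ici (a := (0 : ℝ)))
  convert this using 1
  ext t
  simp [MOCC.ltiResp, Set.indicator_apply]

lemma ltiResp_add {D : Matrix p m ℝ} {h : ℝ → Matrix p m ℝ} {u v : Signal m}
    (hh : ∀ i j, Integrable (fun t => h t i j)) (hu : BddSignal u) (hv : BddSignal v) :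
    ltiResp D h (u + v) = ltiResp D h u + ltiResp D h v := by
  ext t i
  simp only [ltiResp, Pi.add_apply]
  split_ifs
  · rw [← Finset.sum_add_distrib]
    refine Finset.sum_congr rfl fun j _ => ?_
    have : convol (fun t => h t i j) (fun s => u s j + v s j) t =
        convol (fun t => h t i j) (fun s => u s j) t +
        convol (fun t => h t i j) (fun s => v s j) t := by
      simp only [convol, mul_add]
      exact integral_add (integrable_mul_bddFun' (hh i j) (hu.bddFun j) t)
        (integrable_mul_bddFun' (hh i j) (hv.bddFun j) t)
    rw [this]
    ring
  · simp

lemma ltiResp_zero {D : Matrix p m ℝ} {h : ℝ → Matrix p m ℝ} :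
    ltiResp D h (0 : Signal m) = 0 := by
  ext t i
  simp [ltiResp, convol]

lemma IsSpectralDensity.ltiResp_left {κ : Type*} {u : Signal m} {v : Signal κ} {μ : Measure ℝ}
    [SFinite μ] {S : ℝ → Matrix m κ ℂ} {M : TransferMatrix p m} {D : Matrix p m ℝ}
    {h : ℝ → Matrix p m ℝ} (hM : IsImpulseResponse M D h) (hu : BddSignal u) (hv : BddSignal v)
    (H : IsSpectralDensity u v μ S) :
    IsSpectralDensity (ltiResp D h u) v μ (fun ω => freq M ω * S ω) := by
  have hy := hu.ltiResp (D := D) hM.1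
  rw [isSpectralDensity_iff] at H ⊢
  intro i k
  have hterm : ∀ j, BddFun (fun t => D i j * u t j +
      convol (fun t => h t i j) (fun s => u s j) t) := fun j =>
    ((hu.bddFun j).const_mul (D i j)).add ((hu.bddFun j).convol (hM.1 i j))
  have h1 : SpecPair (fun t => ∑ j, (D i j * u t j + convol (fun t => h t i j) (fun s => u s j) t))
      (fun t => v t k) μ
      (fun ω => ∑ j, ((D i j : ℂ) * S ω j k + freqInt (fun t => h t i j) ω * S ω j k)) := by
    refine SpecPair.sum Finset.univ hterm (hv.bddFun k) fun j => ?_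
    exact ((H j k).const_mul (D i j)).add ((hu.bddFun j).const_mul _)
      ((hu.bddFun j).convol (hM.1 i j)) (hv.bddFun k)
      ((H j k).convol (hM.1 i j) (hu.bddFun j) (hv.bddFun k))
  refine (h1.congr fun ω => ?_).congr_left_of_le (BddFun.sum _ fun j _ => hterm j) (hy.bddFun i)
    (hv.bddFun k) 0 fun t ht => by simp [ltiResp, ht]
  simp only [Matrix.mul_apply, hM.freq_eq, add_mul]

end

/-- The signal `a` is generated from `r` by a map with frequency response `F`: its cross spectral
densities arise from those of `r` by multiplication with `F`. -/
structure IsResponse {p m : Type} [Fintype m] (F : ℝ → Matrix p m ℂ) (r : Signal m)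
    (a : Signal p) : Prop where
  bdd : BddSignal r → BddSignal a
  spectral : BddSignal r → ∀ {κ : Type} (v : Signal κ), BddSignal v → ∀ (μ : Measure ℝ) [SFinite μ]
    (S : ℝ → Matrix m κ ℂ), IsSpectralDensity r v μ S → IsSpectralDensity a v μ (fun ω => F ω * S ω)

namespace IsResponse

variable {p q m : Type} [Fintype m] {F G : ℝ → Matrix p m ℂ} {r : Signal m} {a b : Signal p}

lemma refl [DecidableEq m] (r : Signal m) : IsResponse (fun _ => 1) r r :=
  ⟨id, fun _ _ v _ μ _ S h => by simpa using h⟩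

lemma congr (h : IsResponse F r a) (hF : ∀ ω, F ω = G ω) : IsResponse G r a := by
  rwa [show G = F from funext fun ω => (hF ω).symm]

lemma add (h : IsResponse F r a) (h' : IsResponse G r b) :
    IsResponse (fun ω => F ω + G ω) r (a + b) :=
  ⟨fun hr => (h.bdd hr).add (h'.bdd hr), fun hr _ v hv μ _ S hS =>
    ((h.spectral hr v hv μ S hS).add (h.bdd hr) (h'.bdd hr) hv
      (h'.spectral hr v hv μ S hS)).congr fun _ => (Matrix.add_mul _ _ _).symm⟩

lemma const_smul (c : ℝ) (h : IsResponse F r a) :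
    IsResponse (fun ω => (c : ℂ) • F ω) r (c • a) :=
  ⟨fun hr => (h.bdd hr).const_smul c, fun hr _ v hv μ _ S hS => by
    simpa only [smul_mul] using (h.spectral hr v hv μ S hS).const_smul c⟩

lemma ltiResp [Fintype p] {M : TransferMatrix q p} {D : Matrix q p ℝ} {h : ℝ → Matrix q p ℝ}
    (hM : IsImpulseResponse M D h) (ha : IsResponse F r a) :
    IsResponse (fun ω => freq M ω * F ω) r (MOCC.ltiResp D h a) :=
  ⟨fun hr => (ha.bdd hr).ltiResp hM.1, fun hr _ v hv μ _ S hS => by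
    simpa only [Matrix.mul_assoc] using (ha.spectral hr v hv μ S hS).ltiResp_left hM (ha.bdd hr) hv⟩

/-- Swapping the arguments, filtering on the left and swapping back turns the frequency response
into its adjoint on the right. -/
lemma spectral_right {κ : Type} {v : Signal κ} {μ : Measure ℝ} [SFinite μ] {S : ℝ → Matrix κ m ℂ}
    (ha : IsResponse F r a) (hr : BddSignal r) (hv : BddSignal v)
    (h : IsSpectralDensity v r μ S) : IsSpectralDensity v a μ (fun ω => S ω * (F ω)ᴴ) := by
  have := (ha.spectral hr v hv μ _ (h.swap hv hr)).swap (ha.bdd hr) hv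
  exact this.congr fun ω => by simp

lemma spectral_mul {G : ℝ → Matrix q m ℂ} {b : Signal q} {μ : Measure ℝ} [SFinite μ]
    {S : ℝ → Matrix m m ℂ} (ha : IsResponse F r a) (hb : IsResponse G r b) (hr : BddSignal r)
    (h : IsSpectralDensity r r μ S) : IsSpectralDensity a b μ (fun ω => F ω * S ω * (G ω)ᴴ) :=
  hb.spectral_right hr (ha.bdd hr) (ha.spectral hr r hr μ S h)

end IsResponse

/-! ### The Plancherel identity on `L¹ ∩ L²` and the gain of a filter -/

section

open FourierTransform Real

/-- The L² Fourier transform is an isometry; what needs proof is that it agrees a.e. with the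
integral transform. Both have the same pairing with test functions, by distributional duality for
the one and Fubini for the other. -/
lemma plancherel {f : ℝ → ℂ} (h1 : Integrable f) (h2 : MemLp f 2) :
    MemLp (𝓕 f) 2 ∧ ∫ ξ, ‖𝓕 f ξ‖ ^ 2 = ∫ x, ‖f x‖ ^ 2 := by
  set F : Lp ℂ 2 (volume : Measure ℝ) := h2.toLp f with hF
  have hFf : F =ᵐ[volume] f := h2.coeFn_toLp
  have hcont : Continuous (𝓕 f) :=
    VectorFourier.fourierIntegral_continuous continuous_fourierChar continuous_inner h1
  have hae : (𝓕 F : Lp ℂ 2 (volume : Measure ℝ)) =ᵐ[volume] 𝓕 f := by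
    refine ae_eq_of_integral_contDiff_smul_eq
      ((Lp.memLp (𝓕 F : Lp ℂ 2 (volume : Measure ℝ))).locallyIntegrable (by norm_num))
      hcont.locallyIntegrable fun g hg hgc => ?_
    set φ : SchwartzMap ℝ ℂ := HasCompactSupport.toSchwartzMap (f := fun x => ((g x : ℝ) : ℂ))
      (hgc.comp_left (g := fun x : ℝ => (x : ℂ)) (by simp))
      (Complex.ofRealCLM.contDiff.comp hg) with hφ
    have hφg : ∀ x, φ x = ((g x : ℝ) : ℂ) := fun x => rfl
    have e := congrArg (fun Λ => Λ φ) (Lp.fourier_toTemperedDistribution_eq F)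
    simp only [TemperedDistribution.fourier_apply, Lp.toTemperedDistribution_apply] at e
    have e2 : ∫ x, (𝓕 φ : SchwartzMap ℝ ℂ) x • F x = ∫ x, φ x • 𝓕 f x := by
      rw [integral_congr_ae (g := fun x => (𝓕 φ : SchwartzMap ℝ ℂ) x • f x)
        (hFf.mono fun x hx => by simp [hx])]
      have := VectorFourier.integral_fourierIntegral_smul_eq_flip (μ := volume) (ν := volume)
        (L := innerₗ ℝ) (e := 𝐞) continuous_fourierChar continuous_inner φ.integrable h1
      rw [flip_innerₗ] at this
      rw [SchwartzMap.fourier_coe]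
      exact this
    rw [e] at e2
    simpa [hφg] using e2
  have hm : MemLp (𝓕 f) 2 := (memLp_congr_ae hae).1 (Lp.memLp _)
  refine ⟨hm, ?_⟩
  have hsq : ∀ {u : ℝ → ℂ} {U : Lp ℂ 2 (volume : Measure ℝ)}, U =ᵐ[volume] u →
      ((∫ x, ‖u x‖ ^ 2 : ℝ) : ℂ) = ((‖U‖ ^ 2 : ℝ) : ℂ) := fun {u U} h => by
    have h3 := inner_self_eq_norm_sq_to_K (𝕜 := ℂ) U
    rw [L2.inner_def] at h3
    rw [Complex.ofReal_pow]
    refine (integral_ofReal (𝕜 := ℂ)).symm.trans (Eq.trans (integral_congr_ae ?_) h3)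
    refine h.mono fun x hx => ?_
    simp only [hx, inner_self_eq_norm_sq_to_K]
    simp
  have h4 := hsq hae
  rw [Lp.norm_fourier_eq, ← hsq hFf] at h4
  exact_mod_cast h4

end

lemma fourier_ofReal (h : ℝ → ℝ) (ξ : ℝ) :
    FourierTransform.fourier (fun t => ((h t : ℝ) : ℂ)) ξ = freqInt h (2 * Real.pi * ξ) := by
  rw [Real.fourier_real_eq_integral_exp_smul, freqInt]
  congr 1 with t
  rw [smul_eq_mul, mul_comm]
  congr 2
  push_cast
  ring

lemma convolution_ofReal (h u : ℝ → ℝ) :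
    convolution (fun t => ((h t : ℝ) : ℂ)) (fun t => ((u t : ℝ) : ℂ))
      (ContinuousLinearMap.mul ℂ ℂ) volume = fun t => ((convol h u t : ℝ) : ℂ) := by
  ext t
  rw [convolution_def, convol_eq, ← integral_complex_ofReal]
  simp

/-- The energy gain of a filter is at most the supremum of the norm of its frequency response. -/
lemma energy_gain_le {p m : Type*} [Fintype p] [Fintype m] {D : Matrix p m ℝ}
    {h : ℝ → Matrix p m ℝ} (hh : ∀ i j, Integrable (fun t => h t i j)) {g : ℝ}
    (hg : ∀ (ω : ℝ) (x : m → ℂ),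
      ∑ i, ‖∑ j, ((D i j : ℂ) + freqInt (fun t => h t i j) ω) * x j‖ ^ 2 ≤ g ^ 2 * ∑ j, ‖x j‖ ^ 2)
    {e : m → ℝ → ℝ} (he : ∀ j, BddFun (e j)) (hei : ∀ j, Integrable (e j)) :
    (∀ i, Integrable (fun t => (∑ j, (D i j * e j t + convol (fun t => h t i j) (e j) t)) ^ 2)) ∧
    ∑ i, ∫ t, (∑ j, (D i j * e j t + convol (fun t => h t i j) (e j) t)) ^ 2 ≤
      g ^ 2 * ∑ j, ∫ t, e j t ^ 2 := by
  set y : p → ℝ → ℝ := fun i t => ∑ j, (D i j * e j t + convol (fun t => h t i j) (e j) t) with hy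
  have hconv : ∀ i j, Integrable (fun t => convol (fun t => h t i j) (e j) t) := fun i j => by
    have := ((hh i j).ofReal (𝕜 := ℂ)).integrable_convolution (ContinuousLinearMap.mul ℂ ℂ)
      ((hei j).ofReal (𝕜 := ℂ))
    have h2 := convolution_ofReal (fun t => h t i j) (e j)
    simp only [Complex.coe_algebraMap] at this
    rw [h2] at this
    simpa using this.re
  have hyi : ∀ i, Integrable (y i) := fun i =>
    integrable_finsetSum _ fun j _ => ((hei j).const_mul _).add (hconv i j)
  have hyb : ∀ i, BddFun (y i) := fun i => BddFun.sum _ fun j _ =>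
    ((he j).const_mul _).add ((he j).convol (hh i j))
  have hsq : ∀ {f : ℝ → ℝ}, BddFun f → Integrable f → Integrable (fun t => f t ^ 2) :=
    fun {f} hb hi => by
      obtain ⟨M, hM⟩ := hb.bdd
      simpa only [pow_two] using hi.mul_bdd hb.aesm (Eventually.of_forall hM)
  -- A bounded integrable function is square integrable, so Plancherel applies to each component of
  -- input and output.
  have hpl : ∀ {f : ℝ → ℝ}, BddFun f → Integrable f →
      Integrable (fun ξ => ‖FourierTransform.fourier (fun t => ((f t : ℝ) : ℂ)) ξ‖ ^ 2) ∧
      ∫ ξ, ‖FourierTransform.fourier (fun t => ((f t : ℝ) : ℂ)) ξ‖ ^ 2 = ∫ t, f t ^ 2 :=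
    fun {f} hb hi => by
      have hi' : Integrable (fun t => ((f t : ℝ) : ℂ)) := hi.ofReal
      have h2 : MemLp (fun t => ((f t : ℝ) : ℂ)) 2 := by
        rw [memLp_two_iff_integrable_sq_norm hi'.aestronglyMeasurable]
        simpa using hsq hb hi
      obtain ⟨h3, h4⟩ := plancherel hi' h2
      refine ⟨(memLp_two_iff_integrable_sq_norm h3.1).1 h3, h4.trans ?_⟩
      simp
  refine ⟨fun i => hsq (hyb i) (hyi i), ?_⟩
  -- On the Fourier side the filter is pointwise multiplication by D + ĥ, at angular frequency ω =
  -- 2πξ; the energy bound then follows by integrating the gain hypothesis over ξ.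
  have hfy : ∀ i ξ, FourierTransform.fourier (fun t => ((y i t : ℝ) : ℂ)) ξ =
      ∑ j, ((D i j : ℂ) + freqInt (fun t => h t i j) (2 * Real.pi * ξ)) *
        FourierTransform.fourier (fun t => ((e j t : ℝ) : ℂ)) ξ := fun i ξ => by
    have hc : ∀ j, freqInt (fun t => convol (fun t => h t i j) (e j) t) (2 * Real.pi * ξ) =
        freqInt (fun t => h t i j) (2 * Real.pi * ξ) * freqInt (e j) (2 * Real.pi * ξ) := fun j => by
      rw [← fourier_ofReal, ← fourier_ofReal, ← fourier_ofReal, ← convolution_ofReal]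
      exact Real.fourier_mul_convolution_eq (hh i j).ofReal (hei j).ofReal ξ
    have hie : ∀ {f : ℝ → ℝ}, Integrable f → Integrable (fun t : ℝ => ((f t : ℝ) : ℂ) *
        Complex.exp (-(((2 * Real.pi * ξ : ℝ) : ℂ) * (t : ℂ) * Complex.I))) := fun {f} hf =>
      hf.ofReal.mul_bdd (c := 1) (Continuous.aestronglyMeasurable (by fun_prop))
        (Eventually.of_forall fun t => (norm_exp_neg_mul_I _ t).le)
    rw [fourier_ofReal]
    simp only [fourier_ofReal]
    rw [freqInt]
    simp only [hy, Complex.ofReal_sum, Finset.sum_mul]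
    have hterm : ∀ j, Integrable (fun t : ℝ =>
        ((D i j * e j t + convol (fun t => h t i j) (e j) t : ℝ) : ℂ) *
        Complex.exp (-(((2 * Real.pi * ξ : ℝ) : ℂ) * (t : ℂ) * Complex.I))) := fun j =>
      hie (((hei j).const_mul _).add (hconv i j))
    rw [integral_finsetSum _ fun j _ => hterm j]
    refine Finset.sum_congr rfl fun j _ => ?_
    rw [add_mul, ← hc, freqInt, freqInt, ← integral_const_mul,
      ← integral_add ((hie (hei j)).const_mul _) (hie (hconv i j))]
    congr 1 with t
    push_cast
    ring
  change ∑ i, ∫ t, y i t ^ 2 ≤ _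
  simp only [← fun i => (hpl (hyb i) (hyi i)).2, ← fun j => (hpl (he j) (hei j)).2]
  rw [← integral_finsetSum _ fun i _ => (hpl (hyb i) (hyi i)).1,
    ← integral_finsetSum _ fun j _ => (hpl (he j) (hei j)).1, ← integral_const_mul]
  refine integral_mono (integrable_finsetSum _ fun i _ => (hpl (hyb i) (hyi i)).1)
    ((integrable_finsetSum _ fun j _ => (hpl (he j) (hei j)).1).const_mul _) fun ξ => ?_
  simp only [hfy]
  exact hg _ _

/-! ### Asymptotic adjoints and gains of filters -/

/-- If the integrals `∫₀ᵀ F T a` are `O(1 + |a|)` and `O(T)`, their filtered time averages vanish. -/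
lemma tendsto_integral_mul_of_shift_bound {h : ℝ → ℝ} (hh : Integrable h) {G : ℝ → ℝ → ℝ} {K : ℝ}
    (hG : ∀ T, AEStronglyMeasurable (G T) volume)
    (h1 : ∀ T > 0, ∀ a, |G T a| ≤ K * T) (h2 : ∀ T > 0, ∀ a, |G T a| ≤ K * |a|) :
    Tendsto (fun T : ℝ => T⁻¹ * ∫ a, h a * G T a) atTop (𝓝 0) := by
  -- The O(T) bound supplies the majorant |h| K, the O(|a|) bound the pointwise limit 0. No moment
  -- of h is required.
  have key : Tendsto (fun T : ℝ => ∫ a, T⁻¹ * (h a * G T a)) atTop (𝓝 (∫ _ : ℝ, (0 : ℝ))) := by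
    refine tendsto_integral_filter_of_dominated_convergence (fun a => |h a| * K) ?_ ?_
      (hh.abs.mul_const _) (Eventually.of_forall fun a => ?_)
    · filter_upwards with T
      exact (hh.aestronglyMeasurable.mul (hG T)).const_mul _
    · filter_upwards [eventually_gt_atTop 0] with T hT
      refine Eventually.of_forall fun a => ?_
      rw [Real.norm_eq_abs, abs_mul, abs_mul, abs_of_pos (inv_pos.2 hT)]
      calc T⁻¹ * (|h a| * |G T a|) ≤ T⁻¹ * (|h a| * (K * T)) := by
            gcongr
            exact h1 T hT a
        _ = |h a| * K := by field_simp
    · apply squeeze_zero_norm' (a := fun T : ℝ => T⁻¹ * (|h a| * (K * |a|)))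
      · filter_upwards [eventually_gt_atTop 0] with T hT
        rw [Real.norm_eq_abs, abs_mul, abs_mul, abs_of_pos (inv_pos.2 hT)]
        gcongr
        exact h2 T hT a
      · simpa using tendsto_inv_atTop_zero.mul_const (|h a| * (K * |a|))
  simpa [integral_const_mul] using key

/-- After Fubini the two integrals over [0, T] differ, for each lag b, only by a shift of one
integrand by b, hence by boundary terms O(|b|). The correlations of a and e themselves need not
exist. -/
lemma hasTimeAvg_mul_convol_sub {h a e : ℝ → ℝ} (hh : Integrable h) (ha : BddFun a)
    (he : BddFun e) :
    HasTimeAvg (fun t => a t * convol h e t - convol (fun s => h (-s)) a t * e t) 0 := by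
  obtain ⟨M, hM0, hM⟩ := ha.exists_pos
  obtain ⟨N, hN0, hN⟩ := he.exists_pos
  have hh' : Integrable (fun s => h (-s)) := hh.comp_neg
  have hB : ∀ b t, |e (t - b) * a t| ≤ N * M := fun b t => by
    rw [abs_mul]
    exact mul_le_mul (hN _) (hM t) (abs_nonneg _) hN0.le
  have hB' : ∀ b t, |a (t + b) * e t| ≤ N * M := fun b t => by
    rw [abs_mul, mul_comm N]
    exact mul_le_mul (hM _) (hN t) (abs_nonneg _) hM0.le
  have hG1 : ∀ T, AEStronglyMeasurable (fun b => ∫ t in (0 : ℝ)..T, e (t - b) * a t) volume :=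
    fun T => by simpa [sub_eq_add_neg] using aestronglyMeasurable_integral_shift_mul he ha 0 T
  have hG2 : ∀ T, AEStronglyMeasurable (fun b => ∫ t in (0 : ℝ)..T, a (t + b) * e t) volume :=
    fun T => by
      have := (aestronglyMeasurable_integral_shift_mul ha he 0 T).comp_quasiMeasurePreserving
        (Measure.measurePreserving_neg volume).quasiMeasurePreserving
      simpa [Function.comp_def] using this
  have hint : ∀ {G : ℝ → ℝ} {C : ℝ}, AEStronglyMeasurable G volume → (∀ b, |G b| ≤ C) →
      Integrable (fun b => h b * G b) := fun {G C} hm hb =>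
    hh.mul_bdd (c := C) hm (Eventually.of_forall hb)
  have hm2 : ∀ b, BddFun (fun t => e (t - b) * a t) := fun b => by
    simpa only [sub_eq_add_neg] using (he.shift (-b)).mul ha
  refine (tendsto_integral_mul_of_shift_bound hh (K := 2 * (N * M))
    (fun T => (hG1 T).sub (hG2 T)) ?_ ?_).congr fun T => ?_
  · intro T hT b
    have h1 := BddFun.abs_integral_le (hB b) 0 T
    have h2 := BddFun.abs_integral_le (hB' b) 0 T
    rw [sub_zero, abs_of_pos hT] at h1 h2
    refine (abs_sub _ _).trans ?_
    linarith
  · intro T hT b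
    have := (hm2 b).abs_integral_shift_sub_le (hB b) b T
    rw [Pi.sub_apply, abs_sub_comm]
    simpa only [add_sub_cancel_right, mul_comm (e _)] using this
  · have e1 := integral_convol_mul hh he ha 0 T
    have e2 := integral_convol_mul hh' ha he 0 T
    simp only [add_zero, zero_sub] at e1 e2
    rw [← integral_neg_eq_self] at e2
    simp only [neg_neg] at e2
    simp only [mul_comm (a _) (convol _ _ _)]
    rw [intervalIntegral.integral_sub (((he.convol hh).mul ha).intervalIntegrable _ _)
      (((ha.convol hh').mul he).intervalIntegrable _ _), e1, e2]
    simp only [Pi.sub_apply, mul_sub, ← sub_eq_add_neg]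
    rw [integral_sub (hint (hG1 T) fun b => BddFun.abs_integral_le (hB b) 0 T)
      (hint (hG2 T) fun b => BddFun.abs_integral_le (hB' b) 0 T), mul_sub]

/-- In the time average, the adjoint of the filter with impulse response `D δ + h` is the filter with
impulse response `D' δ + h(-·)'`. -/
lemma hasTimeAvg_ltiResp_adjoint {p m : Type*} [Fintype p] [Fintype m] {D : Matrix p m ℝ}
    {h : ℝ → Matrix p m ℝ} (hh : ∀ i j, Integrable (fun t => h t i j)) {a : Signal p}
    {e : Signal m} (ha : BddSignal a) (he : BddSignal e) :
    HasTimeAvg (fun t => a t ⬝ᵥ ltiResp D h e t - ltiResp Dᵀ (fun t => (h (-t))ᵀ) a t ⬝ᵥ e t) 0 := by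
  have hh' : ∀ j i, Integrable (fun t => (h (-t))ᵀ j i) := fun j i => (hh i j).comp_neg
  have hb : ∀ i j, BddFun (fun t => a t i * convol (fun t => h t i j) (fun s => e s j) t -
      convol (fun t => h (-t) i j) (fun s => a s i) t * e t j) := fun i j =>
    ((ha.bddFun i).mul ((he.bddFun j).convol (hh i j))).sub
      (((ha.bddFun i).convol (hh' j i)).mul (he.bddFun j))
  have h0 := HasTimeAvg.sum Finset.univ (fun i _ => BddFun.sum Finset.univ fun j _ => hb i j)
    fun i _ => HasTimeAvg.sum Finset.univ (fun j _ => hb i j) fun j _ =>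
      hasTimeAvg_mul_convol_sub (hh i j) (ha.bddFun i) (he.bddFun j)
  simp only [Finset.sum_const_zero] at h0
  refine h0.congr_of_le (BddFun.sum _ fun i _ => BddFun.sum _ fun j _ => hb i j)
    ((ha.dotProduct (he.ltiResp hh)).sub ((ha.ltiResp hh').dotProduct he)) 0 fun t ht => ?_
  simp only [ltiResp, ht, if_true, dotProduct, Finset.mul_sum, Finset.sum_mul, Matrix.transpose_apply]
  rw [Finset.sum_comm (s := (Finset.univ : Finset m)), ← Finset.sum_sub_distrib]
  refine Finset.sum_congr rfl fun i _ => ?_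
  rw [← Finset.sum_sub_distrib]
  refine Finset.sum_congr rfl fun j _ => ?_
  ring

/-- A noncausal filter lets inputs after T leak into [0, T]. At lag a the leakage is bounded by a
multiple of both T and |a|, so it is negligible on average. -/
lemma tendsto_avg_convol_future {h : ℝ → ℝ} (hh : Integrable h) :
    Tendsto (fun T : ℝ => T⁻¹ * ∫ t in (0 : ℝ)..T, convol h ((Set.Ioi T).indicator 1) t)
      atTop (𝓝 0) := by
  have h1 : BddFun (fun _ => (1 : ℝ)) := ⟨aestronglyMeasurable_const, 1, by simp⟩
  have hI : ∀ T : ℝ, BddFun ((Set.Ioi T).indicator 1) := fun T => h1.indicator measurableSet_Ioi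
  have hI1 : ∀ T t : ℝ, |(Set.Ioi T).indicator (1 : ℝ → ℝ) t| ≤ 1 := fun T t => by
    by_cases ht : t ∈ Set.Ioi T <;> simp [ht]
  refine (tendsto_integral_mul_of_shift_bound hh (K := 2)
    (G := fun T a => ∫ t in (0 : ℝ)..T, (Set.Ioi T).indicator 1 (t - a)) ?_ ?_ ?_).congr fun T => ?_
  · intro T
    simpa [sub_eq_add_neg] using aestronglyMeasurable_integral_shift_mul (hI T) h1 0 T
  · intro T hT a
    have := BddFun.abs_integral_le (fun t => hI1 T (t - a)) 0 T
    rw [sub_zero, abs_of_pos hT] at this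
    linarith
  · intro T hT a
    have := (hI T).abs_integral_shift_sub_le (hI1 T) (-a) T
    have h0 : ∫ t in (0 : ℝ)..T, (Set.Ioi T).indicator (1 : ℝ → ℝ) t = 0 := by
      refine intervalIntegral.integral_zero_ae (Eventually.of_forall fun t ht => ?_)
      rw [Set.uIoc_of_le hT.le] at ht
      simp [ht.2]
    rw [h0, sub_zero, abs_neg] at this
    simpa [sub_eq_add_neg] using this
  · have := integral_convol_mul hh (hI T) h1 0 T
    simp only [add_zero, mul_one, zero_sub, ← sub_eq_add_neg] at this
    rw [this]

/-- The asymptotic power gain of a filter is at most the supremum of the norm of its frequency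
response. -/
lemma eventually_avg_gain_le {p m : Type*} [Fintype p] [Fintype m] {D : Matrix p m ℝ}
    {h : ℝ → Matrix p m ℝ} (hh : ∀ i j, Integrable (fun t => h t i j)) {g : ℝ}
    (hg : ∀ (ω : ℝ) (x : m → ℂ),
      ∑ i, ‖∑ j, ((D i j : ℂ) + freqInt (fun t => h t i j) ω) * x j‖ ^ 2 ≤ g ^ 2 * ∑ j, ‖x j‖ ^ 2)
    {e : Signal m} (he : BddSignal e) {ε : ℝ} (hε : 0 < ε) :
    ∀ᶠ T : ℝ in atTop, T⁻¹ * ∫ t in (0 : ℝ)..T,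
      (ltiResp D h e t ⬝ᵥ ltiResp D h e t - g ^ 2 * (e t ⬝ᵥ e t)) ≤ ε := by
  have hyb := he.ltiResp (D := D) hh
  choose N hN0 hN using fun j => (he.bddFun j).exists_pos
  choose B hB0 hB using fun i => (hyb.bddFun i).exists_pos
  set C : p → ℝ := fun i => B i + ∑ j, (|D i j| * N j + (∫ a, |h a i j|) * N j) with hC
  -- the truncated input and the corresponding output
  set f : ℝ → m → ℝ → ℝ := fun T j => (Set.Ioc 0 T).indicator fun s => e s j with hf
  set y : ℝ → p → ℝ → ℝ := fun T i t =>
    ∑ j, (D i j * f T j t + convol (fun t => h t i j) (f T j) t) with hy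
  have hfb : ∀ T j, BddFun (f T j) := fun T j => (he.bddFun j).indicator measurableSet_Ioc
  have hfN : ∀ T j t, |f T j t| ≤ N j := fun T j t => by
    by_cases ht : t ∈ Set.Ioc 0 T
    · simpa [hf, ht] using hN j t
    · simpa [hf, ht] using (hN0 j).le
  have hfi : ∀ T j, Integrable (f T j) := fun T j => by
    rw [hf, integrable_indicator_iff measurableSet_Ioc]
    rcases le_total 0 T with hT | hT
    · exact (intervalIntegrable_iff_integrableOn_Ioc_of_le hT).1 ((he.bddFun j).intervalIntegrable _ _)
    · simp [hT]
  have hyc : ∀ T i, BddFun (y T i) := fun T i => BddFun.sum _ fun j _ =>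
    ((hfb T j).const_mul _).add ((hfb T j).convol (hh i j))
  have hyC : ∀ T i t, |y T i t| ≤ ∑ j, (|D i j| * N j + (∫ a, |h a i j|) * N j) := fun T i t => by
    refine (Finset.abs_sum_le_sum_abs _ _).trans (Finset.sum_le_sum fun j _ => ?_)
    refine (abs_add_le _ _).trans (add_le_add ?_ (abs_convol_le (hh i j) (hfN T j) t))
    rw [abs_mul]
    exact mul_le_mul_of_nonneg_left (hfN T j t) (abs_nonneg _)
  -- the contribution of the inputs after the time `T`
  set δ : ℝ → ℝ := fun T => ∑ i, C i * ∑ j, N j *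
    (T⁻¹ * ∫ t in (0 : ℝ)..T, convol (fun t => |h t i j|) ((Set.Ioi T).indicator 1) t) with hδ
  have hδ0 : Tendsto δ atTop (𝓝 0) := by
    rw [show (0 : ℝ) = ∑ i, C i * ∑ j, N j * 0 by simp]
    exact tendsto_finsetSum _ fun i _ => (tendsto_finsetSum _ fun j _ =>
      (tendsto_avg_convol_future (hh i j).abs).const_mul _).const_mul _
  filter_upwards [hδ0.eventually (gt_mem_nhds hε), eventually_gt_atTop 0] with T hTε hT
  refine le_trans ?_ hTε.le
  have h1b : BddFun ((Set.Ioi T).indicator 1) :=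
    BddFun.indicator (f := fun _ => 1) ⟨aestronglyMeasurable_const, 1, by simp⟩ measurableSet_Ioi
  -- Factor the difference of squares: C bounds the sum of true and truncated outputs, while their
  -- difference involves only inputs after T.
  have hdiff : ∀ i, ∀ t ∈ Set.Ioc 0 T, ltiResp D h e t i ^ 2 ≤ y T i t ^ 2 + C i *
      ∑ j, N j * convol (fun t => |h t i j|) ((Set.Ioi T).indicator 1) t := fun i t ht => by
    have e1 : ltiResp D h e t i - y T i t =
        ∑ j, (convol (fun t => h t i j) (fun s => e s j) t - convol (fun t => h t i j) (f T j) t) := by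
      simp only [ltiResp, ht.1.le, if_true, hy]
      rw [← Finset.sum_sub_distrib]
      refine Finset.sum_congr rfl fun j _ => ?_
      simp [hf, ht.1, ht.2]
    have e2 : |ltiResp D h e t i - y T i t| ≤
        ∑ j, N j * convol (fun t => |h t i j|) ((Set.Ioi T).indicator 1) t := by
      rw [e1]
      refine (Finset.abs_sum_le_sum_abs _ _).trans (Finset.sum_le_sum fun j _ => ?_)
      simp only [convol]
      rw [← integral_sub (integrable_mul_bddFun' (hh i j) (he.bddFun j) t)
        (integrable_mul_bddFun' (hh i j) (hfb T j) t), ← integral_const_mul, ← Real.norm_eq_abs]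
      refine norm_integral_le_of_norm_le
        ((integrable_mul_bddFun' (hh i j).abs h1b t).const_mul _) ?_
      -- The truncation to (0, T] drops the value at 0, where e may be nonzero; this is a null set.
      have hne : ∀ᵐ s : ℝ, s ≠ 0 := by simp [ae_iff]
      filter_upwards [hne] with s hs
      rw [← mul_sub, Real.norm_eq_abs, abs_mul]
      by_cases h1 : s ∈ Set.Ioc 0 T
      · have : s ∉ Set.Ioi T := by simpa using h1.2
        simp [hf, h1, this]
      · rcases lt_or_gt_of_ne hs with h0 | h0
        · have h2 : s ∉ Set.Ioi T := by simpa using (h0.trans hT).le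
          simp [hf, h1, he.zero_of_neg s h0, h2]
        · have h2 : s ∈ Set.Ioi T := not_le.1 fun h3 => h1 ⟨h0, h3⟩
          simp only [hf, h1, not_false_eq_true, Set.indicator_of_notMem, sub_zero,
            Set.indicator_of_mem h2, Pi.one_apply, mul_one]
          rw [mul_comm]
          exact mul_le_mul_of_nonneg_right (hN j s) (abs_nonneg _)
    have e3 : |ltiResp D h e t i + y T i t| ≤ C i :=
      (abs_add_le _ _).trans (add_le_add (hB i t) (hyC T i t))
    have e4 : ltiResp D h e t i ^ 2 - y T i t ^ 2 ≤
        |ltiResp D h e t i + y T i t| * |ltiResp D h e t i - y T i t| := by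
      rw [← abs_mul]
      refine le_trans (le_of_eq ?_) (le_abs_self _)
      ring
    have e5 := mul_le_mul e3 e2 (abs_nonneg _) ((abs_nonneg _).trans e3)
    linarith
  -- The truncated input has finite energy, so the energy gain holds on the whole line and bounds
  -- the output energy on [0, T].
  obtain ⟨hys, hE⟩ := energy_gain_le hh hg (hfb T) (hfi T)
  have hcv : ∀ i j, IntervalIntegrable
      (convol (fun t => |h t i j|) ((Set.Ioi T).indicator 1)) volume 0 T := fun i j =>
    (h1b.convol (hh i j).abs).intervalIntegrable _ _
  have hsq : ∀ {f : ℝ → ℝ}, BddFun f → IntervalIntegrable (fun t => f t ^ 2) volume 0 T :=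
    fun {f} hf => by simpa only [pow_two] using (hf.mul hf).intervalIntegrable 0 T
  have i1 : ∫ t in (0 : ℝ)..T, ltiResp D h e t ⬝ᵥ ltiResp D h e t ≤ (∑ i, ∫ t, y T i t ^ 2) +
      ∑ i, C i * ∑ j, N j *
        ∫ t in (0 : ℝ)..T, convol (fun t => |h t i j|) ((Set.Ioi T).indicator 1) t := by
    simp only [dotProduct, ← pow_two]
    rw [intervalIntegral.integral_finsetSum fun i _ => hsq (hyb.bddFun i),
      ← Finset.sum_add_distrib]
    refine Finset.sum_le_sum fun i _ => ?_
    have hci : IntervalIntegrable (fun t => C i *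
        ∑ j, N j * convol (fun t => |h t i j|) ((Set.Ioi T).indicator 1) t) volume 0 T :=
      ((BddFun.sum _ fun j _ => (h1b.convol (hh i j).abs).const_mul _).const_mul
        _).intervalIntegrable _ _
    calc ∫ t in (0 : ℝ)..T, ltiResp D h e t i ^ 2
        ≤ ∫ t in (0 : ℝ)..T, (y T i t ^ 2 + C i *
          ∑ j, N j * convol (fun t => |h t i j|) ((Set.Ioi T).indicator 1) t) := by
          refine intervalIntegral.integral_mono_on_of_le_Ioo hT.le (hsq (hyb.bddFun i))
            ((hsq (hyc T i)).add hci) fun t ht => hdiff i t ⟨ht.1, ht.2.le⟩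
      _ = (∫ t in (0 : ℝ)..T, y T i t ^ 2) + C i * ∑ j, N j *
          ∫ t in (0 : ℝ)..T, convol (fun t => |h t i j|) ((Set.Ioi T).indicator 1) t := by
          rw [intervalIntegral.integral_add (hsq (hyc T i)) hci,
            intervalIntegral.integral_const_mul,
            intervalIntegral.integral_finsetSum fun j _ => (hcv i j).const_mul _]
          simp only [intervalIntegral.integral_const_mul]
      _ ≤ _ := by
          gcongr
          rw [intervalIntegral.integral_of_le hT.le]
          exact setIntegral_le_integral (hys i) (Eventually.of_forall fun t => sq_nonneg _)
  have i2 : ∑ j, ∫ t, f T j t ^ 2 = ∫ t in (0 : ℝ)..T, e t ⬝ᵥ e t := by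
    simp only [dotProduct, ← pow_two]
    rw [intervalIntegral.integral_finsetSum fun i _ => hsq (he.bddFun i)]
    refine Finset.sum_congr rfl fun j _ => ?_
    rw [intervalIntegral.integral_of_le hT.le, ← integral_indicator measurableSet_Ioc]
    congr 1 with t
    by_cases ht : t ∈ Set.Ioc 0 T <;> simp [hf, ht]
  rw [intervalIntegral.integral_sub ((hyb.dotProduct hyb).intervalIntegrable _ _)
    (((he.dotProduct he).const_mul _).intervalIntegrable _ _), intervalIntegral.integral_const_mul,
    ← i2]
  calc _ ≤ T⁻¹ * ∑ i, C i * ∑ j, N j *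
        ∫ t in (0 : ℝ)..T, convol (fun t => |h t i j|) ((Set.Ioi T).indicator 1) t := by
        gcongr
        linarith
    _ = δ T := by
        simp only [hδ, Finset.mul_sum]
        refine Finset.sum_congr rfl fun i _ => Finset.sum_congr rfl fun j _ => ?_
        ring

/-! ### Evaluation of rational functions at a regular point -/

/-- The value of a rational function at a complex number. -/
abbrev ratEval (a : ℂ) : RatFunc ℝ → ℂ := RatFunc.eval (algebraMap ℝ ℂ) a

/-- The ring of real rational functions without a pole at `a`. -/
def regularAt (a : ℂ) : Subring (RatFunc ℝ) where
  carrier := {f | f.denom.eval₂ (algebraMap ℝ ℂ) a ≠ 0}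
  mul_mem' {f g} hf hg := fun h => by
    have := Polynomial.eval₂_dvd (algebraMap ℝ ℂ) a (RatFunc.denom_mul_dvd f g)
    rw [h, Polynomial.eval₂_mul, zero_dvd_iff] at this
    exact mul_ne_zero hf hg this
  add_mem' {f g} hf hg := fun h => by
    have := Polynomial.eval₂_dvd (algebraMap ℝ ℂ) a (RatFunc.denom_add_dvd f g)
    rw [h, Polynomial.eval₂_mul, zero_dvd_iff] at this
    exact mul_ne_zero hf hg this
  one_mem' := by simp
  zero_mem' := by simp
  neg_mem' {f} hf := fun h => by
    have h1 : (-f).denom ∣ f.denom := by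
      rw [RatFunc.denom_dvd (RatFunc.denom_ne_zero f)]
      exact ⟨-f.num, by rw [map_neg, neg_div, RatFunc.num_div_denom]⟩
    have := Polynomial.eval₂_dvd (algebraMap ℝ ℂ) a h1
    rw [h, zero_dvd_iff] at this
    exact hf this

lemma mem_regularAt {a : ℂ} {f : RatFunc ℝ} :
    f ∈ regularAt a ↔ f.denom.eval₂ (algebraMap ℝ ℂ) a ≠ 0 := Iff.rfl

/-- Evaluation at `a` as a ring homomorphism. -/
def evalHom (a : ℂ) : regularAt a →+* ℂ where
  toFun f := ratEval a f
  map_one' := RatFunc.eval_one _ _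
  map_zero' := RatFunc.eval_zero _ _
  map_mul' f g := RatFunc.eval_mul _ _ f.2 g.2
  map_add' f g := RatFunc.eval_add _ _ f.2 g.2

lemma algebraMap_mem_regularAt (a : ℂ) (p : Polynomial ℝ) :
    algebraMap (Polynomial ℝ) (RatFunc ℝ) p ∈ regularAt a := by
  simp [mem_regularAt]

lemma C_mem_regularAt (a : ℂ) (c : ℝ) : RatFunc.C c ∈ regularAt a := by
  simp [mem_regularAt]

lemma inv_mem_regularAt {a : ℂ} {f : RatFunc ℝ} (hf : f ∈ regularAt a) (h0 : ratEval a f ≠ 0) :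
    f⁻¹ ∈ regularAt a := by
  have hf0 : f ≠ 0 := by
    rintro rfl
    exact h0 (RatFunc.eval_zero _ _)
  intro h
  have := Polynomial.eval₂_dvd (algebraMap ℝ ℂ) a (RatFunc.denom_inv_dvd hf0)
  rw [h, zero_dvd_iff] at this
  exact h0 (by simp [ratEval, RatFunc.eval, this])

/-- The fraction need not be reduced: its reduced denominator divides q and so cannot vanish at a.
Such fractions occur for f(-s). -/
lemma ratEval_div {a : ℂ} (p q : Polynomial ℝ) (hq : q.eval₂ (algebraMap ℝ ℂ) a ≠ 0) :
    algebraMap _ (RatFunc ℝ) p / algebraMap _ (RatFunc ℝ) q ∈ regularAt a ∧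
    ratEval a (algebraMap _ (RatFunc ℝ) p / algebraMap _ (RatFunc ℝ) q) =
      p.eval₂ (algebraMap ℝ ℂ) a / q.eval₂ (algebraMap ℝ ℂ) a := by
  have hm : algebraMap _ (RatFunc ℝ) p / algebraMap _ (RatFunc ℝ) q ∈ regularAt a := fun h => by
    have := Polynomial.eval₂_dvd (algebraMap ℝ ℂ) a (RatFunc.denom_div_dvd p q)
    rw [h, zero_dvd_iff] at this
    exact hq this
  refine ⟨hm, ?_⟩
  have hq0 : algebraMap _ (RatFunc ℝ) q ≠ 0 := by
    intro h
    rw [map_eq_zero_iff _ (RatFunc.algebraMap_injective ℝ)] at h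
    simp [h] at hq
  have := RatFunc.eval_mul (algebraMap ℝ ℂ) a hm (algebraMap_mem_regularAt a q)
  rw [div_mul_cancel₀ _ hq0, RatFunc.eval_algebraMap, RatFunc.eval_algebraMap] at this
  rw [eq_div_iff hq]
  simpa using this.symm

section Matrix

variable {p q r : Type*} {a : ℂ}

/-- All entries of a transfer matrix are regular at `a`. -/
def IsRegularAt (a : ℂ) (M : TransferMatrix p q) : Prop := ∀ i j, M i j ∈ regularAt a

/-- Evaluation is a ring homomorphism only on functions regular at a. Lifting to that subring makes
it commute with products and determinants. -/
lemma IsRegularAt.exists_lift {M : TransferMatrix p q} (h : IsRegularAt a M) :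
    ∃ N : Matrix p q (regularAt a), M = N.map (regularAt a).subtype ∧
      M.map (ratEval a) = N.map (evalHom a) :=
  ⟨Matrix.of fun i j => ⟨M i j, h i j⟩, rfl, rfl⟩

lemma isRegularAt_map (N : Matrix p q (regularAt a)) :
    IsRegularAt a (N.map (regularAt a).subtype) := fun i j => (N i j).2

lemma IsRegularAt.mul [Fintype q] {M : TransferMatrix p q} {N : TransferMatrix q r}
    (hM : IsRegularAt a M) (hN : IsRegularAt a N) : IsRegularAt a (M * N) ∧
      (M * N).map (ratEval a) = M.map (ratEval a) * N.map (ratEval a) := by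
  obtain ⟨M', h1, h2⟩ := hM.exists_lift
  obtain ⟨N', h3, h4⟩ := hN.exists_lift
  rw [h2, h4, h1, h3, ← Matrix.map_mul, ← Matrix.map_mul]
  exact ⟨isRegularAt_map _, rfl⟩

lemma IsRegularAt.add {M N : TransferMatrix p q}
    (hM : IsRegularAt a M) (hN : IsRegularAt a N) : IsRegularAt a (M + N) ∧
      (M + N).map (ratEval a) = M.map (ratEval a) + N.map (ratEval a) := by
  refine ⟨fun i j => (regularAt a).add_mem (hM i j) (hN i j), ?_⟩
  ext i j
  exact RatFunc.eval_add _ _ (hM i j) (hN i j)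

lemma IsRegularAt.sub {M N : TransferMatrix p q}
    (hM : IsRegularAt a M) (hN : IsRegularAt a N) : IsRegularAt a (M - N) ∧
      (M - N).map (ratEval a) = M.map (ratEval a) - N.map (ratEval a) := by
  refine ⟨fun i j => (regularAt a).sub_mem (hM i j) (hN i j), ?_⟩
  ext i j
  exact map_sub (evalHom a) ⟨M i j, hM i j⟩ ⟨N i j, hN i j⟩

/-- A function regular and nonzero at a is a unit of the subring. The determinant is one, so the
inverse exists over the subring and maps both to M⁻¹ and to the inverse of the value. -/
lemma IsRegularAt.inv [Fintype p] [DecidableEq p] {M : TransferMatrix p p} (hM : IsRegularAt a M)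
    (hdet : (M.map (ratEval a)).det ≠ 0) : IsRegularAt a M⁻¹ ∧
      M⁻¹.map (ratEval a) = (M.map (ratEval a))⁻¹ := by
  obtain ⟨N, h1, h2⟩ := hM.exists_lift
  have hd1 : M.det = (N.det : RatFunc ℝ) := by
    rw [h1]
    exact ((regularAt a).subtype.map_det N).symm
  have hd2 : (M.map (ratEval a)).det = evalHom a N.det := by
    rw [h2]
    exact ((evalHom a).map_det N).symm
  rw [hd2] at hdet
  have hunit : IsUnit N.det := by
    have hne : (N.det : RatFunc ℝ) ≠ 0 := fun h => hdet (by
      rw [show N.det = 0 from Subtype.ext h, map_zero])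
    refine IsUnit.of_mul_eq_one ⟨(N.det : RatFunc ℝ)⁻¹, inv_mem_regularAt N.det.2 hdet⟩ ?_
    exact Subtype.ext (mul_inv_cancel₀ hne)
  have hN := Matrix.mul_nonsing_inv N hunit
  have hMi : M⁻¹ = N⁻¹.map (regularAt a).subtype := by
    refine Matrix.inv_eq_right_inv ?_
    rw [h1, ← Matrix.map_mul, hN]
    simp
  refine ⟨hMi ▸ isRegularAt_map _, ?_⟩
  symm
  refine Matrix.inv_eq_right_inv ?_
  rw [h2, hMi]
  change N.map (evalHom a) * N⁻¹.map (evalHom a) = 1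
  rw [← Matrix.map_mul, hN]
  simp

lemma isRegularAt_C (M : Matrix p q ℝ) : IsRegularAt a (M.map (RatFunc.C (K := ℝ))) ∧
    (M.map (RatFunc.C (K := ℝ))).map (ratEval a) = M.map (algebraMap ℝ ℂ) := by
  refine ⟨fun i j => C_mem_regularAt a _, ?_⟩
  ext i j
  exact RatFunc.eval_C _ _

lemma isRegularAt_smul_one [DecidableEq p] {f : RatFunc ℝ} (hf : f ∈ regularAt a) :
    IsRegularAt a (f • (1 : TransferMatrix p p)) ∧
      (f • (1 : TransferMatrix p p)).map (ratEval a) = ratEval a f • 1 := by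
  constructor
  · intro i j
    rw [Matrix.smul_apply, Matrix.one_apply]
    split_ifs
    · simpa using hf
    · simp
  · ext i j
    rw [Matrix.map_apply, Matrix.smul_apply, Matrix.smul_apply, Matrix.one_apply, Matrix.one_apply]
    split_ifs <;> simp [ratEval]

lemma IsRLInf.isRegularAt {M : TransferMatrix p q} (h : IsRLInf M) (ω : ℝ) :
    IsRegularAt ((ω : ℂ) * Complex.I) M := fun i j => (h i j).2 ω

/-! ### Para-Hermitian conjugation on the imaginary axis. -/

lemma negVar_apply (f : RatFunc ℝ) : negVar f =
    algebraMap _ (RatFunc ℝ) (f.num.comp (-Polynomial.X)) /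
      algebraMap _ (RatFunc ℝ) (f.denom.comp (-Polynomial.X)) := by
  rw [negVar, RatFunc.coe_mapRingHom_eq_coe_map, RatFunc.map_apply]
  rfl

lemma eval₂_conj (p : Polynomial ℝ) (a : ℂ) :
    p.eval₂ (algebraMap ℝ ℂ) (starRingEnd ℂ a) = starRingEnd ℂ (p.eval₂ (algebraMap ℝ ℂ) a) := by
  rw [Polynomial.hom_eval₂]
  congr 1
  ext x
  simp

lemma ratEval_conj (f : RatFunc ℝ) (a : ℂ) :
    ratEval (starRingEnd ℂ a) f = starRingEnd ℂ (ratEval a f) := by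
  simp [ratEval, RatFunc.eval, eval₂_conj]

lemma conj_ofReal_mul_I (ω : ℝ) : starRingEnd ℂ ((ω : ℂ) * Complex.I) = -((ω : ℂ) * Complex.I) := by
  simp

/-- On the imaginary axis -s is the conjugate of s, and real coefficients turn conjugation of the
argument into conjugation of the value. -/
lemma negVar_regular {f : RatFunc ℝ} {ω : ℝ} (hf : f ∈ regularAt ((ω : ℂ) * Complex.I)) :
    negVar f ∈ regularAt ((ω : ℂ) * Complex.I) ∧
      ratEval ((ω : ℂ) * Complex.I) (negVar f) = starRingEnd ℂ (ratEval ((ω : ℂ) * Complex.I) f) := by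
  have h1 : ∀ p : Polynomial ℝ, (p.comp (-Polynomial.X)).eval₂ (algebraMap ℝ ℂ)
      ((ω : ℂ) * Complex.I) = starRingEnd ℂ (p.eval₂ (algebraMap ℝ ℂ) ((ω : ℂ) * Complex.I)) :=
    fun p => by
      rw [Polynomial.eval₂_comp, ← eval₂_conj, conj_ofReal_mul_I]
      simp
  have h2 := ratEval_div (a := (ω : ℂ) * Complex.I) (f.num.comp (-Polynomial.X))
    (f.denom.comp (-Polynomial.X)) (by rw [h1]; exact (map_ne_zero _).2 hf)
  rw [negVar_apply]
  refine ⟨h2.1, h2.2.trans ?_⟩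
  rw [h1, h1, ratEval, RatFunc.eval, map_div₀]

lemma IsRegularAt.paraConj {M : TransferMatrix p q} {ω : ℝ}
    (hM : IsRegularAt ((ω : ℂ) * Complex.I) M) :
    IsRegularAt ((ω : ℂ) * Complex.I) (paraConj M) ∧ freq (paraConj M) ω = (freq M ω)ᴴ := by
  refine ⟨fun i j => (negVar_regular (hM j i)).1, ?_⟩
  ext i j
  exact (negVar_regular (hM j i)).2

end Matrix

/-! ### Properness -/

/-- Dividing by the top power leaves the reversed polynomial at 1/(jω), whose limit is its constant
coefficient, the leading coefficient of p. -/
lemma tendsto_norm_eval₂_div_pow (p : Polynomial ℝ) :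
    Tendsto (fun ω : ℝ => ‖p.eval₂ (algebraMap ℝ ℂ) ((ω : ℂ) * Complex.I)‖ / ω ^ p.natDegree)
      atTop (𝓝 |p.leadingCoeff|) := by
  have h1 : Tendsto (fun ω : ℝ => ((ω : ℂ) * Complex.I)⁻¹) atTop (𝓝 0) := by
    rw [tendsto_zero_iff_norm_tendsto_zero]
    have : Tendsto (fun ω : ℝ => |ω|⁻¹) atTop (𝓝 0) := tendsto_inv_atTop_zero.comp tendsto_abs_atTop_atTop
    simpa using this
  have h2 : Tendsto (fun ω : ℝ => ‖p.reverse.eval₂ (algebraMap ℝ ℂ) ((ω : ℂ) * Complex.I)⁻¹‖)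
      atTop (𝓝 ‖p.reverse.eval₂ (algebraMap ℝ ℂ) 0‖) := by
    simp only [Polynomial.eval₂_eq_eval_map]
    exact ((Polynomial.continuous _).tendsto 0 |>.comp h1).norm
  rw [Polynomial.eval₂_at_zero, Polynomial.coeff_zero_reverse] at h2
  rw [show |p.leadingCoeff| = ‖algebraMap ℝ ℂ p.leadingCoeff‖ by simp]
  refine h2.congr' ?_
  filter_upwards [eventually_gt_atTop 0] with ω hω
  have hne : (ω : ℂ) * Complex.I ≠ 0 := by simp [hω.ne']
  let _ := invertibleOfNonzero hne
  rw [← Polynomial.eval₂_reverse_mul_pow (algebraMap ℝ ℂ) ((ω : ℂ) * Complex.I) p, norm_mul, norm_pow,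
    invOf_eq_inv]
  have : ‖(ω : ℂ) * Complex.I‖ = ω := by simp [abs_of_pos hω]
  rw [this]
  field_simp

/-- If the numerator had larger degree, boundedness would force its leading coefficient to vanish.
Properness of W̃ is thus read off from a norm bound, with no degree count through the matrix
inverse. -/
lemma intDegree_nonpos_of_bounded {f : RatFunc ℝ} {B : ℝ}
    (hreg : ∀ ω : ℝ, f ∈ regularAt ((ω : ℂ) * Complex.I))
    (hB : ∀ ω : ℝ, ‖ratEval ((ω : ℂ) * Complex.I) f‖ ≤ B) : f.intDegree ≤ 0 := by
  by_contra hpos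
  rw [not_le, RatFunc.intDegree, sub_pos, Nat.cast_lt] at hpos
  have hnum : f.num ≠ 0 := by
    intro h
    simp [h] at hpos
  have hle : ∀ᶠ ω : ℝ in atTop,
      ‖f.num.eval₂ (algebraMap ℝ ℂ) ((ω : ℂ) * Complex.I)‖ / ω ^ f.num.natDegree ≤
      B * ((‖f.denom.eval₂ (algebraMap ℝ ℂ) ((ω : ℂ) * Complex.I)‖ / ω ^ f.denom.natDegree) *
        (ω ^ (f.num.natDegree - f.denom.natDegree))⁻¹) := by
    filter_upwards [eventually_gt_atTop 0] with ω hω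
    have h1 := hB ω
    have h2 : 0 < ‖f.denom.eval₂ (algebraMap ℝ ℂ) ((ω : ℂ) * Complex.I)‖ := norm_pos_iff.2 (hreg ω)
    rw [ratEval, RatFunc.eval, norm_div, div_le_iff₀ h2] at h1
    have h3 : ω ^ f.num.natDegree = ω ^ f.denom.natDegree *
        ω ^ (f.num.natDegree - f.denom.natDegree) := by
      rw [← pow_add, Nat.add_sub_cancel' hpos.le]
    rw [div_mul_eq_mul_div, ← mul_div_assoc, div_le_div_iff₀ (by positivity) (by positivity), h3]
    have : B * (‖f.denom.eval₂ (algebraMap ℝ ℂ) ((ω : ℂ) * Complex.I)‖ *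
        (ω ^ (f.num.natDegree - f.denom.natDegree))⁻¹) * (ω ^ f.denom.natDegree *
        ω ^ (f.num.natDegree - f.denom.natDegree)) =
        B * ‖f.denom.eval₂ (algebraMap ℝ ℂ) ((ω : ℂ) * Complex.I)‖ * ω ^ f.denom.natDegree := by
      field_simp
    rw [this]
    gcongr
  have hlim := ((tendsto_norm_eval₂_div_pow f.denom).mul
    (tendsto_inv_atTop_zero.comp (tendsto_pow_atTop (α := ℝ)
      (Nat.sub_pos_of_lt hpos).ne'))).const_mul B
  have h0 := le_of_tendsto_of_tendsto (tendsto_norm_eval₂_div_pow f.num) hlim hle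
  rw [mul_zero, mul_zero] at h0
  exact hnum (Polynomial.leadingCoeff_eq_zero.1 (abs_nonpos_iff.1 h0))

/-! ### Impulse responses of rational functions -/

/-- Frequency responses of complex impulse responses `c δ + h` with `h` integrable. -/
def IsWiener (F : ℝ → ℂ) : Prop :=
  ∃ (c : ℂ) (h : ℝ → ℂ), Integrable h ∧
    ∀ ω : ℝ, F ω = c + ∫ t : ℝ, h t * Complex.exp (-((ω : ℂ) * (t : ℂ) * Complex.I))

lemma integral_mul_exp_eq_fourier (h : ℝ → ℂ) (ω : ℝ) :
    ∫ t : ℝ, h t * Complex.exp (-((ω : ℂ) * (t : ℂ) * Complex.I)) =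
      FourierTransform.fourier h (ω / (2 * Real.pi)) := by
  rw [Real.fourier_real_eq_integral_exp_smul]
  congr 1 with t
  rw [smul_eq_mul, mul_comm]
  congr 2
  have : (Real.pi : ℂ) ≠ 0 := by exact_mod_cast Real.pi_ne_zero
  push_cast
  field_simp

lemma integrable_mul_exp_neg {h : ℝ → ℂ} (hh : Integrable h) (ω : ℝ) :
    Integrable (fun t : ℝ => h t * Complex.exp (-((ω : ℂ) * (t : ℂ) * Complex.I))) :=
  hh.mul_bdd (c := 1) (Continuous.aestronglyMeasurable (by fun_prop))
    (Eventually.of_forall fun t => (norm_exp_neg_mul_I ω t).le)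

namespace IsWiener

variable {F G : ℝ → ℂ}

lemma const (c : ℂ) : IsWiener (fun _ => c) := ⟨c, 0, integrable_zero _ _ _, by simp⟩

lemma add (hF : IsWiener F) (hG : IsWiener G) : IsWiener (fun ω => F ω + G ω) := by
  obtain ⟨c, h, hi, hF⟩ := hF
  obtain ⟨d, k, ki, hG⟩ := hG
  refine ⟨c + d, h + k, hi.add ki, fun ω => ?_⟩
  simp only [Pi.add_apply, add_mul]
  rw [integral_add (integrable_mul_exp_neg hi ω) (integrable_mul_exp_neg ki ω), hF, hG]
  ring

lemma mul (hF : IsWiener F) (hG : IsWiener G) : IsWiener (fun ω => F ω * G ω) := by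
  obtain ⟨c, h, hi, hF⟩ := hF
  obtain ⟨d, k, ki, hG⟩ := hG
  have hc := hi.integrable_convolution (ContinuousLinearMap.mul ℂ ℂ) ki
  refine ⟨c * d, fun t => c * k t + (d * h t +
    convolution h k (ContinuousLinearMap.mul ℂ ℂ) volume t),
    (ki.const_mul c).add ((hi.const_mul d).add hc), fun ω => ?_⟩
  have h2 : Integrable (fun t : ℝ => d * h t * Complex.exp (-((ω : ℂ) * (t : ℂ) * Complex.I)) +
      convolution h k (ContinuousLinearMap.mul ℂ ℂ) volume t *
        Complex.exp (-((ω : ℂ) * (t : ℂ) * Complex.I))) :=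
    (integrable_mul_exp_neg (hi.const_mul d) ω).add (integrable_mul_exp_neg hc ω)
  simp only [add_mul]
  rw [integral_add (integrable_mul_exp_neg (ki.const_mul c) ω) h2,
    integral_add (integrable_mul_exp_neg (hi.const_mul d) ω) (integrable_mul_exp_neg hc ω),
    integral_mul_exp_eq_fourier (convolution _ _ _ _), Real.fourier_mul_convolution_eq hi ki,
    ← integral_mul_exp_eq_fourier, ← integral_mul_exp_eq_fourier, hF, hG]
  simp only [mul_assoc, integral_const_mul]
  ring

/-- A pole in the left half plane gives the causal kernel e^{pt} on t > 0, one in the right half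
plane the anticausal kernel -e^{pt} on t ≤ 0; both are integrable. -/
lemma inv_sub {p : ℂ} (hp : p.re ≠ 0) : IsWiener (fun ω => ((ω : ℂ) * Complex.I - p)⁻¹) := by
  have he : ∀ ω t : ℝ, Complex.exp (p * t) * Complex.exp (-((ω : ℂ) * (t : ℂ) * Complex.I)) =
      Complex.exp ((p - (ω : ℂ) * Complex.I) * t) := fun ω t => by
    rw [← Complex.exp_add]
    ring_nf
  have hre : ∀ ω : ℝ, (p - (ω : ℂ) * Complex.I).re = p.re := fun ω => by simp
  have hinv : ∀ ω : ℝ, ((ω : ℂ) * Complex.I - p)⁻¹ = -(1 / (p - (ω : ℂ) * Complex.I)) := fun ω => by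
    rw [one_div, ← inv_neg, neg_sub]
  rcases lt_or_gt_of_ne hp with h | h
  · refine ⟨0, (Set.Ioi 0).indicator fun t : ℝ => Complex.exp (p * t), ?_, fun ω => ?_⟩
    · rw [integrable_indicator_iff measurableSet_Ioi]
      exact integrableOn_exp_mul_complex_Ioi h 0
    · have := integral_exp_mul_complex_Ioi (a := p - (ω : ℂ) * Complex.I) (by rwa [hre]) 0
      rw [← integral_indicator measurableSet_Ioi] at this
      rw [zero_add]
      refine (hinv ω).trans ?_
      trans ∫ t : ℝ, (Set.Ioi (0 : ℝ)).indicator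
        (fun t : ℝ => Complex.exp ((p - (ω : ℂ) * Complex.I) * t)) t
      · rw [this]
        simp [neg_div]
      · congr 1 with t
        simp only [Set.indicator_apply]
        split_ifs
        · rw [he]
        · simp
  · refine ⟨0, (Set.Iic 0).indicator fun t : ℝ => -Complex.exp (p * t), ?_, fun ω => ?_⟩
    · rw [integrable_indicator_iff measurableSet_Iic]
      exact (integrableOn_exp_mul_complex_Iic h 0).neg
    · have := integral_exp_mul_complex_Iic (a := p - (ω : ℂ) * Complex.I) (by rwa [hre]) 0
      rw [← integral_indicator measurableSet_Iic] at this
      rw [zero_add]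
      refine (hinv ω).trans ?_
      trans -∫ t : ℝ, (Set.Iic (0 : ℝ)).indicator
        (fun t : ℝ => Complex.exp ((p - (ω : ℂ) * Complex.I) * t)) t
      · rw [this]
        simp
      · rw [← integral_neg]
        congr 1 with t
        simp only [Set.indicator_apply]
        split_ifs
        · rw [neg_mul, he]
        · simp

/-- One pole is removed at a time by dividing N by X - p: the quotient drops one degree, the
remainder is the constant N(p). Closure under products handles repeated poles, so no partial
fractions are needed. -/
lemma polynomial_div_prod (ps : Multiset ℂ) (hps : ∀ p ∈ ps, p.re ≠ 0) (N : Polynomial ℂ)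
    (hN : N.natDegree ≤ Multiset.card ps) :
    IsWiener (fun ω => N.eval ((ω : ℂ) * Complex.I) *
      (ps.map fun p => ((ω : ℂ) * Complex.I - p)⁻¹).prod) := by
  induction ps using Multiset.induction_on generalizing N with
  | empty =>
    rw [Multiset.card_zero, Nat.le_zero] at hN
    rw [Polynomial.eq_C_of_natDegree_eq_zero hN]
    simpa using const _
  | cons p ps ih =>
    have hp : p.re ≠ 0 := hps p (by simp)
    have ih' := ih fun q hq => hps q (by simp [hq])
    have hmon := Polynomial.monic_X_sub_C p
    have hN1 : (N /ₘ (Polynomial.X - Polynomial.C p)).natDegree ≤ Multiset.card ps := by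
      rw [Polynomial.natDegree_divByMonic _ hmon, Polynomial.natDegree_X_sub_C]
      rw [Multiset.card_cons] at hN
      omega
    have h1 := (ih' _ hN1).add (((ih' 1 (by simp)).mul (inv_sub hp)).mul (const (N.eval p)))
    convert h1 using 2 with ω
    have hne : (ω : ℂ) * Complex.I - p ≠ 0 := by
      intro h
      apply hp
      rw [← sub_eq_zero.1 h]
      simp
    have hdecomp := congrArg (Polynomial.eval ((ω : ℂ) * Complex.I))
      (Polynomial.modByMonic_add_div N (Polynomial.X - Polynomial.C p))
    rw [Polynomial.modByMonic_X_sub_C_eq_C_eval] at hdecomp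
    simp only [Polynomial.eval_add, Polynomial.eval_mul, Polynomial.eval_sub, Polynomial.eval_X,
      Polynomial.eval_C] at hdecomp
    rw [Multiset.map_cons, Multiset.prod_cons, ← hdecomp]
    simp only [Polynomial.eval_one]
    field_simp
    ring

end IsWiener

lemma exists_impulse_response {f : RatFunc ℝ} (hprop : f.intDegree ≤ 0)
    (hreg : ∀ ω : ℝ, f ∈ regularAt ((ω : ℂ) * Complex.I)) :
    ∃ (D : ℝ) (h : ℝ → ℝ), Integrable h ∧
      ∀ ω : ℝ, ratEval ((ω : ℂ) * Complex.I) f = (D : ℂ) + freqInt h ω := by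
  set q := f.denom.map (algebraMap ℝ ℂ) with hq
  have hqmon : q.Monic := (RatFunc.monic_denom f).map _
  have hqprod : q = (q.roots.map fun x => Polynomial.X - Polynomial.C x).prod := by
    have := (IsAlgClosed.splits q).eq_prod_roots
    rwa [hqmon.leadingCoeff, Polynomial.C_1, one_mul] at this
  have hroots : ∀ p ∈ q.roots, p.re ≠ 0 := by
    intro p hp h0
    have hpe : p = (p.im : ℂ) * Complex.I := by
      apply Complex.ext <;> simp [h0]
    have hr := (Polynomial.mem_roots hqmon.ne_zero).1 hp
    rw [Polynomial.IsRoot.def, hq, Polynomial.eval_map] at hr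
    exact hreg p.im (hpe ▸ hr)
  have hcard : Multiset.card q.roots = f.denom.natDegree := by
    rw [← (IsAlgClosed.splits q).natDegree_eq_card_roots, hq, Polynomial.natDegree_map]
  have hdeg : (f.num.map (algebraMap ℝ ℂ)).natDegree ≤ Multiset.card q.roots := by
    rw [hcard, Polynomial.natDegree_map]
    rw [RatFunc.intDegree] at hprop
    omega
  have hw := IsWiener.polynomial_div_prod q.roots hroots _ hdeg
  have hval : ∀ ω : ℝ, (f.num.map (algebraMap ℝ ℂ)).eval ((ω : ℂ) * Complex.I) *
      (q.roots.map fun p => ((ω : ℂ) * Complex.I - p)⁻¹).prod =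
      ratEval ((ω : ℂ) * Complex.I) f := fun ω => by
    rw [ratEval, RatFunc.eval, div_eq_mul_inv, Polynomial.eval_map,
      ← Polynomial.eval_map (algebraMap ℝ ℂ) (p := f.denom), ← hq]
    congr 1
    conv_rhs => rw [hqprod]
    rw [Polynomial.eval_multiset_prod, Multiset.map_map, Multiset.prod_map_inv]
    congr 3
    ext p
    simp
  obtain ⟨c, h, hi, hF⟩ := hw
  refine ⟨c.re, fun t => (h t).re, hi.re, fun ω => ?_⟩
  have h1 := (hval ω).symm.trans (hF ω)
  have h2 := (hval (-ω)).symm.trans (hF (-ω))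
  -- The kernel found over ℂ may be complex. Since f is real, averaging the formula at ω with the
  -- conjugated formula at -ω replaces c and h by their real parts.
  have h3 : ratEval (((-ω : ℝ) : ℂ) * Complex.I) f = starRingEnd ℂ (ratEval ((ω : ℂ) * Complex.I) f) := by
    rw [← ratEval_conj, conj_ofReal_mul_I]
    push_cast
    rw [neg_mul]
  have h4 : ratEval ((ω : ℂ) * Complex.I) f = starRingEnd ℂ c +
      ∫ t : ℝ, starRingEnd ℂ (h t) * Complex.exp (-((ω : ℂ) * (t : ℂ) * Complex.I)) := by
    have := congrArg (starRingEnd ℂ) h2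
    rw [h3, Complex.conj_conj, map_add, ← integral_conj] at this
    rw [this]
    congr 2 with t
    rw [map_mul, ← Complex.exp_conj]
    simp
  have h5 : freqInt (fun t => (h t).re) ω =
      (∫ t : ℝ, h t * Complex.exp (-((ω : ℂ) * (t : ℂ) * Complex.I)) +
        starRingEnd ℂ (h t) * Complex.exp (-((ω : ℂ) * (t : ℂ) * Complex.I))) / 2 := by
    rw [freqInt, ← integral_div]
    congr 1 with t
    rw [Complex.re_eq_add_conj]
    ring
  have hic : Integrable (fun t => starRingEnd ℂ (h t)) :=
    (LinearIsometryEquiv.integrable_comp_iff Complex.conjLIE).2 hi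
  rw [integral_add (integrable_mul_exp_neg hi ω) (integrable_mul_exp_neg hic ω)] at h5
  rw [h5, Complex.re_eq_add_conj]
  linear_combination (h1 + h4) / 2

/-! ### Impulse responses of transfer matrices in RL∞. -/

section

variable {p m : Type*}

lemma IsRLInf.exists_impulseResponse {M : TransferMatrix p m} (hM : IsRLInf M) :
    ∃ D h, IsImpulseResponse M D h := by
  choose D h hi hf using fun i j => exists_impulse_response (hM i j).1 (hM i j).2
  exact ⟨Matrix.of D, fun t => Matrix.of fun i j => h i j t, fun i j => hi i j,
    fun ω i j => hf i j ω⟩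

lemma IsImpulseResponse.exists_bound {M : TransferMatrix p m} {D h}
    (hM : IsImpulseResponse M D h) (i : p) (j : m) : ∃ B, ∀ ω, ‖freq M ω i j‖ ≤ B := by
  refine ⟨‖(D i j : ℂ)‖ + ∫ t, |h t i j|, fun ω => ?_⟩
  rw [hM.freq_eq]
  exact (norm_add_le _ _).trans (add_le_add le_rfl (norm_freqInt_le (hM.1 i j) ω))

lemma IsImpulseResponse.isRLInf {M : TransferMatrix p m} {D h} (hM : IsImpulseResponse M D h)
    (hreg : ∀ ω : ℝ, IsRegularAt ((ω : ℂ) * Complex.I) M) : IsRLInf M := fun i j => by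
  obtain ⟨B, hB⟩ := hM.exists_bound i j
  exact ⟨intDegree_nonpos_of_bounded (fun ω => hreg ω i j) hB, fun ω => hreg ω i j⟩

lemma freqInt_comp_neg (h : ℝ → ℝ) (ω : ℝ) :
    freqInt (fun t => h (-t)) ω = starRingEnd ℂ (freqInt h ω) := by
  rw [freqInt, freqInt, ← integral_conj, ← integral_neg_eq_self]
  congr 1 with t
  rw [map_mul, ← Complex.exp_conj]
  simp

lemma IsImpulseResponse.paraConj {M : TransferMatrix p m} {D h} (hM : IsImpulseResponse M D h)
    (hreg : ∀ ω : ℝ, IsRegularAt ((ω : ℂ) * Complex.I) M) :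
    IsImpulseResponse (paraConj M) Dᵀ (fun t => (h (-t))ᵀ) := by
  refine ⟨fun j i => (hM.1 i j).comp_neg, fun ω j i => ?_⟩
  rw [(hreg ω).paraConj.2, conjTranspose_apply, hM.freq_eq]
  change _ = _ + freqInt (fun t => h (-t) i j) ω
  rw [freqInt_comp_neg (fun t => h t i j)]
  simp

end

/-! ### Exponentially decaying functions -/

/-- Functions with an exponentially decaying bound on the half line. -/
def ExpDecay (f : ℝ → ℂ) : Prop := ∃ C a : ℝ, 0 < a ∧ ∀ t, 0 ≤ t → ‖f t‖ ≤ C * Real.exp (-a * t)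

namespace ExpDecay

variable {f g : ℝ → ℂ}

lemma zero : ExpDecay (fun _ => 0) := ⟨0, 1, one_pos, by simp⟩

lemma add (hf : ExpDecay f) (hg : ExpDecay g) : ExpDecay (fun t => f t + g t) := by
  obtain ⟨C, a, ha, hC⟩ := hf
  obtain ⟨D, b, hb, hD⟩ := hg
  refine ⟨|C| + |D|, min a b, lt_min ha hb, fun t ht => (norm_add_le _ _).trans ?_⟩
  rw [add_mul]
  refine add_le_add ((hC t ht).trans ?_) ((hD t ht).trans ?_)
  · refine mul_le_mul (le_abs_self _) (Real.exp_le_exp.2 ?_) (Real.exp_nonneg _) (abs_nonneg _)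
    have := mul_le_mul_of_nonneg_right (min_le_left a b) ht
    linarith
  · refine mul_le_mul (le_abs_self _) (Real.exp_le_exp.2 ?_) (Real.exp_nonneg _) (abs_nonneg _)
    have := mul_le_mul_of_nonneg_right (min_le_right a b) ht
    linarith

lemma mul_const (hf : ExpDecay f) (c : ℂ) : ExpDecay (fun t => f t * c) := by
  obtain ⟨C, a, ha, hC⟩ := hf
  refine ⟨C * ‖c‖, a, ha, fun t ht => ?_⟩
  rw [norm_mul, mul_right_comm]
  exact mul_le_mul_of_nonneg_right (hC t ht) (norm_nonneg _)

lemma sum {α : Type*} (s : Finset α) {f : α → ℝ → ℂ} (hf : ∀ a ∈ s, ExpDecay (f a)) :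
    ExpDecay (fun t => ∑ a ∈ s, f a t) := by
  classical
  induction s using Finset.induction_on with
  | empty => simpa using zero
  | insert a s ha ih =>
    simp only [Finset.sum_insert ha]
    exact (hf a (by simp)).add (ih fun b hb => hf b (by simp [hb]))

lemma pow_mul_exp (n : ℕ) {μ : ℂ} (hμ : μ.re < 0) :
    ExpDecay (fun t : ℝ => (t : ℂ) ^ n * Complex.exp (t * μ)) := by
  -- Half of the decay rate absorbs the power through (bt)ⁿ/n! ≤ e^{bt}; the other half remains as
  -- the exponential bound.
  set b := -μ.re / 2 with hb
  have hb0 : 0 < b := by rw [hb]; linarith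
  refine ⟨n.factorial / b ^ n, b, hb0, fun t ht => ?_⟩
  have h1 := Real.pow_div_factorial_le_exp (b * t) (by positivity) n
  rw [norm_mul, norm_pow, Complex.norm_real, Real.norm_of_nonneg ht, Complex.norm_exp]
  have h2 : ((t : ℂ) * μ).re = -b * t + -(b * t) := by
    simp [hb]
    ring
  rw [h2, Real.exp_add, Real.exp_neg (b * t)]
  have h3 : t ^ n * (Real.exp (b * t))⁻¹ ≤ n.factorial / b ^ n := by
    rw [← div_eq_mul_inv, div_le_div_iff₀ (Real.exp_pos _) (by positivity)]
    rw [div_le_iff₀ (by positivity), mul_pow] at h1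
    linarith
  calc t ^ n * (Real.exp (-b * t) * (Real.exp (b * t))⁻¹)
      = t ^ n * (Real.exp (b * t))⁻¹ * Real.exp (-b * t) := by ring
    _ ≤ _ := mul_le_mul_of_nonneg_right h3 (Real.exp_nonneg _)

lemma tendsto (hf : ExpDecay f) : Tendsto f atTop (𝓝 0) := by
  obtain ⟨C, a, ha, hC⟩ := hf
  apply squeeze_zero_norm' (a := fun t => C * Real.exp (-a * t))
  · filter_upwards [eventually_ge_atTop 0] with t ht using hC t ht
  · have : Tendsto (fun t : ℝ => Real.exp (-a * t)) atTop (𝓝 0) :=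
      Real.tendsto_exp_atBot.comp (tendsto_id.const_mul_atTop_of_neg (neg_lt_zero.2 ha))
    simpa using this.const_mul C

lemma integrableOn (hf : ExpDecay f) (hm : Continuous f) : IntegrableOn f (Set.Ioi 0) := by
  obtain ⟨C, a, ha, hC⟩ := hf
  refine Integrable.mono' ((integrableOn_exp_mul_Ioi (neg_lt_zero.2 ha) 0).const_mul C)
    hm.aestronglyMeasurable ?_
  filter_upwards [ae_restrict_mem measurableSet_Ioi] with t ht using hC t (le_of_lt ht)

end ExpDecay

/-! ### Exponentials of stable matrices -/

section

variable {ι : Type*} [Fintype ι] [DecidableEq ι]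

open scoped Matrix.Norms.Operator in
lemma hasDerivAt_exp_entry (A : Matrix ι ι ℝ) (t : ℝ) (i j : ι) :
    HasDerivAt (fun u : ℝ => NormedSpace.exp (u • A) i j) ((A * NormedSpace.exp (t • A)) i j) t :=
  (Matrix.entryLinearMap ℝ ℝ i j).toContinuousLinearMap.hasFDerivAt.comp_hasDerivAt t
    (hasDerivAt_exp_smul_const' A t)

open scoped Matrix.Norms.Operator in
lemma exp_smul_mul_comm (A : Matrix ι ι ℝ) (t : ℝ) :
    NormedSpace.exp (t • A) * A = A * NormedSpace.exp (t • A) :=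
  (((Commute.refl A).smul_left t).exp_left).eq

lemma continuous_exp_entry (A : Matrix ι ι ℝ) (i j : ι) :
    Continuous (fun u : ℝ => NormedSpace.exp (u • A) i j) :=
  continuous_iff_continuousAt.2 fun t => (hasDerivAt_exp_entry A t i j).continuousAt

open scoped Matrix.Norms.Operator in
lemma map_exp_ofReal (A : Matrix ι ι ℝ) (t : ℝ) :
    (NormedSpace.exp (t • A)).map (algebraMap ℝ ℂ) =
      NormedSpace.exp ((t : ℂ) • A.map (algebraMap ℝ ℂ)) := by
  have h := NormedSpace.map_exp ((algebraMap ℝ ℂ).mapMatrix (m := ι))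
    (Continuous.matrix_map continuous_id Complex.continuous_ofReal) (t • A)
  rw [RingHom.mapMatrix_apply, RingHom.mapMatrix_apply] at h
  refine h.trans (congrArg _ ?_)
  ext i j
  simp

open scoped Matrix.Norms.Operator in
-- Split e^{tA} = e^{tμ} e^{t(A-μ)}; on a generalized eigenvector the second exponential series
-- stops before the k-th term.
lemma exp_mulVec_of_pow_mulVec_eq_zero (A : Matrix ι ι ℂ) (μ : ℂ) {k : ℕ} {v : ι → ℂ}
    (hv : ((A - μ • 1) ^ k) *ᵥ v = 0) (t : ℝ) :
    NormedSpace.exp ((t : ℂ) • A) *ᵥ v = Complex.exp (t * μ) •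
      ∑ n ∈ Finset.range k, ((n.factorial : ℂ)⁻¹ * (t : ℂ) ^ n) • (((A - μ • 1) ^ n) *ᵥ v) := by
  set N := A - μ • (1 : Matrix ι ι ℂ) with hN
  have h1 : NormedSpace.exp ((t : ℂ) • A) = Complex.exp (t * μ) • NormedSpace.exp ((t : ℂ) • N) := by
    have hA : (t : ℂ) • A = algebraMap ℂ (Matrix ι ι ℂ) (t * μ) + (t : ℂ) • N := by
      rw [hN, Algebra.algebraMap_eq_smul_one, smul_sub, smul_smul]
      abel
    rw [hA, Matrix.exp_add_of_commute _ _ (Algebra.commute_algebraMap_left _ _)]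
    refine (congrArg₂ (· * ·) (NormedSpace.algebraMap_exp_comm _).symm rfl).trans ?_
    rw [← Complex.exp_eq_exp_ℂ, Algebra.algebraMap_eq_smul_one, smul_mul_assoc, one_mul]
  have h2 := NormedSpace.exp_series_hasSum_exp' (𝕂 := ℂ) ((t : ℂ) • N)
  have hcont : Continuous (fun M : Matrix ι ι ℂ => M *ᵥ v) :=
    Continuous.matrix_mulVec continuous_id continuous_const
  have h3 := h2.map (⟨⟨fun M : Matrix ι ι ℂ => M *ᵥ v, Matrix.zero_mulVec v⟩,
    fun M M' => Matrix.add_mulVec M M' v⟩ : Matrix ι ι ℂ →+ (ι → ℂ)) hcont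
  have hz : ∀ n, n ∉ Finset.range k → (N ^ n) *ᵥ v = 0 := fun n hn => by
    rw [Finset.mem_range, not_lt] at hn
    rw [← Nat.sub_add_cancel hn, pow_add, ← Matrix.mulVec_mulVec, hv, Matrix.mulVec_zero]
  have h4 : NormedSpace.exp ((t : ℂ) • N) *ᵥ v =
      ∑ n ∈ Finset.range k, ((n.factorial : ℂ)⁻¹ * (t : ℂ) ^ n) • ((N ^ n) *ᵥ v) := by
    have e : ∀ n : ℕ, ((n.factorial : ℂ)⁻¹ • ((t : ℂ) • N) ^ n) *ᵥ v =
        ((n.factorial : ℂ)⁻¹ * (t : ℂ) ^ n) • ((N ^ n) *ᵥ v) := fun n => by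
      rw [smul_pow, smul_smul, Matrix.smul_mulVec]
    have h5 : HasSum (fun n : ℕ => ((n.factorial : ℂ)⁻¹ • ((t : ℂ) • N) ^ n) *ᵥ v)
        (NormedSpace.exp ((t : ℂ) • N) *ᵥ v) := h3
    simp only [e] at h5
    refine h5.unique (hasSum_sum_of_ne_finset_zero fun n hn => ?_)
    rw [hz n hn, smul_zero]
  rw [h1, Matrix.smul_mulVec, h4]

/-- Generalized eigenvectors span the complex space, and on each of them the exponential is a
polynomial times e^{tμ}. This avoids the Jordan form. -/
lemma expDecay_exp_mulVec {A : Matrix ι ι ℂ} (hA : ∀ c ∈ spectrum ℂ A, c.re < 0) (v : ι → ℂ)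
    (i : ι) : ExpDecay (fun t : ℝ => (NormedSpace.exp ((t : ℂ) • A) *ᵥ v) i) := by
  have hv : v ∈ ⨆ μ, Module.End.maxGenEigenspace (Matrix.toLin' A) μ := by
    rw [Module.End.iSup_maxGenEigenspace_eq_top]
    trivial
  refine Submodule.iSup_induction _
    (motive := fun v => ExpDecay (fun t : ℝ => (NormedSpace.exp ((t : ℂ) • A) *ᵥ v) i)) hv
    (fun μ x hx => ?_) ?_ fun x y hx hy => ?_
  · rw [Module.End.mem_maxGenEigenspace] at hx
    obtain ⟨k, hk⟩ := hx
    have hlin : Matrix.toLin' A - μ • 1 = Matrix.toLin' (A - μ • (1 : Matrix ι ι ℂ)) := by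
      rw [map_sub, map_smul, Matrix.toLin'_one]
      rfl
    rw [hlin, ← Matrix.toLin'_pow, Matrix.toLin'_apply] at hk
    by_cases hμ : μ ∈ spectrum ℂ A
    · simp only [exp_mulVec_of_pow_mulVec_eq_zero A μ hk]
      have := ExpDecay.sum (Finset.range k) fun n _ => (ExpDecay.pow_mul_exp n (hA μ hμ)).mul_const
        ((n.factorial : ℂ)⁻¹ * (((A - μ • (1 : Matrix ι ι ℂ)) ^ n) *ᵥ x) i)
      convert this using 2 with t
      rw [Pi.smul_apply, Finset.sum_apply, smul_eq_mul, Finset.mul_sum]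
      refine Finset.sum_congr rfl fun n _ => ?_
      rw [Pi.smul_apply, smul_eq_mul]
      ring
    -- The supremum runs over all complex μ; outside the spectrum the generalized eigenspace is
    -- zero.
    · have hu : IsUnit (A - μ • (1 : Matrix ι ι ℂ)) := by
        rw [spectrum.notMem_iff, Algebra.algebraMap_eq_smul_one] at hμ
        rw [← neg_sub]
        exact hμ.neg
      have hx0 : x = 0 := by
        have := Matrix.mulVec_injective_of_isUnit (hu.pow k)
        exact this (by rw [hk, Matrix.mulVec_zero])
      simpa [hx0] using ExpDecay.zero
  · simpa using ExpDecay.zero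
  · simpa only [Matrix.mulVec_add] using! hx.add hy

lemma IsHurwitz.expDecay {A : Matrix ι ι ℝ} (hA : IsHurwitz A) (i j : ι) :
    ExpDecay (fun t : ℝ => ((NormedSpace.exp (t • A) i j : ℝ) : ℂ)) := by
  have := expDecay_exp_mulVec hA (Pi.single j 1) i
  convert this using 2 with t
  rw [← map_exp_ofReal, Matrix.mulVec_single_one]
  simp

/-- The kernel `e^{At}` on `t ≥ 0`. -/
def stateKernel (A : Matrix ι ι ℝ) (t : ℝ) : Matrix ι ι ℝ :=
  if 0 < t then NormedSpace.exp (t • A) else 0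

lemma stateKernel_apply (A : Matrix ι ι ℝ) (i j : ι) :
    (fun t => stateKernel A t i j) =
      (Set.Ioi 0).indicator fun t : ℝ => NormedSpace.exp (t • A) i j := by
  ext t
  by_cases ht : 0 < t <;> simp [stateKernel, ht]

lemma IsHurwitz.integrable_stateKernel {A : Matrix ι ι ℝ} (hA : IsHurwitz A) (i j : ι) :
    Integrable (fun t => stateKernel A t i j) := by
  rw [stateKernel_apply, integrable_indicator_iff measurableSet_Ioi]
  have := (hA.expDecay i j).integrableOn
    (Complex.continuous_ofReal.comp (continuous_exp_entry A i j))
  simpa [IntegrableOn] using Integrable.re this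

/-- Integrate the derivative of e^{tA} e^{-jωt} over t > 0: exponential decay removes the end at
infinity, and the end at 0 contributes the identity. -/
lemma IsHurwitz.freqInt_stateKernel {A : Matrix ι ι ℝ} (hA : IsHurwitz A) (ω : ℝ) :
    (((ω : ℂ) * Complex.I) • (1 : Matrix ι ι ℂ) - A.map (algebraMap ℝ ℂ)) *
      (Matrix.of fun i j => freqInt (fun t => stateKernel A t i j) ω) = 1 := by
  set Φ : ι → ι → ℝ → ℂ := fun i j t => ((NormedSpace.exp (t • A) i j : ℝ) : ℂ) *
    Complex.exp (-((ω : ℂ) * (t : ℂ) * Complex.I)) with hΦ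
  have hc : ∀ i j, Continuous (Φ i j) := fun i j =>
    (Complex.continuous_ofReal.comp (continuous_exp_entry A i j)).mul (by fun_prop)
  have hdec : ∀ i j, ExpDecay (Φ i j) := fun i j => by
    obtain ⟨C, a, ha, h⟩ := hA.expDecay i j
    refine ⟨C, a, ha, fun t ht => ?_⟩
    rw [hΦ, norm_mul, norm_exp_neg_mul_I, mul_one]
    exact h t ht
  have hint : ∀ i j, IntegrableOn (Φ i j) (Set.Ioi 0) := fun i j => (hdec i j).integrableOn (hc i j)
  have hfreq : ∀ i j, freqInt (fun t => stateKernel A t i j) ω = ∫ t in Set.Ioi 0, Φ i j t :=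
    fun i j => by
      rw [freqInt, ← integral_indicator measurableSet_Ioi]
      congr 1 with t
      rw [show stateKernel A t i j = _ from congrFun (stateKernel_apply A i j) t]
      by_cases ht : 0 < t <;> simp [hΦ, ht]
  have hder : ∀ i j t, HasDerivAt (Φ i j)
      ((∑ k, (A i k : ℂ) * Φ k j t) - ((ω : ℂ) * Complex.I) * Φ i j t) t := fun i j t => by
    have h1 := (hasDerivAt_exp_entry A t i j).ofReal_comp
    have h2 : HasDerivAt (fun t : ℝ => Complex.exp (-((ω : ℂ) * (t : ℂ) * Complex.I)))
        (Complex.exp (-((ω : ℂ) * (t : ℂ) * Complex.I)) * (-((ω : ℂ) * 1 * Complex.I))) t :=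
      ((((hasDerivAt_id t).ofReal_comp).const_mul (ω : ℂ)).mul_const Complex.I).neg.cexp
    refine (h1.mul h2).congr_deriv ?_
    simp only [hΦ, Matrix.mul_apply, Complex.ofReal_sum, Finset.sum_mul, Complex.ofReal_mul,
      ← mul_assoc]
    ring
  ext i j
  have h0 := integral_Ioi_of_hasDerivAt_of_tendsto (hc i j).continuousWithinAt
    (fun t _ => hder i j t) ((integrable_finsetSum _ fun k _ => (hint k j).const_mul _).sub
      ((hint i j).const_mul _)) (hdec i j).tendsto
  rw [integral_sub (integrable_finsetSum _ fun k _ => (hint k j).const_mul _)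
    ((hint i j).const_mul _), integral_finsetSum _ fun k _ => (hint k j).const_mul _] at h0
  simp only [integral_const_mul, ← hfreq] at h0
  have h1 : Φ i j 0 = (1 : Matrix ι ι ℂ) i j := by
    simp [hΦ, Matrix.one_apply, apply_ite]
  rw [h1, zero_sub] at h0
  rw [Matrix.sub_mul, smul_mul_assoc, one_mul, Matrix.sub_apply, Matrix.smul_apply,
    Matrix.mul_apply, smul_eq_mul]
  simp only [Matrix.of_apply, Matrix.map_apply, Complex.coe_algebraMap]
  linear_combination -h0

end

/-! ### Carathéodory solutions of linear differential equations -/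

lemma isStateOf_iff {ι : Type*} [Fintype ι] {x g : Signal ι} :
    IsStateOf x g ↔ ∀ i t, 0 ≤ t → IntervalIntegrable (fun s => g s i) volume 0 t ∧
      x t i = ∫ s in (0 : ℝ)..t, g s i := by
  have key : ∀ t, 0 ≤ t → (IntervalIntegrable g volume 0 t ↔
      ∀ i, IntervalIntegrable (fun s => g s i) volume 0 t) := fun t _ => by
    simp only [intervalIntegrable_iff, IntegrableOn]
    exact integrable_pi_iff
  have hev : ∀ t, 0 ≤ t → (∀ i, IntervalIntegrable (fun s => g s i) volume 0 t) → ∀ i,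
      (∫ s in (0 : ℝ)..t, g s) i = ∫ s in (0 : ℝ)..t, g s i := fun t ht h i => by
    simp only [intervalIntegral.integral_of_le ht]
    refine eval_integral (fun i => ?_) i
    have := h i
    rwa [intervalIntegrable_iff, Set.uIoc_of_le ht] at this
  constructor
  · intro h i t ht
    obtain ⟨h1, h2⟩ := h t ht
    have h3 := (key t ht).1 h1
    exact ⟨h3 i, by rw [h2, hev t ht h3]⟩
  · intro h t ht
    have h3 : ∀ i, IntervalIntegrable (fun s => g s i) volume 0 t := fun i => (h i t ht).1
    refine ⟨(key t ht).2 h3, funext fun i => ?_⟩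
    rw [hev t ht h3, (h i t ht).2]

/-- The product rule for an absolutely continuous and a continuously differentiable function. -/
lemma integral_product_rule {f g g' : ℝ → ℝ} {t : ℝ} (hf : IntervalIntegrable f volume 0 t)
    (hg : ∀ s, HasDerivAt g (g' s) s) (hg' : Continuous g') :
    ∫ s in (0 : ℝ)..t, (f s * g s + (∫ x in (0 : ℝ)..s, f x) * g' s) =
      (∫ s in (0 : ℝ)..t, f s) * g t := by
  -- The integral of f is differentiable only almost everywhere, so integration by parts is used in
  -- its absolutely continuous form.
  have hF := hf.absolutelyContinuousOnInterval_intervalIntegral (c := 0) Set.left_mem_uIcc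
  have hdg : deriv g = g' := funext fun s => (hg s).deriv
  have hG : AbsolutelyContinuousOnInterval g 0 t := by
    refine ContDiffOn.absolutelyContinuousOnInterval (ContDiff.contDiffOn ?_)
    rw [contDiff_one_iff_deriv, hdg]
    exact ⟨fun s => (hg s).differentiableAt, hg'⟩
  have h := hF.integral_deriv_mul_eq_sub hG
  rw [intervalIntegral.integral_same, zero_mul, sub_zero] at h
  rw [← h]
  refine intervalIntegral.integral_congr_ae ?_
  filter_upwards [hf.ae_hasDerivAt_integral] with s hs hst
  have hs' : s ∈ Set.uIcc 0 t := Set.uIoc_subset_uIcc hst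
  rw [(hs hs' 0 Set.left_mem_uIcc).deriv, hdg]

section

variable {ι : Type*} [Fintype ι] [DecidableEq ι]

lemma exp_zero_smul_entry (A : Matrix ι ι ℝ) (i j : ι) :
    NormedSpace.exp ((0 : ℝ) • A) i j = (1 : Matrix ι ι ℝ) i j := by
  simp

lemma exp_mul_exp_neg (A : Matrix ι ι ℝ) (t : ℝ) :
    NormedSpace.exp (t • A) * NormedSpace.exp ((-t) • A) = 1 := by
  rw [neg_smul, Matrix.exp_neg]
  exact Matrix.mul_nonsing_inv _ ((Matrix.isUnit_iff_isUnit_det _).1 (Matrix.isUnit_exp _))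

lemma intervalIntegrable_mul_exp {f : ℝ → ℝ} {a b : ℝ} (hf : IntervalIntegrable f volume a b)
    (A : Matrix ι ι ℝ) (i j : ι) {φ : ℝ → ℝ} (hφ : Continuous φ) :
    IntervalIntegrable (fun s => NormedSpace.exp (φ s • A) i j * f s) volume a b :=
  hf.continuousOn_mul ((continuous_exp_entry A i j).comp hφ).continuousOn

/-- Variation of constants: every solution is a convolution with the matrix exponential. -/
lemma IsStateOf.eq_integral {A : Matrix ι ι ℝ} {x g : Signal ι}
    (h : IsStateOf x (fun t => A *ᵥ x t + g t))
    (hg : ∀ j t, 0 ≤ t → IntervalIntegrable (fun s => g s j) volume 0 t) {t : ℝ} (ht : 0 ≤ t)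
    (i : ι) :
    x t i = ∑ j, ∫ s in (0 : ℝ)..t, NormedSpace.exp ((t - s) • A) i j * g s j := by
  rw [isStateOf_iff] at h
  set F : ι → ℝ → ℝ := fun j s => (A *ᵥ x s + g s) j with hF
  have hFi : ∀ j, IntervalIntegrable (F j) volume 0 t := fun j => (h j t ht).1
  have hder : ∀ j s, HasDerivAt (fun s => NormedSpace.exp ((t - s) • A) i j)
      (-(NormedSpace.exp ((t - s) • A) * A) i j) s := fun j s => by
    have := (hasDerivAt_exp_entry A (t - s) i j).scomp s ((hasDerivAt_id s).const_sub t)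
    rw [exp_smul_mul_comm]
    simpa [Function.comp_def] using! this
  have hcont : ∀ j, Continuous fun s => -(NormedSpace.exp ((t - s) • A) * A) i j := fun j => by
    simp only [Matrix.mul_apply]
    exact (continuous_finsetSum _ fun k _ => ((continuous_exp_entry A i k).comp
      (by fun_prop : Continuous fun s : ℝ => t - s)).mul continuous_const).neg
  -- Differentiating e^{(t-s)A} x(s) in s cancels the A x terms and leaves e^{(t-s)A} g(s).
  have hprod := fun j => integral_product_rule (hFi j) (hder j) (hcont j)
  have hsum : ∑ j, (∫ s in (0 : ℝ)..t, F j s) * NormedSpace.exp ((t - t) • A) i j = x t i := by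
    have : ∀ j, (∫ s in (0 : ℝ)..t, F j s) = x t j := fun j => (h j t ht).2.symm
    simp only [this, sub_self, exp_zero_smul_entry, Matrix.one_apply]
    simp
  have hint : ∀ j, IntervalIntegrable (fun s => F j s * NormedSpace.exp ((t - s) • A) i j +
      (∫ y in (0 : ℝ)..s, F j y) * -(NormedSpace.exp ((t - s) • A) * A) i j) volume 0 t := fun j => by
    refine IntervalIntegrable.add ?_ ?_
    · simpa only [mul_comm] using intervalIntegrable_mul_exp (hFi j) A i j
        (by fun_prop : Continuous fun s : ℝ => t - s)
    · refine ContinuousOn.intervalIntegrable (ContinuousOn.mul ?_ (hcont j).continuousOn)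
      exact ((hFi j).absolutelyContinuousOnInterval_intervalIntegral (c := 0)
        Set.left_mem_uIcc).continuousOn
  rw [← hsum, ← Finset.sum_congr rfl fun j _ => hprod j,
    ← intervalIntegral.integral_finsetSum fun j _ => hint j,
    ← intervalIntegral.integral_finsetSum fun j _ => intervalIntegrable_mul_exp (hg j t ht) A i j
        (by fun_prop : Continuous fun s : ℝ => t - s)]
  refine intervalIntegral.integral_congr fun s hs => ?_
  rw [Set.uIcc_of_le ht] at hs
  have hx : ∀ j, (∫ y in (0 : ℝ)..s, F j y) = x s j := fun j => (h j s hs.1).2.symm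
  simp only [hx]
  simp only [hF, Pi.add_apply]
  set E := NormedSpace.exp ((t - s) • A)
  have e1 : ∑ j, (A *ᵥ x s) j * E i j = ∑ j, x s j * (E * A) i j := by
    have h1 : ∑ j, (A *ᵥ x s) j * E i j = (E *ᵥ (A *ᵥ x s)) i := by
      simp only [Matrix.mulVec, dotProduct, mul_comm]
    have h2 : ∑ j, x s j * (E * A) i j = ((E * A) *ᵥ x s) i := by
      simp only [Matrix.mulVec, dotProduct, mul_comm]
    rw [h1, h2, Matrix.mulVec_mulVec]
  simp only [add_mul, mul_neg, Finset.sum_add_distrib, Finset.sum_neg_distrib, e1]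
  simp only [mul_comm (g s _)]
  ring

/-- The solution is e^{tA} ∫ e^{-sA} g(s) ds. The formula works for merely locally integrable
forcing and needs no stability. -/
lemma exists_isStateOf (A : Matrix ι ι ℝ) {g : Signal ι}
    (hg : ∀ j t, 0 ≤ t → IntervalIntegrable (fun s => g s j) volume 0 t) :
    ∃ x, IsStateOf x (fun t => A *ᵥ x t + g t) := by
  set f : ι → ℝ → ℝ := fun j s => ∑ k, NormedSpace.exp ((-s) • A) j k * g s k with hf
  have hfi : ∀ j t, 0 ≤ t → IntervalIntegrable (f j) volume 0 t := fun j t ht => by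
    have := IntervalIntegrable.sum (μ := volume) (a := 0) (b := t) Finset.univ
      (f := fun k s => NormedSpace.exp ((-s) • A) j k * g s k) fun k _ =>
        intervalIntegrable_mul_exp (hg k t ht) A j k continuous_neg
    exact this.congr (fun s _ => by simp [hf])
  set x : Signal ι := fun t i => ∑ j, (∫ s in (0 : ℝ)..t, f j s) * NormedSpace.exp (t • A) i j with hx
  refine ⟨x, isStateOf_iff.2 fun i t ht => ?_⟩
  have hcont : ∀ j, Continuous fun s : ℝ => (A * NormedSpace.exp (s • A)) i j := fun j => by
    simp only [Matrix.mul_apply]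
    exact continuous_finsetSum _ fun k _ => continuous_const.mul (continuous_exp_entry A k j)
  have hprod := fun j => integral_product_rule (hfi j t ht) (fun s => hasDerivAt_exp_entry A s i j)
    (hcont j)
  have hint : ∀ j, IntervalIntegrable (fun s => f j s * NormedSpace.exp (s • A) i j +
      (∫ y in (0 : ℝ)..s, f j y) * (A * NormedSpace.exp (s • A)) i j) volume 0 t := fun j => by
    refine IntervalIntegrable.add ?_ ?_
    · simpa only [mul_comm] using! intervalIntegrable_mul_exp (hfi j t ht) A i j continuous_id
    · refine ContinuousOn.intervalIntegrable (ContinuousOn.mul ?_ (hcont j).continuousOn)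
      exact ((hfi j t ht).absolutelyContinuousOnInterval_intervalIntegral (c := 0)
        Set.left_mem_uIcc).continuousOn
  have hpt : ∀ s, ∑ j, (f j s * NormedSpace.exp (s • A) i j +
      (∫ y in (0 : ℝ)..s, f j y) * (A * NormedSpace.exp (s • A)) i j) = (A *ᵥ x s + g s) i :=
    fun s => by
      set E := NormedSpace.exp (s • A)
      set φ : ι → ℝ := fun j => ∫ y in (0 : ℝ)..s, f j y
      have h1 : ∑ j, f j s * E i j = g s i := by
        have : ∑ j, f j s * E i j = (E *ᵥ (NormedSpace.exp ((-s) • A) *ᵥ g s)) i := by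
          simp only [Matrix.mulVec, dotProduct, mul_comm, hf]
        rw [this, Matrix.mulVec_mulVec, exp_mul_exp_neg, Matrix.one_mulVec]
      have h2 : x s = E *ᵥ φ := by
        ext i
        simp only [hx, Matrix.mulVec, dotProduct, mul_comm]
        rfl
      rw [Finset.sum_add_distrib, h1, h2, Matrix.mulVec_mulVec, Pi.add_apply, add_comm]
      congr 1
      simp only [Matrix.mulVec, dotProduct]
      exact Finset.sum_congr rfl fun j _ => mul_comm _ _
  constructor
  · have := IntervalIntegrable.sum Finset.univ fun j _ => hint j
    refine this.congr fun s _ => ?_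
    rw [← hpt, Finset.sum_apply]
  · rw [hx]
    simp only
    rw [← Finset.sum_congr rfl fun j _ => hprod j,
      ← intervalIntegral.integral_finsetSum fun j _ => hint j]
    exact intervalIntegral.integral_congr fun s _ => hpt s

end

/-! ### State-space realizations -/

lemma BddSignal.intervalIntegrable_mulVec {ι m : Type*} [Fintype m] {u : Signal m} (hu : BddSignal u) (B : Matrix ι m ℝ)
    (j : ι) (t : ℝ) : IntervalIntegrable (fun s => (B *ᵥ u s) j) volume 0 t :=
  (BddFun.sum Finset.univ fun k _ => (hu.bddFun k).const_mul (B j k)).intervalIntegrable _ _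

section

variable {ι p m : Type*} [Fintype ι] [DecidableEq ι] {A : Matrix ι ι ℝ} {B : Matrix ι m ℝ}
  {C : Matrix p ι ℝ} {D : Matrix p m ℝ}

lemma stateKernel_entry (t : ℝ) (i : p) (j : m) : (C * stateKernel A t * B) i j =
    ∑ l, ∑ k, C i k * stateKernel A t k l * B l j := by
  simp only [Matrix.mul_apply, Finset.sum_mul]

lemma IsHurwitz.integrable_realization (hA : IsHurwitz A) (i : p) (j : m) :
    Integrable (fun t => (C * stateKernel A t * B) i j) := by
  simp only [stateKernel_entry]
  exact integrable_finsetSum _ fun l _ => integrable_finsetSum _ fun k _ =>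
    ((hA.integrable_stateKernel k l).const_mul _).mul_const _

/-- The transform of e^{tA} is an explicit right inverse of jω - A. It makes the determinant
nonzero, hence the resolvent regular, and identifies its value. -/
lemma IsHurwitz.stateSpaceTF_freq (hA : IsHurwitz A) (ω : ℝ) :
    IsRegularAt ((ω : ℂ) * Complex.I) (stateSpaceTF A B C D) ∧
    freq (stateSpaceTF A B C D) ω = C.map (algebraMap ℝ ℂ) *
      (Matrix.of fun i j => freqInt (fun t => stateKernel A t i j) ω) * B.map (algebraMap ℝ ℂ) +
      D.map (algebraMap ℝ ℂ) := by
  set a := (ω : ℂ) * Complex.I with ha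
  have hinv := hA.freqInt_stateKernel ω
  have hX : (RatFunc.X : RatFunc ℝ) ∈ regularAt a := by
    rw [← RatFunc.algebraMap_X]
    exact algebraMap_mem_regularAt a _
  obtain ⟨h1, h1'⟩ := isRegularAt_smul_one (p := ι) hX
  rw [show ratEval a RatFunc.X = a from RatFunc.eval_X _ _] at h1'
  obtain ⟨h2, h2'⟩ := h1.sub (isRegularAt_C A).1
  rw [h1', (isRegularAt_C A).2] at h2'
  have hdet : ((((RatFunc.X : RatFunc ℝ) • (1 : Matrix ι ι (RatFunc ℝ)) -
      A.map (RatFunc.C (K := ℝ))).map (ratEval a))).det ≠ 0 := by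
    rw [h2']
    intro h0
    have := congrArg Matrix.det hinv
    rw [Matrix.det_mul, h0, zero_mul, Matrix.det_one] at this
    exact zero_ne_one this
  obtain ⟨h3, h3'⟩ := h2.inv hdet
  rw [h2', Matrix.inv_eq_right_inv hinv] at h3'
  obtain ⟨h4, h4'⟩ := (isRegularAt_C C).1.mul h3
  obtain ⟨h5, h5'⟩ := h4.mul (isRegularAt_C B).1
  obtain ⟨h6, h6'⟩ := h5.add (isRegularAt_C D).1
  refine ⟨h6, h6'.trans ?_⟩
  rw [h5', h4', h3', (isRegularAt_C C).2, (isRegularAt_C B).2, (isRegularAt_C D).2]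

lemma freqInt_const_mul_mul {h : ℝ → ℝ} (c d ω : ℝ) :
    freqInt (fun t => c * h t * d) ω = c * freqInt h ω * d := by
  rw [freqInt, freqInt, ← integral_const_mul, ← integral_mul_const]
  congr 1 with t
  push_cast
  ring

lemma freqInt_sum {α : Type*} (s : Finset α) {h : α → ℝ → ℝ} (hh : ∀ a ∈ s, Integrable (h a))
    (ω : ℝ) : freqInt (fun t => ∑ a ∈ s, h a t) ω = ∑ a ∈ s, freqInt (h a) ω := by
  simp only [freqInt, Complex.ofReal_sum, Finset.sum_mul]
  exact integral_finsetSum _ fun a ha => integrable_mul_exp_neg (hh a ha).ofReal ω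

lemma IsHurwitz.isImpulseResponse (hA : IsHurwitz A) :
    IsImpulseResponse (stateSpaceTF A B C D) D (fun t => C * stateKernel A t * B) := by
  refine ⟨hA.integrable_realization, fun ω i j => ?_⟩
  have h : ∀ l k, Integrable (fun t => C i k * stateKernel A t k l * B l j) := fun l k =>
    ((hA.integrable_stateKernel k l).const_mul _).mul_const _
  change _ = _ + freqInt (fun t => (C * stateKernel A t * B) i j) ω
  simp only [stateKernel_entry]
  rw [freqInt_sum _ fun l _ => integrable_finsetSum _ fun k _ => h l k, (hA.stateSpaceTF_freq ω).2,
    Matrix.add_apply, add_comm]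
  congr 1
  simp only [Matrix.mul_apply, Finset.sum_mul]
  refine Finset.sum_congr rfl fun l _ => ?_
  rw [freqInt_sum _ fun k _ => h l k]
  refine Finset.sum_congr rfl fun k _ => ?_
  rw [freqInt_const_mul_mul]
  simp

lemma IsHurwitz.isRLInf_stateSpaceTF (hA : IsHurwitz A) : IsRLInf (stateSpaceTF A B C D) :=
  hA.isImpulseResponse.isRLInf fun ω => (hA.stateSpaceTF_freq ω).1

variable [Fintype m]

/-- The output of a stable system started from rest is the response of its impulse response. -/
lemma IsStateOf.output_eq (hA : IsHurwitz A) {u : Signal m} (hu : BddSignal u) {x : Signal ι}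
    (hx : IsStateOf x (fun t => A *ᵥ x t + B *ᵥ u t)) {t : ℝ} (ht : 0 ≤ t) :
    C *ᵥ x t + D *ᵥ u t = ltiResp D (fun t => C * stateKernel A t * B) u t := by
  have hconv : ∀ k l j, ∫ s in (0 : ℝ)..t, NormedSpace.exp ((t - s) • A) k l * (B l j * u s j) =
      B l j * convol (fun t => stateKernel A t k l) (fun s => u s j) t := fun k l j => by
    rw [convol, ← integral_const_mul, intervalIntegral.integral_of_le ht, integral_Ioc_eq_integral_Ioo, ← integral_indicator measurableSet_Ioo]
    refine integral_congr_ae ?_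
    -- Both integrands vanish for s < 0, where u = 0, and for s ≥ t, where the kernel is 0. At s = 0
    -- they may differ, as u(0) is arbitrary.
    have hne : ∀ᵐ s : ℝ, s ≠ 0 := by simp [ae_iff]
    filter_upwards [hne] with s hs
    by_cases h1 : s < t
    · rcases lt_or_gt_of_ne hs with h0 | h0
      · simp [h0.not_gt, hu.zero_of_neg s h0]
      · simp [h0, h1, stateKernel]
        ring
    · simp [h1, stateKernel]
  have hint : ∀ k l j, IntervalIntegrable
      (fun s => NormedSpace.exp ((t - s) • A) k l * (B l j * u s j)) volume 0 t := fun k l j =>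
    intervalIntegrable_mul_exp (((hu.bddFun j).const_mul _).intervalIntegrable _ _) A k l
      (by fun_prop : Continuous fun s : ℝ => t - s)
  have hxk : ∀ k, x t k =
      ∑ l, ∑ j, B l j * convol (fun t => stateKernel A t k l) (fun s => u s j) t := fun k => by
    rw [hx.eq_integral (fun j t _ => hu.intervalIntegrable_mulVec B j t) ht]
    refine Finset.sum_congr rfl fun l _ => ?_
    simp only [Matrix.mulVec, dotProduct, Finset.mul_sum]
    rw [intervalIntegral.integral_finsetSum fun j _ => hint k l j]
    exact Finset.sum_congr rfl fun j _ => hconv k l j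
  have hK : ∀ i j, convol (fun t => (C * stateKernel A t * B) i j) (fun s => u s j) t =
      ∑ l, ∑ k, C i k * (B l j * convol (fun t => stateKernel A t k l) (fun s => u s j) t) :=
    fun i j => by
      simp only [convol, stateKernel_entry, Finset.sum_mul]
      have h : ∀ l k, Integrable (fun s => C i k * stateKernel A (t - s) k l * B l j * u s j) :=
        fun l k => integrable_mul_bddFun' (h := fun s => C i k * stateKernel A s k l * B l j)
          (((hA.integrable_stateKernel k l).const_mul _).mul_const _) (hu.bddFun j) t
      rw [integral_finsetSum _ fun l _ => integrable_finsetSum _ fun k _ => h l k]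
      refine Finset.sum_congr rfl fun l _ => ?_
      rw [integral_finsetSum _ fun k _ => h l k]
      refine Finset.sum_congr rfl fun k _ => ?_
      rw [← integral_const_mul, ← integral_const_mul]
      congr 1 with s
      ring
  ext i
  simp only [ltiResp, ht, if_true, hK, Finset.sum_add_distrib]
  rw [Pi.add_apply, add_comm]
  congr 1
  simp only [Matrix.mulVec, dotProduct, hxk, Finset.mul_sum]
  rw [Finset.sum_comm]
  rw [Finset.sum_comm (s := (Finset.univ : Finset m))]
  refine Finset.sum_congr rfl fun l _ => ?_
  rw [Finset.sum_comm]

end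

/-! ### The closed loop -/

namespace IsStateOf

variable {ι κ : Type*} [Fintype ι] [Fintype κ] {x y g h : Signal ι}

lemma congr (hx : IsStateOf x g) (hgh : ∀ t, 0 ≤ t → g t = h t) : IsStateOf x h := by
  intro t ht
  obtain ⟨h1, h2⟩ := hx t ht
  refine ⟨h1.congr fun s hs => ?_, h2.trans (intervalIntegral.integral_congr fun s hs => ?_)⟩
  · rw [Set.uIoc_of_le ht] at hs
    exact hgh s hs.1.le
  · rw [Set.uIcc_of_le ht] at hs
    exact hgh s hs.1

lemma add (hx : IsStateOf x g) (hy : IsStateOf y h) :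
    IsStateOf (fun t => x t + y t) (fun t => g t + h t) := fun t ht =>
  ⟨(hx t ht).1.add (hy t ht).1, by
    simp only [(hx t ht).2, (hy t ht).2]
    exact (intervalIntegral.integral_add (hx t ht).1 (hy t ht).1).symm⟩

lemma sub (hx : IsStateOf x g) (hy : IsStateOf y h) :
    IsStateOf (fun t => x t - y t) (fun t => g t - h t) := fun t ht =>
  ⟨(hx t ht).1.sub (hy t ht).1, by
    simp only [(hx t ht).2, (hy t ht).2]
    exact (intervalIntegral.integral_sub (hx t ht).1 (hy t ht).1).symm⟩

lemma sumElim {x' g' : Signal κ} (hx : IsStateOf x g) (hx' : IsStateOf x' g') :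
    IsStateOf (fun t => Sum.elim (x t) (x' t)) (fun t => Sum.elim (g t) (g' t)) := by
  rw [isStateOf_iff] at hx hx' ⊢
  rintro (i | i)
  · exact hx i
  · exact hx' i

lemma inl {x g : Signal (ι ⊕ κ)} (hx : IsStateOf x g) :
    IsStateOf (fun t => x t ∘ Sum.inl) (fun t => g t ∘ Sum.inl) := by
  rw [isStateOf_iff] at hx ⊢
  exact fun i => hx (Sum.inl i)

lemma inr {x g : Signal (ι ⊕ κ)} (hx : IsStateOf x g) :
    IsStateOf (fun t => x t ∘ Sum.inr) (fun t => g t ∘ Sum.inr) := by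
  rw [isStateOf_iff] at hx ⊢
  exact fun i => hx (Sum.inr i)

lemma intervalIntegrable_state (hx : IsStateOf x g) (i : ι) {t : ℝ} (ht : 0 ≤ t) :
    IntervalIntegrable (fun s => x s i) volume 0 t := by
  rw [isStateOf_iff] at hx
  have h1 := ((hx i t ht).1.absolutelyContinuousOnInterval_intervalIntegral (c := 0)
    Set.left_mem_uIcc).continuousOn.intervalIntegrable (μ := volume)
  refine h1.congr fun s hs => ?_
  rw [Set.uIoc_of_le ht] at hs
  exact (hx i s hs.1.le).2.symm

end IsStateOf

/-- Signals whose components are locally integrable on `t ≥ 0`. -/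
def IsLocInt {ι : Type*} (g : Signal ι) : Prop :=
  ∀ j t, 0 ≤ t → IntervalIntegrable (fun s => g s j) volume 0 t

namespace IsLocInt

variable {ι κ : Type*} {g h : Signal ι}

lemma add (hg : IsLocInt g) (hh : IsLocInt h) : IsLocInt (fun t => g t + h t) :=
  fun j t ht => (hg j t ht).add (hh j t ht)

lemma sub (hg : IsLocInt g) (hh : IsLocInt h) : IsLocInt (fun t => g t - h t) :=
  fun j t ht => (hg j t ht).sub (hh j t ht)

lemma mulVec [Fintype ι] (hg : IsLocInt g) (B : Matrix κ ι ℝ) : IsLocInt (fun t => B *ᵥ g t) :=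
  fun j t ht => by
    have := IntervalIntegrable.sum Finset.univ fun k _ => (hg k t ht).const_mul (B j k)
    exact this.congr fun s _ => by simp [Matrix.mulVec, dotProduct]

end IsLocInt

lemma BddSignal.isLocInt {ι : Type*} {u : Signal ι} (hu : BddSignal u) : IsLocInt u :=
  fun j t _ => (hu.bddFun j).intervalIntegrable 0 t

section

variable {n m₁ m₂ p₁ p₂ k c : Type*} [Fintype n] [Fintype m₁] [Fintype m₂]
  [Fintype p₂] [Fintype k] [Fintype c] [DecidableEq n] [DecidableEq k] [DecidableEq c]
  {P : Plant n m₁ m₂ p₁ p₂} {C : Controller c m₂ p₂} {K : Controller k m₂ p₂}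
  {L : Matrix n p₂ ℝ} {Lc : Matrix c m₂ ℝ} {w : Signal m₁} {r : Signal p₂} {z : Signal p₁}

/-- Separation: the closed-loop output is the sum of the responses of the two single-controller
loops. -/
lemma IsClosedLoopOutput.eq_add (hC : Stabilizes P C) (hK : Stabilizes P K) (hw : BddSignal w)
    (hr : BddSignal r) (hz : IsClosedLoopOutput P C K L Lc w r z) :
    ∃ v z₂, IsLTIOutput (Tz1w P K) w v ∧ IsLTIOutput (Tz2r P C) r z₂ ∧ z = v + z₂ := by
  obtain ⟨x, xhat, xc, xq, u, uc, uq, y, f, hx, hz, hz0, hy, hxc, huc, hxhat, hf, hxq, huq, hu⟩ := hz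
  set q₁ : Signal c := fun t => xq t ∘ Sum.inl with hq₁
  set q₂ : Signal n := fun t => (xq t ∘ Sum.inr) ∘ Sum.inl with hq₂
  set q₃ : Signal k := fun t => (xq t ∘ Sum.inr) ∘ Sum.inr with hq₃
  -- The total control is C acting on the differences x_c - q₁, x̂ - q₂ plus K acting on q₂, q₃ and
  -- the residual; this dictates the two sets of coordinates.
  have hu' : ∀ t, 0 ≤ t → u t = C.C *ᵥ (xc t - q₁ t) + C.D *ᵥ (P.C₂ *ᵥ (xhat t - q₂ t) - r t) +
      K.D *ᵥ (P.C₂ *ᵥ q₂ t - f t) + K.C *ᵥ q₃ t := fun t ht => by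
    have hf' : y t = P.C₂ *ᵥ xhat t - f t := by rw [hf t ht]; abel
    rw [hu t ht, huc t ht, huq t ht, hf']
    simp only [youlaQ, Matrix.fromCols_mulVec, Matrix.neg_mulVec, Matrix.sub_mulVec,
      ← Matrix.mulVec_mulVec, Matrix.mulVec_sub]
    simp only [hq₁, hq₂, hq₃]
    abel
  have hq₁s : IsStateOf q₁ (fun t => (C.A + Lc * C.C) *ᵥ q₁ t + (C.B + Lc * (C.D - K.D)) *ᵥ
      (P.C₂ *ᵥ q₂ t - f t) - (Lc * K.C) *ᵥ q₃ t) := by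
    refine hxq.inl.congr fun t ht => ?_
    ext i
    simp only [youlaQ, Matrix.fromBlocks_mulVec, Matrix.fromRows_mulVec, Matrix.fromCols_mulVec,
      Function.comp_apply, Pi.add_apply, Sum.elim_inl]
    simp only [← Pi.add_apply]
    refine congrFun ?_ i
    simp only [Matrix.neg_mulVec, Matrix.sub_mulVec, Matrix.add_mulVec,
      ← Matrix.mulVec_mulVec, Matrix.mulVec_sub]
    simp only [hq₁, hq₂, hq₃]
    abel
  have hq₂s : IsStateOf q₂ (fun t => (P.A + P.B₂ * K.D * P.C₂) *ᵥ q₂ t + (P.B₂ * K.C) *ᵥ q₃ t +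
      (L - P.B₂ * K.D) *ᵥ f t) := by
    refine hxq.inr.inl.congr fun t ht => ?_
    ext i
    simp only [youlaQ, loopMatrix, Matrix.fromBlocks_mulVec, Matrix.fromRows_mulVec,
      Matrix.zero_mulVec, zero_add,
      Function.comp_apply, Pi.add_apply, Sum.elim_inl, Sum.elim_inr]
    rfl
  have hq₃s : IsStateOf q₃ (fun t => (K.B * P.C₂) *ᵥ q₂ t + K.A *ᵥ q₃ t - K.B *ᵥ f t) := by
    refine hxq.inr.inr.congr fun t ht => ?_
    ext i
    simp only [youlaQ, loopMatrix, Matrix.fromBlocks_mulVec, Matrix.fromRows_mulVec,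
      Matrix.zero_mulVec, zero_add,
      Function.comp_apply, Pi.add_apply, Sum.elim_inr, Matrix.neg_mulVec]
    rfl
  -- In these coordinates u, r and L cancel, leaving the loop with K driven by w.
  have hKs : IsStateOf (fun t => Sum.elim (q₂ t - xhat t + x t) (q₃ t))
      (fun t => loopMatrix P K *ᵥ Sum.elim (q₂ t - xhat t + x t) (q₃ t) +
        fromRows (P.B₁ + P.B₂ * K.D * P.D₂₁) (K.B * P.D₂₁) *ᵥ w t) := by
    refine (((hq₂s.sub hxhat).add hx).sumElim hq₃s).congr fun t ht => ?_
    rw [loopMatrix, Matrix.fromBlocks_mulVec, Matrix.fromRows_mulVec, Sum.elim_comp_inl,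
      Sum.elim_comp_inr, ← Sum.elim_add_add, hf t ht, hy t ht]
    congr 1 <;>
    · simp only [Matrix.sub_mulVec, Matrix.add_mulVec, ← Matrix.mulVec_mulVec, Matrix.mulVec_sub,
        Matrix.mulVec_add]
      abel
  -- Here the residual f cancels, and with it w, leaving the loop with C driven by r. The two plant
  -- components add up to x.
  have hCs : IsStateOf (fun t => Sum.elim (xhat t - q₂ t) (xc t - q₁ t))
      (fun t => loopMatrix P C *ᵥ Sum.elim (xhat t - q₂ t) (xc t - q₁ t) +
        fromRows (-(P.B₂ * C.D)) (-C.B) *ᵥ r t) := by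
    refine ((hxhat.sub hq₂s).sumElim (hxc.sub hq₁s)).congr fun t ht => ?_
    have hf' : y t = P.C₂ *ᵥ xhat t - f t := by rw [hf t ht]; abel
    rw [loopMatrix, Matrix.fromBlocks_mulVec, Matrix.fromRows_mulVec, Sum.elim_comp_inl,
      Sum.elim_comp_inr, ← Sum.elim_add_add, hu' t ht, hf']
    congr 1 <;>
    · simp only [Matrix.sub_mulVec, Matrix.add_mulVec, ← Matrix.mulVec_mulVec, Matrix.mulVec_sub,
        Matrix.mulVec_add, Matrix.neg_mulVec]
      abel
  refine ⟨_, _, isLTIOutput_iff.2 ⟨_, _, hK.isImpulseResponse, rfl⟩,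
    isLTIOutput_iff.2 ⟨_, _, hC.isImpulseResponse, rfl⟩, ?_⟩
  ext t : 1
  rcases lt_or_ge t 0 with ht | ht
  · rw [hz0 t ht, Pi.add_apply, (hw.ltiResp hK.integrable_realization).zero_of_neg t ht,
      (hr.ltiResp hC.integrable_realization).zero_of_neg t ht, add_zero]
  · rw [Pi.add_apply, ← hKs.output_eq hK hw ht, ← hCs.output_eq hC hr ht, hz t ht, hu' t ht, hf t ht,
      hy t ht, Matrix.fromCols_mulVec, Matrix.fromCols_mulVec, Sum.elim_comp_inl, Sum.elim_comp_inr,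
      Sum.elim_comp_inl, Sum.elim_comp_inr]
    simp only [Matrix.add_mulVec, ← Matrix.mulVec_mulVec, Matrix.mulVec_sub,
      Matrix.mulVec_add, Matrix.neg_mulVec]
    abel

/-- The closed loop has a solution for all bounded signals `w` and `r`. -/
lemma exists_isClosedLoopOutput (P : Plant n m₁ m₂ p₁ p₂) (C : Controller c m₂ p₂)
    (K : Controller k m₂ p₂) (L : Matrix n p₂ ℝ) (Lc : Matrix c m₂ ℝ) (hw : BddSignal w)
    (hr : BddSignal r) : ∃ z, IsClosedLoopOutput P C K L Lc w r z := by
  obtain ⟨ξ, hξ⟩ := exists_isStateOf (loopMatrix P K)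
    (hw.isLocInt.mulVec (fromRows (P.B₁ + P.B₂ * K.D * P.D₂₁) (K.B * P.D₂₁)))
  obtain ⟨η, hη⟩ := exists_isStateOf (loopMatrix P C)
    (hr.isLocInt.mulVec (fromRows (-(P.B₂ * C.D)) (-C.B)))
  -- The separated coordinates are solved first and the loop is reassembled from them; e plays the
  -- role of the observer error x̂ - x and is driven by w only.
  obtain ⟨e, he⟩ := exists_isStateOf (P.A + L * P.C₂)
    (hw.isLocInt.mulVec (-(P.B₁ + L * P.D₂₁)))
  set xw : Signal n := fun t => ξ t ∘ Sum.inl with hxw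
  set q₃ : Signal k := fun t => ξ t ∘ Sum.inr with hq₃
  set d₂ : Signal n := fun t => η t ∘ Sum.inl with hd₂
  set d₁ : Signal c := fun t => η t ∘ Sum.inr with hd₁
  set f : Signal p₂ := fun t => P.C₂ *ᵥ e t - P.D₂₁ *ᵥ w t with hf
  set q₂ : Signal n := fun t => xw t + e t with hq₂
  have hxws : IsStateOf xw (fun t => (P.A + P.B₂ * K.D * P.C₂) *ᵥ xw t + (P.B₂ * K.C) *ᵥ q₃ t +
      (P.B₁ + P.B₂ * K.D * P.D₂₁) *ᵥ w t) := by
    refine hξ.inl.congr fun t ht => ?_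
    rw [loopMatrix, Matrix.fromBlocks_mulVec, Matrix.fromRows_mulVec, ← Sum.elim_add_add,
      Sum.elim_comp_inl]
  have hq₃s : IsStateOf q₃ (fun t => (K.B * P.C₂) *ᵥ xw t + K.A *ᵥ q₃ t + (K.B * P.D₂₁) *ᵥ w t) := by
    refine hξ.inr.congr fun t ht => ?_
    rw [loopMatrix, Matrix.fromBlocks_mulVec, Matrix.fromRows_mulVec, ← Sum.elim_add_add,
      Sum.elim_comp_inr]
  have hd₂s : IsStateOf d₂ (fun t => (P.A + P.B₂ * C.D * P.C₂) *ᵥ d₂ t + (P.B₂ * C.C) *ᵥ d₁ t +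
      (-(P.B₂ * C.D)) *ᵥ r t) := by
    refine hη.inl.congr fun t ht => ?_
    rw [loopMatrix, Matrix.fromBlocks_mulVec, Matrix.fromRows_mulVec, ← Sum.elim_add_add,
      Sum.elim_comp_inl]
  have hd₁s : IsStateOf d₁ (fun t => (C.B * P.C₂) *ᵥ d₂ t + C.A *ᵥ d₁ t + (-C.B) *ᵥ r t) := by
    refine hη.inr.congr fun t ht => ?_
    rw [loopMatrix, Matrix.fromBlocks_mulVec, Matrix.fromRows_mulVec, ← Sum.elim_add_add,
      Sum.elim_comp_inr]
  have hel : IsLocInt e := fun j t ht => he.intervalIntegrable_state j ht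
  have hfl : IsLocInt f := (hel.mulVec P.C₂).sub (hw.isLocInt.mulVec P.D₂₁)
  have hq₂l : IsLocInt q₂ :=
    IsLocInt.add (fun j t ht => hxws.intervalIntegrable_state j ht) hel
  have hq₃l : IsLocInt q₃ := fun j t ht => hq₃s.intervalIntegrable_state j ht
  -- This component of Q is driven by q₂, q₃ and f and feeds none of them, so it can be solved last.
  obtain ⟨q₁, hq₁s⟩ := exists_isStateOf (C.A + Lc * C.C)
    ((((hq₂l.mulVec P.C₂).sub hfl).mulVec (C.B + Lc * (C.D - K.D))).sub
      (hq₃l.mulVec (Lc * K.C)))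
  set x : Signal n := fun t => d₂ t + xw t with hx
  set xhat : Signal n := fun t => d₂ t + q₂ t with hxhat
  set xc : Signal c := fun t => d₁ t + q₁ t with hxc
  set xq : Signal (c ⊕ (n ⊕ k)) := fun t => Sum.elim (q₁ t) (Sum.elim (q₂ t) (q₃ t)) with hxq
  set y : Signal p₂ := fun t => P.C₂ *ᵥ x t + P.D₂₁ *ᵥ w t with hy
  set uc : Signal m₂ := fun t => C.C *ᵥ xc t + C.D *ᵥ (y t - r t) with huc
  set uq : Signal m₂ := fun t => (youlaQ P C K L Lc).C *ᵥ xq t + (youlaQ P C K L Lc).D *ᵥ f t with huq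
  have hu : ∀ t, uc t + uq t = C.C *ᵥ d₁ t + C.D *ᵥ (P.C₂ *ᵥ d₂ t - r t) +
      K.D *ᵥ (P.C₂ *ᵥ q₂ t - f t) + K.C *ᵥ q₃ t := fun t => by
    simp only [huc, huq, hxc, hxq, hy, hf, hq₂, hx, youlaQ, Matrix.fromCols_mulVec,
      Sum.elim_comp_inl, Sum.elim_comp_inr, Matrix.neg_mulVec, Matrix.sub_mulVec,
      ← Matrix.mulVec_mulVec, Matrix.mulVec_sub, Matrix.mulVec_add]
    abel
  have hq₂s : IsStateOf q₂ (fun t => (P.A + P.B₂ * K.D * P.C₂) *ᵥ q₂ t + (P.B₂ * K.C) *ᵥ q₃ t +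
      (L - P.B₂ * K.D) *ᵥ f t) := by
    refine (hxws.add he).congr fun t ht => ?_
    simp only [hq₂, hf, Matrix.sub_mulVec, Matrix.add_mulVec, ← Matrix.mulVec_mulVec,
      Matrix.mulVec_sub, Matrix.mulVec_add, Matrix.neg_mulVec]
    abel
  refine ⟨fun t => if 0 ≤ t then P.C₁ *ᵥ (P.C₂ *ᵥ x t - r t) + P.D₁₂ *ᵥ (uc t + uq t) else 0,
    x, xhat, xc, xq, fun t => uc t + uq t, uc, uq, y, f, ?_, fun t ht => by simp [ht],
    fun t ht => by simp [ht.not_ge], fun t _ => rfl, ?_, fun t _ => rfl, ?_, fun t _ => ?_, ?_,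
    fun t _ => rfl, fun t _ => rfl⟩
  · refine (hd₂s.add hxws).congr fun t ht => ?_
    simp only [hu]
    simp only [hx, hq₂, hf, Matrix.add_mulVec, ← Matrix.mulVec_mulVec,
      Matrix.mulVec_sub, Matrix.mulVec_add, Matrix.neg_mulVec]
    abel
  · refine (hd₁s.add hq₁s).congr fun t ht => ?_
    simp only [hu]
    simp only [hx, hxc, hy, hq₂, hf, Matrix.sub_mulVec, Matrix.add_mulVec, ← Matrix.mulVec_mulVec,
      Matrix.mulVec_sub, Matrix.mulVec_add, Matrix.neg_mulVec]
    abel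
  · refine (hd₂s.add hq₂s).congr fun t ht => ?_
    simp only [hu]
    simp only [hxhat, hq₂, hf, Matrix.sub_mulVec, Matrix.add_mulVec, ← Matrix.mulVec_mulVec,
      Matrix.mulVec_sub, Matrix.mulVec_add, Matrix.neg_mulVec]
    abel
  · simp only [hf, hxhat, hy, hx, hq₂, Matrix.mulVec_add]
    abel
  · have hq₂₃ : IsStateOf (fun t => Sum.elim (q₂ t) (q₃ t)) (fun t => loopMatrix P K *ᵥ
        Sum.elim (q₂ t) (q₃ t) + fromRows (L - P.B₂ * K.D) (-K.B) *ᵥ f t) := by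
      refine (hq₂s.sumElim hq₃s).congr fun t ht => ?_
      rw [loopMatrix, Matrix.fromBlocks_mulVec, Matrix.fromRows_mulVec, Sum.elim_comp_inl,
        Sum.elim_comp_inr, ← Sum.elim_add_add]
      congr 1
      simp only [hq₂, hf, ← Matrix.mulVec_mulVec,
        Matrix.mulVec_sub, Matrix.mulVec_add, Matrix.neg_mulVec]
      abel
    refine (hq₁s.sumElim hq₂₃).congr fun t ht => ?_
    simp only [youlaQ, hxq]
    rw [Matrix.fromBlocks_mulVec, Matrix.fromRows_mulVec, Matrix.fromRows_mulVec, Matrix.fromRows_mulVec, Sum.elim_comp_inl,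
      Sum.elim_comp_inr, ← Sum.elim_add_add, Matrix.fromCols_mulVec, Matrix.zero_mulVec, zero_add,
      Sum.elim_comp_inl, Sum.elim_comp_inr]
    congr 1
    simp only [Matrix.sub_mulVec, Matrix.add_mulVec, ← Matrix.mulVec_mulVec,
      Matrix.mulVec_sub, Matrix.neg_mulVec]
    abel

end

/-! ### The worst dependent weighting -/

section

variable {p q m : Type*} [Fintype p] [Fintype m]

section

open scoped Matrix.Norms.L2Operator

variable [DecidableEq m]

lemma norm_le_of_hinfNorm_lt {M : TransferMatrix p m} {γ : ℝ} (hγ : 0 < γ)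
    (h : hinfNorm M < ENNReal.ofReal γ) :
    ∃ g, 0 ≤ g ∧ g < γ ∧ ∀ ω, ‖freq M ω‖ ≤ g := by
  refine ⟨(hinfNorm M).toReal, ENNReal.toReal_nonneg, ?_, fun ω => ?_⟩
  · have := ENNReal.toReal_strict_mono ENNReal.ofReal_ne_top h
    rwa [ENNReal.toReal_ofReal hγ.le] at this
  · exact (ENNReal.ofReal_le_iff_le_toReal h.ne_top).1
      (le_iSup (fun ω : ℝ => ENNReal.ofReal ‖freq M ω‖) ω)

lemma sum_norm_sq_mul_le (T : Matrix p m ℂ) {g : ℝ} (hT : ‖T‖ ≤ g) (x : m → ℂ) :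
    ∑ i, ‖∑ j, T i j * x j‖ ^ 2 ≤ g ^ 2 * ∑ j, ‖x j‖ ^ 2 := by
  have h1 := T.l2_opNorm_mulVec (WithLp.toLp 2 x)
  have h2 := pow_le_pow_left₀ (norm_nonneg _) (h1.trans
    (mul_le_mul_of_nonneg_right hT (norm_nonneg _))) 2
  rw [mul_pow, EuclideanSpace.norm_sq_eq, EuclideanSpace.norm_sq_eq] at h2
  exact h2

lemma norm_entry_le (X : Matrix p m ℂ) (i : p) (j : m) : ‖X i j‖ ≤ ‖X‖ := by
  have h := sum_norm_sq_mul_le X le_rfl (Pi.single j 1)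
  rw [Finset.sum_eq_single j (fun k _ hk => by simp [hk]) (by simp)] at h
  have h1 : ‖X i j‖ ^ 2 ≤ ‖X‖ ^ 2 := by
    refine le_trans ?_ (h.trans_eq (by simp))
    refine le_trans ?_ (Finset.single_le_sum (fun k _ => sq_nonneg _) (Finset.mem_univ i))
    simp [Pi.single_apply]
  exact le_of_sq_le_sq h1 (norm_nonneg _)

variable [Fintype q] [DecidableEq q] [DecidableEq p] {T : Matrix p m ℂ} {g γ : ℝ}

/-- From γ² X = Y + T*T X the triangle inequality gives (γ² - g²)‖X‖ ≤ ‖Y‖. This yields both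
invertibility and a bound uniform in ω. -/
lemma norm_le_of_gain_lt (hg : 0 ≤ g) (hgγ : g < γ) (hT : ‖T‖ ≤ g) {X Y : Matrix m q ℂ}
    (h : (((γ : ℂ) ^ 2) • 1 - Tᴴ * T) * X = Y) : ‖X‖ ≤ (γ ^ 2 - g ^ 2)⁻¹ * ‖Y‖ := by
  have h1 : ((γ : ℂ) ^ 2) • X = Y + Tᴴ * (T * X) := by
    rw [← h, Matrix.sub_mul, Matrix.smul_mul, Matrix.one_mul, Matrix.mul_assoc]
    abel
  have h2 : γ ^ 2 * ‖X‖ ≤ ‖Y‖ + g * (g * ‖X‖) := by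
    calc γ ^ 2 * ‖X‖ = ‖((γ : ℂ) ^ 2) • X‖ := by
          rw [norm_smul, norm_pow, Complex.norm_real, Real.norm_eq_abs, sq_abs]
      _ ≤ ‖Y‖ + ‖Tᴴ * (T * X)‖ := h1 ▸ norm_add_le _ _
      _ ≤ _ := by
        gcongr
        refine (Matrix.l2_opNorm_mul _ _).trans ?_
        rw [Matrix.l2_opNorm_conjTranspose]
        gcongr
        exact (Matrix.l2_opNorm_mul _ _).trans (by gcongr)
  have h3 : 0 < γ ^ 2 - g ^ 2 := by nlinarith
  rw [inv_mul_eq_div, le_div_iff₀ h3]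
  linarith

lemma det_ne_zero_of_gain_lt (hg : 0 ≤ g) (hgγ : g < γ) (hT : ‖T‖ ≤ g) :
    (((γ : ℂ) ^ 2) • 1 - Tᴴ * T).det ≠ 0 := fun h => by
  obtain ⟨v, hv, hv0⟩ := Matrix.exists_mulVec_eq_zero_iff.2 h
  have h1 : (((γ : ℂ) ^ 2) • 1 - Tᴴ * T) * Matrix.replicateCol Unit v = 0 := by
    rw [← Matrix.replicateCol_mulVec, hv0, Matrix.replicateCol_zero]
  have h2 := norm_le_of_gain_lt hg hgγ hT h1
  rw [norm_zero, mul_zero, norm_le_zero_iff] at h2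
  exact hv (funext fun i => congrFun (congrFun h2 i) ())

lemma exists_norm_freq_le {M : TransferMatrix p m} (hM : IsRLInf M) :
    ∃ B, ∀ ω, ‖freq M ω‖ ≤ B := by
  obtain ⟨D, h, hh⟩ := hM.exists_impulseResponse
  choose B hB using hh.exists_bound
  refine ⟨∑ i, ∑ j, B i j * ‖Matrix.single i j (1 : ℂ)‖, fun ω => ?_⟩
  rw [Matrix.matrix_eq_sum_single (freq M ω)]
  refine (norm_sum_le _ _).trans (Finset.sum_le_sum fun i _ => (norm_sum_le _ _).trans
    (Finset.sum_le_sum fun j _ => ?_))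
  rw [show Matrix.single i j (freq M ω i j) = freq M ω i j • Matrix.single i j (1 : ℂ) by simp,
    norm_smul]
  exact mul_le_mul_of_nonneg_right (hB i j ω) (norm_nonneg _)

/-- The weighting `(γ² I - T* T)⁻¹ T* T₂` belongs to `RL∞` if `‖T‖∞ < γ`. -/
lemma isRLInf_weighting {T : TransferMatrix p m} {T₂ : TransferMatrix p q} (hT : IsRLInf T)
    (hT₂ : IsRLInf T₂) (hg : 0 ≤ g) (hgγ : g < γ) (hgain : ∀ ω, ‖freq T ω‖ ≤ g) :
    IsRLInf ((RatFunc.C (γ ^ 2) • (1 : TransferMatrix m m) - paraConj T * T)⁻¹ *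
      paraConj T * T₂) ∧
    ∀ ω, (((γ : ℂ) ^ 2) • 1 - (freq T ω)ᴴ * freq T ω) *
      freq ((RatFunc.C (γ ^ 2) • (1 : TransferMatrix m m) - paraConj T * T)⁻¹ *
        paraConj T * T₂) ω = (freq T ω)ᴴ * freq T₂ ω := by
  have key : ∀ ω : ℝ, IsRegularAt ((ω : ℂ) * Complex.I)
      ((RatFunc.C (γ ^ 2) • (1 : TransferMatrix m m) - paraConj T * T)⁻¹ * paraConj T * T₂) ∧
    freq ((RatFunc.C (γ ^ 2) • (1 : TransferMatrix m m) - paraConj T * T)⁻¹ *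
        paraConj T * T₂) ω =
      (((γ : ℂ) ^ 2) • 1 - (freq T ω)ᴴ * freq T ω)⁻¹ * (freq T ω)ᴴ * freq T₂ ω := fun ω => by
    have h1 := (hT.isRegularAt ω).paraConj
    have h2 := h1.1.mul (hT.isRegularAt ω)
    have h3 := isRegularAt_smul_one (p := m) (C_mem_regularAt ((ω : ℂ) * Complex.I) (γ ^ 2))
    have h4 := h3.1.sub h2.1
    have h5 : (RatFunc.C (γ ^ 2) • (1 : TransferMatrix m m) - paraConj T * T).map
        (ratEval ((ω : ℂ) * Complex.I)) = ((γ : ℂ) ^ 2) • 1 - (freq T ω)ᴴ * freq T ω := by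
      rw [h4.2, h3.2, h2.2, ← h1.2]
      congr 2
      exact (RatFunc.eval_C _ _).trans (by simp)
    have h6 := h4.1.inv (h5 ▸ det_ne_zero_of_gain_lt hg hgγ (hgain ω))
    have h7 := h6.1.mul h1.1
    have h8 := h7.1.mul (hT₂.isRegularAt ω)
    refine ⟨h8.1, h8.2.trans ?_⟩
    rw [h7.2, h6.2, h5, ← h1.2]
    rfl
  have hmul : ∀ ω, (((γ : ℂ) ^ 2) • 1 - (freq T ω)ᴴ * freq T ω) *
      freq ((RatFunc.C (γ ^ 2) • (1 : TransferMatrix m m) - paraConj T * T)⁻¹ *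
        paraConj T * T₂) ω = (freq T ω)ᴴ * freq T₂ ω := fun ω => by
    rw [(key ω).2, Matrix.mul_assoc, Matrix.mul_nonsing_inv_cancel_left _ _
      (det_ne_zero_of_gain_lt hg hgγ (hgain ω)).isUnit]
  refine ⟨fun i j => ?_, hmul⟩
  obtain ⟨B, hB⟩ := exists_norm_freq_le hT₂
  -- The coercivity bound with ‖T*T₂‖ ≤ g B is independent of ω, and boundedness on the axis forces
  -- each entry to be proper.
  refine ⟨intDegree_nonpos_of_bounded (B := (γ ^ 2 - g ^ 2)⁻¹ * (g * B))
    (fun ω => (key ω).1 i j) fun ω => ?_, fun ω => (key ω).1 i j⟩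
  have h3 : 0 ≤ γ ^ 2 - g ^ 2 := by nlinarith
  refine (norm_entry_le (freq _ ω) i j).trans
    ((norm_le_of_gain_lt hg hgγ (hgain ω) (hmul ω)).trans ?_)
  gcongr
  refine (Matrix.l2_opNorm_mul _ _).trans ?_
  rw [Matrix.l2_opNorm_conjTranspose]
  exact mul_le_mul (hgain ω) (hB ω) (norm_nonneg _) hg

end

variable [Fintype q] [DecidableEq m] [DecidableEq p]
  {T : Matrix p m ℂ} {T₂ : Matrix p q ℂ} {W : Matrix m q ℂ} {γ : ℝ}

/-- Completion of the square: the worst weighting `W` turns the quadratic form of the dependent part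
into that of the worst-case cost. -/
lemma trace_worst_case (hγ : γ ≠ 0) (hdet : (((γ : ℂ) ^ 2) • 1 - Tᴴ * T).det ≠ 0)
    (hW : (((γ : ℂ) ^ 2) • 1 - Tᴴ * T) * W = Tᴴ * T₂) (S : Matrix q q ℂ) :
    (S * T₂ᴴ * (1 - ((γ : ℂ) ^ 2)⁻¹ • (T * Tᴴ))⁻¹ * T₂).trace =
      ((T * W + T₂) * S * (T * W + T₂)ᴴ).trace - (γ : ℂ) ^ 2 * (W * S * Wᴴ).trace := by
  have hγ' : (γ : ℂ) ^ 2 ≠ 0 := pow_ne_zero 2 (by exact_mod_cast hγ)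
  set N := ((γ : ℂ) ^ 2) • 1 - Tᴴ * T with hN
  set Q := 1 - ((γ : ℂ) ^ 2)⁻¹ • (T * Tᴴ) with hQ
  set F := T * W + T₂ with hF
  have hTT : Tᴴ * T = ((γ : ℂ) ^ 2) • 1 - N := by rw [hN]; abel
  -- This is the Woodbury identity; it moves the inverse from the output side, where J is written,
  -- to the input side, where W is defined.
  have hQinv : Q⁻¹ = 1 + T * N⁻¹ * Tᴴ := by
    refine Matrix.inv_eq_right_inv ?_
    have h1 : T * Tᴴ * (T * N⁻¹ * Tᴴ) = ((γ : ℂ) ^ 2) • (T * N⁻¹ * Tᴴ) - T * Tᴴ := by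
      calc T * Tᴴ * (T * N⁻¹ * Tᴴ) = T * (Tᴴ * T) * N⁻¹ * Tᴴ := by simp only [Matrix.mul_assoc]
        _ = _ := by
          rw [hTT, Matrix.mul_sub, Matrix.sub_mul, Matrix.sub_mul, Matrix.mul_assoc T N,
            Matrix.mul_nonsing_inv _ hdet.isUnit]
          simp
    rw [hQ, Matrix.mul_add, Matrix.mul_one, Matrix.sub_mul, Matrix.one_mul, Matrix.smul_mul, h1,
      smul_sub, smul_smul, inv_mul_cancel₀ hγ', one_smul]
    abel
  have hQF : Q⁻¹ * T₂ = F := by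
    have : W = N⁻¹ * (Tᴴ * T₂) := by
      rw [← hW, Matrix.nonsing_inv_mul_cancel_left _ _ hdet.isUnit]
    rw [hQinv, hF, this, Matrix.add_mul, Matrix.one_mul, add_comm]
    simp only [Matrix.mul_assoc]
  -- Adjoint of the stationarity equation T*F = γ²W, which converts the cross term F*TW into γ²W*W.
  have hzero : Fᴴ * T = ((γ : ℂ) ^ 2) • Wᴴ := by
    have h2 : Tᴴ * F = ((γ : ℂ) ^ 2) • W := by
      rw [hF, Matrix.mul_add, ← hW, ← Matrix.mul_assoc, hTT, Matrix.sub_mul, Matrix.smul_mul,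
        Matrix.one_mul]
      abel
    have h3 := congrArg Matrix.conjTranspose h2
    rw [Matrix.conjTranspose_mul, Matrix.conjTranspose_conjTranspose,
      Matrix.conjTranspose_smul] at h3
    simpa using h3
  have hQh : Qᴴ = Q := by
    rw [hQ]
    simp [Matrix.conjTranspose_sub, Matrix.conjTranspose_smul]
  have hkey : T₂ᴴ * Q⁻¹ * T₂ = Fᴴ * F - ((γ : ℂ) ^ 2) • (Wᴴ * W) := by
    have h4 : T₂ᴴ * Q⁻¹ = Fᴴ := by
      rw [← hQF, Matrix.conjTranspose_mul, Matrix.conjTranspose_nonsing_inv, hQh]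
    rw [h4]
    nth_rewrite 3 [hF]
    rw [Matrix.mul_add, ← Matrix.mul_assoc, hzero, Matrix.smul_mul]
    abel
  rw [Matrix.mul_assoc, Matrix.mul_assoc, ← Matrix.mul_assoc T₂ᴴ, hkey, Matrix.mul_sub,
    Matrix.trace_sub, Matrix.mul_smul, Matrix.trace_smul, smul_eq_mul,
    Matrix.trace_mul_comm (F * S), ← Matrix.mul_assoc Fᴴ, Matrix.trace_mul_comm (Fᴴ * F),
    Matrix.trace_mul_comm (W * S), ← Matrix.mul_assoc Wᴴ, Matrix.trace_mul_comm (Wᴴ * W)]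

end

/-! ### Powers of sums and worst-case bounds -/

lemma IsTraceIntegral.unique {ι : Type*} [Fintype ι] {μ : Measure ℝ} {G : ℝ → Matrix ι ι ℂ}
    {a b : ℝ} (ha : IsTraceIntegral μ G a) (hb : IsTraceIntegral μ G b) : a = b := by
  exact_mod_cast ha.2.trans hb.2.symm

section

variable {ι : Type*} [Fintype ι] {u v : Signal ι} {μ ν : Measure ℝ} [SigmaFinite μ] [SigmaFinite ν]
  {S S' : ℝ → Matrix ι ι ℂ}

/-- Pythagoras for uncorrelated signals. -/
lemma IsSpectralDensity.add_of_uncorrelated (hu : BddSignal u) (hv : BddSignal v)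
    (huu : IsSpectralDensity u u μ S) (hvv : IsSpectralDensity v v ν S')
    (huv : Orthogonal u v) :
    BoundedPower (u + v) ∧ powerNorm (u + v) ^ 2 = powerNorm u ^ 2 + powerNorm v ^ 2 := by
  -- The spectra of u and v may be mutually singular; both are absolutely continuous with respect to
  -- μ + ν, over which the densities can be added.
  have hc := IsSpectralDensity.zero_of_orthogonal huv (μ + ν)
  have hc' := hc.swap hu hv
  have h1 := huu.change_measure (Measure.absolutelyContinuous_of_le (Measure.le_add_right le_rfl) :
    μ ≪ μ + ν)
  have h2 := hvv.change_measure (Measure.absolutelyContinuous_of_le (Measure.le_add_left le_rfl) :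
    ν ≪ μ + ν)
  have h3 := (h1.add hu hv hu hc').swap (hu.add hv) hu
  have h4 := (hc.add hu hv hv h2).swap (hu.add hv) hv
  have h5 := h3.add hu hv (hu.add hv) h4
  refine ⟨(hu.add hv).boundedPower h5, HasTimeAvg.powerNorm_sq ?_⟩
  obtain ⟨c, hc1, hc2⟩ := hc.hasTimeAvg_dotProduct hu hv
  have hc0 : c = 0 := by simpa using hc2.2
  have huv' := (((huu.hasTimeAvg_powerNorm hu).1.add (hu.dotProduct hu) (hv.dotProduct hv)
    (hvv.hasTimeAvg_powerNorm hv).1).add ((hu.dotProduct hu).add (hv.dotProduct hv))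
    ((hu.dotProduct hv).const_mul 2) (hc1.const_mul 2))
  rw [hc0, mul_zero, add_zero] at huv'
  convert huv' using 2 with t
  simp only [Pi.add_apply, add_dotProduct, dotProduct_add, dotProduct_comm (v t) (u t)]
  ring

end

/-! ### Powers of signals generated from the reference. -/

namespace IsResponse

variable {p q m : Type} [Fintype m] {F : ℝ → Matrix p m ℂ} {r : Signal m} {a b : Signal p}

lemma zero : IsResponse (fun _ => (0 : Matrix p m ℂ)) r (0 : Signal p) :=
  ⟨fun _ => BddSignal.zero, fun _ _ v _ μ _ S _ => by
    simpa using IsSpectralDensity.zero_of_orthogonal (orthogonal_zero (v := v)) μ⟩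

lemma of_isLTIOutput [Fintype p] {M : TransferMatrix q p} {y : Signal q}
    (hy : IsLTIOutput M a y) (ha : IsResponse F r a) : IsResponse (fun ω => freq M ω * F ω) r y := by
  obtain ⟨D, h, hM, rfl⟩ := isLTIOutput_iff.1 hy
  exact ha.ltiResp hM

lemma of_input [DecidableEq m] {M : TransferMatrix q m} {y : Signal q}
    (hy : IsLTIOutput M r y) : IsResponse (freq M) r y :=
  ((refl r).of_isLTIOutput hy).congr fun _ => Matrix.mul_one _

variable [Fintype p] {μ : Measure ℝ} [SigmaFinite μ] {S : ℝ → Matrix m m ℂ}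

lemma power (ha : IsResponse F r a) (hr : BddSignal r) (hS : IsSpectralDensity r r μ S) :
    HasTimeAvg (fun t => a t ⬝ᵥ a t) (powerNorm a ^ 2) ∧
      IsTraceIntegral μ (fun ω => F ω * S ω * (F ω)ᴴ) (powerNorm a ^ 2) :=
  (ha.spectral_mul ha hr hS).hasTimeAvg_powerNorm (ha.bdd hr)

lemma boundedPower (ha : IsResponse F r a) (hr : BddSignal r) (hS : IsSpectralDensity r r μ S) :
    BoundedPower a :=
  (ha.bdd hr).boundedPower (ha.spectral_mul ha hr hS)

lemma powerNorm_sq_eq (ha : IsResponse F r a) (hb : IsResponse F r b) (hr : BddSignal r)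
    (hS : IsSpectralDensity r r μ S) : powerNorm a ^ 2 = powerNorm b ^ 2 :=
  (ha.power hr hS).2.unique (hb.power hr hS).2

/-- A signal with zero frequency response is uncorrelated with every bounded signal. -/
lemma hasTimeAvg_mul_of_eq_zero (ha : IsResponse F r a) (hF : ∀ ω, F ω = 0) (hr : BddSignal r)
    (hS : IsSpectralDensity r r μ S) (hb : BddSignal b) :
    HasTimeAvg (fun t => a t ⬝ᵥ b t) 0 := by
  -- A zero response has zero power in each component, which already kills its averages against any
  -- bounded signal; b needs no spectrum.
  have haa := (ha.congr hF).spectral_mul (ha.congr hF) hr hS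
  simp only [Matrix.zero_mul] at haa
  have hi : ∀ i, HasTimeAvg (fun t => a t i ^ 2) 0 := fun i => by
    obtain ⟨c, hc1, hc2⟩ := ((isSpectralDensity_iff.1 haa) i i).hasTimeAvg
    have hc0 : c = 0 := by simpa using hc2
    simpa only [hc0, sq] using hc1
  have hab := ha.bdd hr
  have := HasTimeAvg.sum Finset.univ (fun i _ => (hab.bddFun i).mul (hb.bddFun i)) fun i _ =>
    (hi i).zero_mul_of_sq (hab.bddFun i) (hb.bddFun i)
  rw [Finset.sum_const_zero] at this
  exact this

end IsResponse

/-! ### The worst-case bound in the time domain. -/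

section

variable {p q m : Type} [Fintype p] [Fintype q] [Fintype m]
  {T : TransferMatrix p m} {r : Signal q} {μ : Measure ℝ} [SigmaFinite μ]
  {S : ℝ → Matrix q q ℂ} {F₂ : ℝ → Matrix p q ℂ} {F : ℝ → Matrix m q ℂ}

/-- Worst-case bound: no input `w` does better than the stationary one `w'`. -/
lemma power_sub_le {D : Matrix p m ℝ} {h : ℝ → Matrix p m ℝ} (hT : IsImpulseResponse T D h)
    (hreg : ∀ ω : ℝ, IsRegularAt ((ω : ℂ) * Complex.I) T) {γ : ℝ}
    (hgain : ∀ (ω : ℝ) (x : m → ℂ),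
      ∑ i, ‖∑ j, freq T ω i j * x j‖ ^ 2 ≤ γ ^ 2 * ∑ j, ‖x j‖ ^ 2)
    (hr : BddSignal r) (hS : IsSpectralDensity r r μ S) {z₂ : Signal p} (hz₂ : IsResponse F₂ r z₂)
    {w' : Signal m} (hw' : IsResponse F r w')
    (hstat : ∀ ω, (freq T ω)ᴴ * (freq T ω * F ω + F₂ ω) = ((γ : ℂ) ^ 2) • F ω)
    {w : Signal m} (hw : BddSignal w) {a b : ℝ}
    (ha : HasTimeAvg (fun t => (ltiResp D h w + z₂) t ⬝ᵥ (ltiResp D h w + z₂) t) a)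
    (hb : HasTimeAvg (fun t => w t ⬝ᵥ w t) b) :
    a - γ ^ 2 * b ≤ powerNorm (ltiResp D h w' + z₂) ^ 2 - γ ^ 2 * powerNorm w' ^ 2 := by
  have hw'b := hw'.bdd hr
  set e := w - w' with he
  have heb : BddSignal e := hw.sub hw'b
  have hy : IsResponse (fun ω => freq T ω * F ω + F₂ ω) r (ltiResp D h w' + z₂) :=
    (hw'.ltiResp hT).add hz₂
  set y := ltiResp D h w' + z₂ with hydef
  have hyb := hy.bdd hr
  have hTe : BddSignal (ltiResp D h e) := heb.ltiResp hT.1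
  have hz : ltiResp D h w + z₂ = y + ltiResp D h e := by
    have : w = w' + e := by rw [he]; abel
    rw [this, ltiResp_add hT.1 hw'b heb, hydef]
    abel
  have hzb : BddSignal (ltiResp D h w + z₂) := hz ▸ hyb.add hTe
  -- the first variation at `w'` vanishes
  have hvar : IsResponse (fun ω => freq (paraConj T) ω * (freq T ω * F ω + F₂ ω) +
      ((-γ ^ 2 : ℝ) : ℂ) • F ω) r
      (ltiResp Dᵀ (fun t => (h (-t))ᵀ) y + (-γ ^ 2) • w') :=
    (hy.ltiResp (hT.paraConj hreg)).add (hw'.const_smul _)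
  have hcross := hvar.hasTimeAvg_mul_of_eq_zero (fun ω => by
    rw [(hreg ω).paraConj.2, hstat]
    simp) hr hS heb
  -- Only this replacement of ⟨y, Te⟩ by ⟨T*y, e⟩ lets stationarity be used, as e has no known
  -- correlation with r.
  have hadj := hasTimeAvg_ltiResp_adjoint hT.1 hyb heb (D := D)
  have hyT : BddSignal (ltiResp Dᵀ (fun t => (h (-t))ᵀ) y) := hyb.ltiResp (hT.paraConj hreg).1
  have hvb : BddSignal (ltiResp Dᵀ (fun t => (h (-t))ᵀ) y + (-γ ^ 2) • w') := hvar.bdd hr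
  have hadjb := (hyb.dotProduct hTe).sub (hyT.dotProduct heb)
  have h1 := hadj.add hadjb (hvb.dotProduct heb) hcross
  rw [add_zero] at h1
  have h1b := hadjb.add (hvb.dotProduct heb)
  have h2 := ha.sub (hzb.dotProduct hzb) ((hw.dotProduct hw).const_mul (γ ^ 2))
    (hb.const_mul (γ ^ 2))
  have h2b := (hzb.dotProduct hzb).sub ((hw.dotProduct hw).const_mul (γ ^ 2))
  have h3 := (hy.power hr hS).1.sub (hyb.dotProduct hyb) ((hw'b.dotProduct hw'b).const_mul (γ ^ 2))
    ((hw'.power hr hS).1.const_mul (γ ^ 2))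
  have h3b := (hyb.dotProduct hyb).sub ((hw'b.dotProduct hw'b).const_mul (γ ^ 2))
  have h4 := (h2.sub h2b h3b h3).sub (h2b.sub h3b) (h1b.const_mul 2) (h1.const_mul 2)
  rw [mul_zero, sub_zero] at h4
  -- The average on the left is not assumed to exist: expanding the squares expresses its integrand
  -- by ones with known averages, and its limit is the gap between the two costs.
  have h5 : HasTimeAvg (fun t => ltiResp D h e t ⬝ᵥ ltiResp D h e t - γ ^ 2 * (e t ⬝ᵥ e t))
      (a - γ ^ 2 * b - (powerNorm y ^ 2 - γ ^ 2 * powerNorm w' ^ 2)) := by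
    convert h4 using 2 with t
    have hwt : w t = w' t + e t := by simp [he]
    rw [hz, hwt]
    simp only [Pi.add_apply, Pi.smul_apply, add_dotProduct, dotProduct_add, smul_dotProduct,
      smul_eq_mul, dotProduct_comm (ltiResp D h e t) (y t), dotProduct_comm (e t) (w' t)]
    ring
  refine sub_nonpos.1 (le_of_forall_pos_le_add fun ε hε => ?_)
  rw [zero_add]
  refine le_of_tendsto h5 (eventually_avg_gain_le hT.1 (fun ω x => ?_) heb hε)
  simpa only [← hT.freq_eq] using hgain ω x

end

/-! ### Orthogonality under filtering and the power decomposition. -/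

section

variable {p q m : Type} [Fintype p] [Fintype q] [Fintype m]

lemma IsTraceIntegral.sub_mul {μ : Measure ℝ} {G : ℝ → Matrix q q ℂ} {G₁ : ℝ → Matrix p p ℂ}
    {G₂ : ℝ → Matrix m m ℂ} {a b : ℝ} (c : ℝ) (h₁ : IsTraceIntegral μ G₁ a)
    (h₂ : IsTraceIntegral μ G₂ b) (h : ∀ ω, (G ω).trace = (G₁ ω).trace - (c : ℂ) * (G₂ ω).trace) :
    IsTraceIntegral μ G (a - c * b) := by
  rw [IsTraceIntegral]
  simp only [h]
  refine ⟨h₁.1.sub (h₂.1.const_mul _), ?_⟩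
  rw [integral_sub h₁.1 (h₂.1.const_mul _), integral_const_mul]
  push_cast
  rw [h₁.2, h₂.2]
  ring

lemma Orthogonal.response {p' q' : Type} {u : Signal m} {r : Signal q} {a : Signal p'}
    {b : Signal q'} {F : ℝ → Matrix p' m ℂ} {G : ℝ → Matrix q' q ℂ} (h : Orthogonal u r)
    (hu : BddSignal u) (hr : BddSignal r) (ha : IsResponse F u a) (hb : IsResponse G r b) :
    Orthogonal a b :=
  (ha.spectral hu b (hb.bdd hr) volume _ (hb.spectral_right hr hu h)).congr fun ω => by simp

end

section

variable {n m₁ m₂ p₁ p₂ k c : Type} [Fintype n] [Fintype m₁] [Fintype m₂]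
  [Fintype p₂] [Fintype k] [Fintype c] [DecidableEq n] [DecidableEq k] [DecidableEq c]
  [DecidableEq p₂]
  {P : Plant n m₁ m₂ p₁ p₂} {C : Controller c m₂ p₂} {K : Controller k m₂ p₂}
  {L : Matrix n p₂ ℝ} {Lc : Matrix c m₂ ℝ} {r : Signal p₂} {W : TransferMatrix m₁ p₂}
  {Wr w₁ : Signal m₁} {z z₁ z₂ z₂' : Signal p₁}

lemma IsDependentPart.isResponse (h : IsDependentPart P C K r W Wr z₂ z₂') :
    IsResponse (freq W) r Wr ∧ IsResponse (freq (Tz2r P C)) r z₂ ∧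
      IsResponse (fun ω => freq (Tz1w P K) ω * freq W ω + freq (Tz2r P C) ω) r z₂' := by
  obtain ⟨v, hv, hz₂'⟩ := h.output_z₂'
  have h1 := IsResponse.of_input h.output_W
  have h2 := IsResponse.of_input h.output_z₂
  exact ⟨h1, h2, hz₂' ▸ (h1.of_isLTIOutput hv).add h2⟩

/-- The powers of the signals in the loop when the disturbance splits into a part depending linearly
on the reference and a part orthogonal to it. -/
lemma IsDependentPart.power_decomposition [Fintype p₁] [DecidableEq m₁] (hC : Stabilizes P C) (hK : Stabilizes P K)
    (hr : BoundedPower r) (hdep : IsDependentPart P C K r W Wr z₂ z₂') (hw₁ : BoundedPower w₁)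
    (hor : Orthogonal w₁ r) (hoW : Orthogonal w₁ Wr)
    (hz : IsClosedLoopOutput P C K L Lc (Wr + w₁) r z) (hz₁ : IsLTIOutput (Tz1w P K) w₁ z₁) :
    BoundedPower (Wr + w₁) ∧ BoundedPower z ∧
      powerNorm (Wr + w₁) ^ 2 = powerNorm w₁ ^ 2 + powerNorm Wr ^ 2 ∧
      powerNorm z ^ 2 = powerNorm z₁ ^ 2 + powerNorm z₂' ^ 2 := by
  obtain ⟨μ, _, S, hS⟩ := hr.spectral
  obtain ⟨ν, _, S₁, hS₁⟩ := hw₁.spectral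
  have hrb := hr.bddSignal
  have hw₁b := hw₁.bddSignal
  obtain ⟨hWr, -, hz₂'⟩ := hdep.isResponse
  have hWrb := hWr.bdd hrb
  have hw := hS₁.add_of_uncorrelated hw₁b hWrb (hWr.spectral_mul hWr hrb hS) hoW
  rw [add_comm w₁ Wr] at hw
  obtain ⟨v, y₂, hv, hy₂, rfl⟩ := hz.eq_add hC hK (hWrb.add hw₁b) hrb
  obtain ⟨D, h, hM, rfl⟩ := isLTIOutput_iff.1 hv
  have ha := IsResponse.of_input (isLTIOutput_iff.2 ⟨D, h, hM, rfl⟩ : IsLTIOutput _ w₁ _)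
  have hb := (hWr.ltiResp hM).add (IsResponse.of_input hy₂)
  have hab := (ha.spectral_mul ha hw₁b hS₁).add_of_uncorrelated (ha.bdd hw₁b) (hb.bdd hrb)
    (hb.spectral_mul hb hrb hS) (hor.response hw₁b hrb ha hb)
  -- Group z into a filtered w₁ and a filtered r; these two are orthogonal. Outputs produced by
  -- other impulse responses of the same transfer matrices have equal power, since power depends
  -- only on the frequency response.
  have hsum : ltiResp D h w₁ + (ltiResp D h Wr + y₂) = ltiResp D h (Wr + w₁) + y₂ := by
    rw [ltiResp_add hM.1 hWrb hw₁b]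
    abel
  rw [hsum, ha.powerNorm_sq_eq (IsResponse.of_input hz₁) hw₁b hS₁,
    hb.powerNorm_sq_eq hz₂' hrb hS] at hab
  exact ⟨hw.1, hab.1, hw.2, hab.2⟩

end

end MOCC

end

/-! ### The main theorem. -/

open MOCC in
theorem theorem2 {n m₁ m₂ p₁ p₂ k c : ℕ}
    (P : Plant (Fin n) (Fin m₁) (Fin m₂) (Fin p₁) (Fin p₂))
    (C : Controller (Fin c) (Fin m₂) (Fin p₂)) (K : Controller (Fin k) (Fin m₂) (Fin p₂))
    (L : Matrix (Fin n) (Fin p₂) ℝ) (Lc : Matrix (Fin c) (Fin m₂) ℝ)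
    (hC : Stabilizes P C) (hK : Stabilizes P K)
    (hL : IsHurwitz (P.A + L * P.C₂)) (hLc : IsHurwitz (C.A + Lc * C.C))
    (r : Signal (Fin p₂)) (hr : BoundedPower r)
    (μ : Measure ℝ) [SigmaFinite μ] (S : ℝ → Matrix (Fin p₂) (Fin p₂) ℂ)
    (hS : IsSpectralDensity r r μ S) :
    -- the decompositions of `‖z‖²` and of `‖z‖² - γ² ‖w‖²`
    (∀ (W : TransferMatrix (Fin m₁) (Fin p₂)) (Wr w₁ w : Signal (Fin m₁))
        (z z₁ z₂ z₂' : Signal (Fin p₁)),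
      IsDependentPart P C K r W Wr z₂ z₂' →
      BoundedPower w₁ → Orthogonal w₁ r → Orthogonal w₁ Wr → w = Wr + w₁ →
      IsClosedLoopOutput P C K L Lc w r z → IsLTIOutput (Tz1w P K) w₁ z₁ →
      BoundedPower Wr ∧ BoundedPower w ∧ BoundedPower z ∧ BoundedPower z₁ ∧
      BoundedPower z₂ ∧ BoundedPower z₂' ∧
      powerNorm z ^ 2 = powerNorm z₁ ^ 2 + powerNorm z₂' ^ 2 ∧
      (∀ γ : ℝ, powerNorm z ^ 2 - γ ^ 2 * powerNorm w ^ 2 =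
        powerNorm z₁ ^ 2 - γ ^ 2 * powerNorm w₁ ^ 2 +
          (powerNorm z₂' ^ 2 - γ ^ 2 * powerNorm Wr ^ 2)) ∧
      (∀ (ν : Measure ℝ) (_ : SigmaFinite ν) (S₁ : ℝ → Matrix (Fin m₁) (Fin m₁) ℂ),
        IsSpectralDensity w₁ w₁ ν S₁ →
        IsTraceIntegral ν (fun ω => freq (Tz1w P K) ω * S₁ ω * (freq (Tz1w P K) ω)ᴴ)
          (powerNorm z₁ ^ 2)) ∧
      IsTraceIntegral μ (fun ω => freq (Tz2r P C) ω * S ω * (freq (Tz2r P C) ω)ᴴ)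
        (powerNorm z₂ ^ 2)) ∧
    -- the worst case under `‖T_{z₁w}‖∞ < γ`
    (∀ γ : ℝ, 0 < γ → hinfNorm (Tz1w P K) < ENNReal.ofReal γ →
      ∃ J : ℝ,
        IsTraceIntegral μ (fun ω => S ω * (freq (Tz2r P C) ω)ᴴ *
          (1 - ((γ : ℂ) ^ 2)⁻¹ • (freq (Tz1w P K) ω * (freq (Tz1w P K) ω)ᴴ))⁻¹ *
          freq (Tz2r P C) ω) J ∧
        -- the supremum over `W ∈ RL∞` is `J`, and `W̃` attains it
        IsLUB {a : ℝ | ∃ W Wr z₂ z₂', IsDependentPart P C K r W Wr z₂ z₂' ∧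
          a = powerNorm z₂' ^ 2 - γ ^ 2 * powerNorm Wr ^ 2} J ∧
        (∃ Wr z₂ z₂', IsDependentPart P C K r (worstWeighting P C K γ) Wr z₂ z₂' ∧
          powerNorm z₂' ^ 2 - γ ^ 2 * powerNorm Wr ^ 2 = J) ∧
        -- the supremum over `w`
        ∃ s₁ : ℝ,
          IsLUB {a : ℝ | ∃ w₁ z₁, BoundedPower w₁ ∧ IsLTIOutput (Tz1w P K) w₁ z₁ ∧
            a = powerNorm z₁ ^ 2 - γ ^ 2 * powerNorm w₁ ^ 2} s₁ ∧
          IsLUB {a : ℝ | ∃ w z, BoundedPower w ∧ IsClosedLoopOutput P C K L Lc w r z ∧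
            BoundedPower z ∧ a = powerNorm z ^ 2 - γ ^ 2 * powerNorm w ^ 2} (s₁ + J) ∧
          IsLUB {a : ℝ | ∃ W Wr z₂ z₂' w₁ w z, IsDependentPart P C K r W Wr z₂ z₂' ∧
            BoundedPower w₁ ∧ Orthogonal w₁ r ∧ Orthogonal w₁ Wr ∧ w = Wr + w₁ ∧
            IsClosedLoopOutput P C K L Lc w r z ∧
            a = powerNorm z ^ 2 - γ ^ 2 * powerNorm w ^ 2} (s₁ + J) ∧
          s₁ + J ≤ J) := by
  have hrb := hr.bddSignal
  refine ⟨fun W Wr w₁ w z z₁ z₂ z₂' hdep hw₁ hor hoW hw hz hz₁ => ?_, fun γ hγ hlt => ?_⟩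
  · subst hw
    obtain ⟨hw, hzP, hpw, hpz⟩ := hdep.power_decomposition hC hK hr hw₁ hor hoW hz hz₁
    obtain ⟨hWr, hz₂, hz₂'⟩ := hdep.isResponse
    have hz₁R := IsResponse.of_input hz₁
    obtain ⟨ν, _, S₁, hS₁⟩ := hw₁.spectral
    refine ⟨hWr.boundedPower hrb hS, hw, hzP, hz₁R.boundedPower hw₁.bddSignal hS₁,
      hz₂.boundedPower hrb hS, hz₂'.boundedPower hrb hS, hpz, fun γ => ?_,
      fun ν _ S₁ hS₁ => (hz₁R.power hw₁.bddSignal hS₁).2, (hz₂.power hrb hS).2⟩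
    rw [hpz, hpw]
    ring
  · obtain ⟨g, hg, hgγ, hgain⟩ := norm_le_of_hinfNorm_lt hγ hlt
    have hT : IsRLInf (Tz1w P K) := hK.isRLInf_stateSpaceTF
    have hT₂ : IsRLInf (Tz2r P C) := hC.isRLInf_stateSpaceTF
    obtain ⟨hW, hstat⟩ := isRLInf_weighting hT hT₂ hg hgγ hgain
    obtain ⟨D, h, hM⟩ := hT.exists_impulseResponse
    obtain ⟨D₂, h₂, hM₂⟩ := hT₂.exists_impulseResponse
    obtain ⟨D₃, h₃, hM₃⟩ := hW.exists_impulseResponse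
    have hdep : IsDependentPart P C K r (worstWeighting P C K γ) (ltiResp D₃ h₃ r)
        (ltiResp D₂ h₂ r) (ltiResp D h (ltiResp D₃ h₃ r) + ltiResp D₂ h₂ r) :=
      ⟨hW, isLTIOutput_iff.2 ⟨_, _, hM₃, rfl⟩, isLTIOutput_iff.2 ⟨_, _, hM₂, rfl⟩,
        _, isLTIOutput_iff.2 ⟨_, _, hM, rfl⟩, rfl⟩
    set wr := ltiResp D₃ h₃ r
    set y₂ := ltiResp D₂ h₂ r
    set y := ltiResp D h wr + y₂
    obtain ⟨hwr, -, hy⟩ := hdep.isResponse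
    have hgain' : ∀ (ω : ℝ) (x : Fin m₁ → ℂ),
        ∑ i, ‖∑ j, freq (Tz1w P K) ω i j * x j‖ ^ 2 ≤ γ ^ 2 * ∑ j, ‖x j‖ ^ 2 := fun ω x =>
      sum_norm_sq_mul_le _ ((hgain ω).trans hgγ.le) x
    -- no disturbance does better than the worst dependent weighting
    have hle : ∀ {w : Signal (Fin m₁)} {v z₂ : Signal (Fin p₁)} {a b : ℝ}, BddSignal w →
        IsLTIOutput (Tz1w P K) w v → IsLTIOutput (Tz2r P C) r z₂ →
        HasTimeAvg (fun t => (v + z₂) t ⬝ᵥ (v + z₂) t) a → HasTimeAvg (fun t => w t ⬝ᵥ w t) b →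
        a - γ ^ 2 * b ≤ powerNorm y ^ 2 - γ ^ 2 * powerNorm wr ^ 2 := by
      intro w v z₂ a b hw hv hz₂ ha hb
      obtain ⟨D', h', hM', rfl⟩ := isLTIOutput_iff.1 hv
      have hz₂R := IsResponse.of_input hz₂
      -- The equation (γ² - T*T)W̃ = T*T₂ is rearranged into T*(T W̃ + T₂) = γ² W̃.
      have := power_sub_le hM' hT.isRegularAt hgain' hrb hS hz₂R hwr (fun ω => by
        rw [Matrix.mul_add, ← hstat, ← Matrix.mul_assoc, Matrix.sub_mul, Matrix.smul_mul,
          Matrix.one_mul]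
        exact add_sub_cancel _ _) hw ha hb
      rwa [((hwr.ltiResp hM').add hz₂R).powerNorm_sq_eq hy hrb hS] at this
    -- The maximizing disturbance is W̃(r) with w₁ = 0; its closed-loop output witnesses attainment
    -- in both suprema over w.
    obtain ⟨z, hz⟩ := exists_isClosedLoopOutput P C K L Lc ((hwr.bdd hrb).add BddSignal.zero) hrb
    have hz₁ : IsLTIOutput (Tz1w P K) 0 0 := isLTIOutput_iff.2 ⟨D, h, hM, ltiResp_zero.symm⟩
    obtain ⟨hwP, hzP, hpw, hpz⟩ := hdep.power_decomposition hC hK hr boundedPower_zero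
      orthogonal_zero orthogonal_zero hz hz₁
    have hval : powerNorm y ^ 2 - γ ^ 2 * powerNorm wr ^ 2 =
        powerNorm z ^ 2 - γ ^ 2 * powerNorm (wr + 0) ^ 2 := by
      rw [hpw, hpz, powerNorm_zero, powerNorm_zero]
      ring
    have hbound : ∀ {w z}, BoundedPower w → IsClosedLoopOutput P C K L Lc w r z → BoundedPower z →
        powerNorm z ^ 2 - γ ^ 2 * powerNorm w ^ 2 ≤
          powerNorm y ^ 2 - γ ^ 2 * powerNorm wr ^ 2 := fun {w z} hw hz hzP => by
      obtain ⟨v, z₂, hv, hz₂, rfl⟩ := hz.eq_add hC hK hw.bddSignal hrb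
      exact hle hw.bddSignal hv hz₂ hzP.hasTimeAvg hw.hasTimeAvg
    -- J is introduced as the cost at W̃, and its trace formula is derived afterwards. The
    -- independent part contributes s₁ = 0, so s₁ + J ≤ J holds with equality.
    refine ⟨powerNorm y ^ 2 - γ ^ 2 * powerNorm wr ^ 2, ?_, ?_, ⟨wr, y₂, y, hdep, rfl⟩, 0, ?_, ?_, ?_,
      (zero_add _).le⟩
    · refine (hy.power hrb hS).2.sub_mul (γ ^ 2) (hwr.power hrb hS).2 fun ω => ?_
      rw [trace_worst_case hγ.ne' (det_ne_zero_of_gain_lt hg hgγ (hgain ω)) (hstat ω)]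
      push_cast
      rfl
    · refine IsGreatest.isLUB ⟨⟨_, wr, y₂, y, hdep, rfl⟩, ?_⟩
      rintro a ⟨W, Wr, z₂, z₂', hd, rfl⟩
      obtain ⟨hWr, -, hz₂'⟩ := hd.isResponse
      obtain ⟨v, hv, rfl⟩ := hd.output_z₂'
      exact hle (hWr.bdd hrb) hv hd.output_z₂ (hz₂'.power hrb hS).1 (hWr.power hrb hS).1
    · refine IsGreatest.isLUB ⟨⟨0, 0, boundedPower_zero, hz₁, by simp [powerNorm_zero]⟩, ?_⟩
      rintro a ⟨w₁, z₁, hw₁, hz₁, rfl⟩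
      obtain ⟨ν, _, S₁, hS₁⟩ := hw₁.spectral
      have ha := ((IsResponse.of_input hz₁).power hw₁.bddSignal hS₁).1
      obtain ⟨D', h', hM', rfl⟩ := isLTIOutput_iff.1 hz₁
      rw [← add_zero (ltiResp D' h' w₁)] at ha
      -- With z₂ = 0 and stationary input 0 the worst-case bound reads ‖z₁‖² ≤ γ²‖w₁‖².
      have := power_sub_le hM' hT.isRegularAt hgain' hrb hS IsResponse.zero IsResponse.zero
        (fun ω => by simp) hw₁.bddSignal ha hw₁.hasTimeAvg
      simpa [ltiResp_zero, powerNorm_zero] using this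
    · rw [zero_add]
      refine IsGreatest.isLUB ⟨⟨_, z, hwP, hz, hzP, hval⟩, ?_⟩
      rintro a ⟨w, z, hw, hz, hzP, rfl⟩
      exact hbound hw hz hzP
    · rw [zero_add]
      refine IsGreatest.isLUB ⟨⟨_, wr, y₂, y, 0, _, z, hdep, boundedPower_zero, orthogonal_zero,
        orthogonal_zero, rfl, hz, hval⟩, ?_⟩
      rintro a ⟨W, Wr, z₂, z₂', w₁, w, z, hd, hw₁, hor, hoW, rfl, hz, rfl⟩
      have hd' := hd.power_decomposition hC hK hr hw₁ hor hoW hz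
        (isLTIOutput_iff.2 ⟨D, h, hM, rfl⟩)
      exact hbound hd'.1 hz hd'.2.1
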